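/- **Groupoid of an atlas.** All manifolds are smooth, finite-dimensional, Hausdorff and second countable. A *foliation* $\mathcal F$ on a manifold $M$ is a locally finitely generated $C^\infty(M)$-submodule of $C_c^\infty(M;TM)$ that is stable under Lie brackets. For a smooth map $p:N\to M$, let $p^*(\mathcal F)$ be the set of finite sums of sections $f\cdot(\xi\circ p)$ of $p^*(TM)$ with $f\in C_c^\infty(N)$, $\xi\in\mathcal F$, and let $p^{-1}(\mathcal F)=\{X\in C_c^\infty(N;TN) : dp(X)\in p^*(\mathcal F)\}$. A *bi-submersion* of $(M,\mathcal F)$ is a manifold $U$ with two submersions $t,s:U\to M$ such that $s^{-1}(\mathcal F)=t^{-1}(\mathcal F)=C_c^\infty(U;\ker ds)+C_c^\infty(U;\ker dt)$. A *local morphism* from $(U,t_U,s_U)$ to $(V,t_V,s_V)$ is a smooth map $f:U'\to V$, with $U'\subset U$ open, such that $s_V\circ f=s_U$ and $t_V\circ f=t_U$ on $U'$. The *inverse* of $(U,t,s)$ is $U^{-1}=(U,s,t)$; the *composition* $U\circ V$ is the submanifold $\{(u,v)\in U\times V : s_U(u)=t_V(v)\}$ of $U\times V$ with the maps $t(u,v)=t_U(u)$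 and $s(u,v)=s_V(v)$. Given a family $\mathcal U=(U_i,t_i,s_i)_{i\in I}$ of bi-submersions of $(M,\mathcal F)$, a bi-submersion $U$ is *adapted* to $\mathcal U$ if every $u\in U$ lies in the domain of a local morphism from $U$ to some $U_i$. The family $\mathcal U$ is an *atlas* if $\bigcup_i s_i(U_i)=M$ and if the inverse of every $U_i$ and the composition $U_i\circ U_j$ of any two members are adapted to $\mathcal U$. Let $\mathcal U=(U_i,t_i,s_i)_{i\in I}$ be an atlas of bi-submersions of a foliation $(M,\mathcal F)$. (a) On $\coprod_{i\in I}U_i$, the relation "$U_i\ni u\sim v\in U_j$ if there is a local morphism from $U_i$ to $U_j$ mapping $u$ to $v$" is an equivalence relation. Let $G=G_{\mathcal U}$ be the quotient and $q_i:U_i\to G$ the quotient maps. (b) There are maps $t,s:G\to M$ such that $s\circ q_i=s_i$ and $t\circ q_i=t_i$ for all $i\in I$. (c) For every bi-submersion $(U,t_U,s_U)$ adapted to $\mathcal U$ there is a map $q_U:U\to G$ such that, for every $i\in I$, every local morphism $f:U'\subset U\to U_i$ and every $u\in U'$, we have $q_U(u)=q_i(f(u))$. (d) For all $i,j\in I$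 the composition $U_i\circ U_j$ is a bi-submersion, and there is a groupoid structure on $G$ with set of objects $M$ and with the source and target maps $s$ and $t$ of (b), such that $q_i(u)\,q_j(v)=q_{U_i\circ U_j}(u,v)$ for all $i,j\in I$, $u\in U_i$, $v\in U_j$ with $s_i(u)=t_j(v)$. -/

import Mathlib

open scoped Manifold ContDiff Topology
open Set Manifold

universe u v w

namespace HolonomyGroupoid

noncomputable section

/-- The model space `ℝⁿ`. -/
abbrev Euc (n : ℕ) : Type := EuclideanSpace ℝ (Fin n)

/-! ### Vector fields and foliations -/

section Foliations

variable {m n : ℕ} {M : Type u} [TopologicalSpace M] [ChartedSpace (Euc m) M]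
  [IsManifold (𝓡 m) ∞ M]

/-- A (not necessarily continuous) vector field on `M`. -/
abbrev VecField (m : ℕ) (M : Type u) [TopologicalSpace M] [ChartedSpace (Euc m) M] : Type u :=
  ∀ x : M, TangentSpace (𝓡 m) x

/-- `X` is smooth on the set `U`. -/
def SmoothFieldOn (X : VecField m M) (U : Set M) : Prop :=
  ContMDiffOn (𝓡 m) (𝓡 m).tangent ∞ (fun x => (⟨x, X x⟩ : TangentBundle (𝓡 m) M)) U

/-- The support of a vector field. -/
def fieldSupport (X : VecField m M) : Set M := closure {x | X x ≠ 0}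

/-- The space `C_c^∞(M; TM)` of smooth vector fields with compact support. -/
def compactFields (m : ℕ) (M : Type u) [TopologicalSpace M] [ChartedSpace (Euc m) M]
    [IsManifold (𝓡 m) ∞ M] : Set (VecField m M) :=
  {X | SmoothFieldOn X univ ∧ IsCompact (fieldSupport X)}

/-- The space `C_c^∞(M)` of smooth real functions with compact support. -/
def compactFunctions (m : ℕ) (M : Type u) [TopologicalSpace M] [ChartedSpace (Euc m) M] :
    Set (M → ℝ) :=
  {f | ContMDiff (𝓡 m) 𝓘(ℝ, ℝ) ∞ f ∧ HasCompactSupport f}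

/-- A (singular) foliation on `M`: a locally finitely generated `C^∞(M)`-submodule of
`C_c^∞(M; TM)` which is stable under Lie brackets. The restriction of a submodule to an open set `U`
is identified, through extension by zero, with its elements which are supported in `U`. -/
structure Foliation (m : ℕ) (M : Type u) [TopologicalSpace M] [ChartedSpace (Euc m) M]
    [IsManifold (𝓡 m) ∞ M] where
  fields : Set (VecField m M)
  subset_compactFields : fields ⊆ compactFields m M
  zero_mem : (fun _ => 0) ∈ fields
  add_mem : ∀ X ∈ fields, ∀ Y ∈ fields, (fun x => X x + Y x) ∈ fields
  smul_mem : ∀ f : M → ℝ, ContMDiff (𝓡 m) 𝓘(ℝ, ℝ) ∞ f → ∀ X ∈ fields,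
    (fun x => f x • X x) ∈ fields
  lie_mem : ∀ X ∈ fields, ∀ Y ∈ fields, VectorField.mlieBracket (𝓡 m) X Y ∈ fields
  locally_fg : ∀ x : M, ∃ U : Set M, IsOpen U ∧ x ∈ U ∧
    ∃ (k : ℕ) (ξ : Fin k → VecField m M), (∀ j, SmoothFieldOn (ξ j) U) ∧
      ∀ X : VecField m M, (X ∈ fields ∧ fieldSupport X ⊆ U) ↔
        ∃ f : Fin k → M → ℝ, (∀ j, f j ∈ compactFunctions m M ∧ tsupport (f j) ⊆ U) ∧
          ∀ x, X x = ∑ j, f j x • ξ j x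

/-- The pull-back module `p^*(𝓕)`: the sections `Y` of `p^*(TM)` which are finite sums of terms
`f · (ξ ∘ p)` with `f ∈ C_c^∞(N)` and `ξ ∈ 𝓕`. -/
def Foliation.pullbackModule (𝓕 : Foliation m M) (n : ℕ) {N : Type v} [TopologicalSpace N]
    [ChartedSpace (Euc n) N] (p : N → M) : Set (∀ y : N, TangentSpace (𝓡 m) (p y)) :=
  {Y | ∃ (k : ℕ) (f : Fin k → N → ℝ) (ξ : Fin k → VecField m M),
    (∀ j, f j ∈ compactFunctions n N ∧ ξ j ∈ 𝓕.fields) ∧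
      ∀ y, Y y = ∑ j, f j y • ξ j (p y)}

/-- `p⁻¹(𝓕) = {X ∈ C_c^∞(N; TN) ; dp(X) ∈ p^*(𝓕)}`. -/
def Foliation.pullback (𝓕 : Foliation m M) (n : ℕ) {N : Type v} [TopologicalSpace N]
    [ChartedSpace (Euc n) N] [IsManifold (𝓡 n) ∞ N] (p : N → M) : Set (VecField n N) :=
  {X | X ∈ compactFields n N ∧
    (fun y => mfderiv (𝓡 n) (𝓡 m) p y (X y)) ∈ 𝓕.pullbackModule n p}

/-- The space `C_c^∞(N; ker dp)`. -/
def kernelFields (m : ℕ) {M : Type u} [TopologicalSpace M] [ChartedSpace (Euc m) M]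
    (n : ℕ) {N : Type v} [TopologicalSpace N] [ChartedSpace (Euc n) N]
    [IsManifold (𝓡 n) ∞ N] (p : N → M) : Set (VecField n N) :=
  {X | X ∈ compactFields n N ∧ ∀ y, mfderiv (𝓡 n) (𝓡 m) p y (X y) = 0}

end Foliations

/-! ### The smooth structure of a fibre product -/

section Submanifold

variable {E H : Type} [NormedAddCommGroup E] [NormedSpace ℝ E] [TopologicalSpace H]
  (I : ModelWithCorners ℝ E H) {P : Type v} [TopologicalSpace P] [ChartedSpace H P] {k : ℕ}

/-- `c` is a submanifold chart of the subset `W` of the manifold `P`: a homeomorphism from an open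
subset of `W` onto an open subset of `ℝᵏ` such that `c⁻¹` is smooth as a map to `P` and `c` is
locally the restriction of a smooth map defined on an open subset of `P`. -/
def IsSubmanifoldChart {W : Set P} (c : OpenPartialHomeomorph W (Euc k)) : Prop :=
  ContMDiffOn (𝓡 k) I ∞ (fun y => (c.symm y : P)) c.target ∧
  ∀ x ∈ c.source, ∃ (O : Set P) (g : P → Euc k), IsOpen O ∧ (x : P) ∈ O ∧
    ContMDiffOn I (𝓡 k) ∞ g O ∧ ∀ y ∈ c.source, (y : P) ∈ O → c y = g y

/-- The charted space structure whose atlas consists of all the submanifold charts. -/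
@[reducible]
def submanifoldChartedSpace (W : Set P)
    (h : ∀ x : W, ∃ c : OpenPartialHomeomorph W (Euc k), IsSubmanifoldChart I c ∧ x ∈ c.source) :
    ChartedSpace (Euc k) W where
  atlas := {c | IsSubmanifoldChart I c}
  chartAt x := (h x).choose
  mem_chart_source x := (h x).choose_spec.2
  chart_mem_atlas x := (h x).choose_spec.1

theorem submanifold_isManifold (W : Set P)
    (h : ∀ x : W, ∃ c : OpenPartialHomeomorph W (Euc k), IsSubmanifoldChart I c ∧ x ∈ c.source) :
    let _ := submanifoldChartedSpace I W h
    IsManifold (𝓡 k) ∞ W := by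
  let _ := submanifoldChartedSpace I W h
  refine isManifold_of_contDiffOn (𝓡 k) ∞ W ?_
  intro c c' hc hc'
  have hc : IsSubmanifoldChart I c := hc
  have hc' : IsSubmanifoldChart I c' := hc'
  rw [← contMDiffOn_iff_contDiffOn]
  simp only [modelWithCornersSelf_coe, modelWithCornersSelf_coe_symm, preimage_id, range_id, inter_univ, CompTriple.comp_eq]
  intro y hy
  have hy' : y ∈ c.target ∧ c.symm y ∈ c'.source := by simpa using hy
  obtain ⟨O, g, hO, hyO, hg, hgc⟩ := hc'.2 _ hy'.2
  have h1 : ContMDiffAt (𝓡 k) I ∞ (fun y => (c.symm y : P)) y :=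
    hc.1.contMDiffAt (c.open_target.mem_nhds hy'.1)
  have h2 : ContMDiffAt I (𝓡 k) ∞ g (c.symm y : P) := hg.contMDiffAt (hO.mem_nhds hyO)
  have h3 : ContMDiffAt (𝓡 k) (𝓡 k) ∞ (fun y => g (c.symm y : P)) y :=
    ContMDiffAt.comp (I' := I) y h2 h1
  refine (h3.congr_of_eventuallyEq ?_).contMDiffWithinAt
  filter_upwards [h1.continuousAt.preimage_mem_nhds (hO.mem_nhds hyO),
    (c.symm.trans c').open_source.mem_nhds (by simpa using hy')] with z hz hz'
  have hz' : z ∈ c.target ∧ c.symm z ∈ c'.source := by simpa using hz'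
  simpa using hgc _ hz'.2 hz

/-- A submanifold chart from a smooth map on an open set of `P` and a smooth local inverse. -/
theorem exists_submanifoldChart {W : Set P} {O : Set P} {T : Set (Euc k)} {g : P → Euc k}
    {σ : Euc k → P} (hO : IsOpen O) (hT : IsOpen T) (hg : ContMDiffOn I (𝓡 k) ∞ g O)
    (hσ : ContMDiffOn (𝓡 k) I ∞ σ T) (hgT : ∀ x ∈ W, x ∈ O → g x ∈ T)
    (hσW : ∀ y ∈ T, σ y ∈ W) (hσO : ∀ y ∈ T, σ y ∈ O) (hl : ∀ x ∈ W, x ∈ O → σ (g x) = x)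
    (hr : ∀ y ∈ T, g (σ y) = y) (x₀ : W) :
    ∃ c : OpenPartialHomeomorph W (Euc k), IsSubmanifoldChart I c ∧
      c.source = {x : W | (x : P) ∈ O} ∧ ∀ x, c x = g x := by
  classical
  let τ : Euc k → W := fun y => if h : y ∈ T then ⟨σ y, hσW y h⟩ else x₀
  have hτ : ∀ y ∈ T, (τ y : P) = σ y := fun y hy => by simp [τ, hy]
  let c : OpenPartialHomeomorph W (Euc k) :=
    { toFun := fun x => g x
      invFun := τ
      source := {x | (x : P) ∈ O}
      target := T
      map_source' := fun x hx => hgT x x.2 hx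
      map_target' := fun y hy => by
        change (τ y : P) ∈ O
        rw [hτ y hy]; exact hσO y hy
      left_inv' := fun x hx => by
        apply Subtype.ext
        rw [hτ _ (hgT x x.2 hx)]; exact hl x x.2 hx
      right_inv' := fun y hy => by
        rw [hτ y hy]; exact hr y hy
      open_source := hO.preimage continuous_subtype_val
      open_target := hT
      continuousOn_toFun :=
        hg.continuousOn.comp continuous_subtype_val.continuousOn fun x hx => hx
      continuousOn_invFun := by
        rw [Topology.IsInducing.subtypeVal.continuousOn_iff]
        exact hσ.continuousOn.congr fun y hy => hτ y hy }
  refine ⟨c, ⟨hσ.congr fun y hy => hτ y hy, fun x hx => ⟨O, g, hO, hx, hg, fun y _ _ => rfl⟩⟩,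
    rfl, fun x => rfl⟩

end Submanifold

section FibreProduct

/-- The fibre product `U ×_{s,t} V`, as a subset of `U × V`. -/
abbrev fibreProduct {M : Type u} {U : Type v} {V : Type w} (s : U → M) (t : V → M) : Set (U × V) :=
  {p | s p.1 = t p.2}

/-- Exchanging the two factors of a fibre product carries submanifold charts to such charts. -/
theorem IsSubmanifoldChart.swap {a b k : ℕ} {M : Type u} {U : Type v} [TopologicalSpace U]
    [ChartedSpace (Euc a) U] {V : Type w} [TopologicalSpace V] [ChartedSpace (Euc b) V]
    {s : U → M} {t : V → M}
    {c : OpenPartialHomeomorph (fibreProduct t s) (Euc k)}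
    (hc : IsSubmanifoldChart ((𝓡 b).prod (𝓡 a)) c) :
    ∃ c' : OpenPartialHomeomorph (fibreProduct s t) (Euc k),
      IsSubmanifoldChart ((𝓡 a).prod (𝓡 b)) c' ∧
      (∀ x : fibreProduct s t, x ∈ c'.source ↔ ⟨x.1.swap, x.2.symm⟩ ∈ c.source) ∧
      (∀ x : fibreProduct s t, c' x = c ⟨x.1.swap, x.2.symm⟩) := by
  let S : fibreProduct s t ≃ₜ fibreProduct t s :=
    { toFun := fun x => ⟨x.1.swap, x.2.symm⟩
      invFun := fun x => ⟨x.1.swap, x.2.symm⟩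
      left_inv := fun x => rfl
      right_inv := fun x => rfl
      continuous_toFun := by fun_prop
      continuous_invFun := by fun_prop }
  refine ⟨S.transOpenPartialHomeomorph c, ⟨?_, ?_⟩, fun x => Iff.rfl, fun x => rfl⟩
  · exact (contMDiff_snd.prodMk contMDiff_fst).comp_contMDiffOn hc.1
  · intro x hx
    obtain ⟨O, g, hO, hxO, hg, hgc⟩ := hc.2 (S x) hx
    refine ⟨Prod.swap ⁻¹' O, g ∘ Prod.swap, hO.preimage continuous_swap, hxO,
      hg.comp (contMDiff_snd.prodMk contMDiff_fst).contMDiffOn fun p hp => hp, ?_⟩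
    intro y hy hyO
    exact hgc (S y) hy hyO

variable {m a b : ℕ} {M : Type u} [TopologicalSpace M] [ChartedSpace (Euc m) M]
  {U : Type v} [TopologicalSpace U] [ChartedSpace (Euc a) U]
  {V : Type w} [TopologicalSpace V] [ChartedSpace (Euc b) V]
  {F : Type} [NormedAddCommGroup F] [NormedSpace ℝ F]

theorem exists_fibreChart {k : ℕ} {s : U → M} {t : V → M} (w : fibreProduct s t)
    (h : IsSubmersionAtOfComplement F (𝓡 a) (𝓡 m) ∞ s w.1.1)
    (ht : ContMDiff (𝓡 b) (𝓡 m) ∞ t) {ψ : OpenPartialHomeomorph V (Euc b)}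
    (hψ : ψ ∈ IsManifold.maximalAtlas (𝓡 b) ∞ V) (hw : w.1.2 ∈ ψ.source)
    (L : (Euc b × F) ≃L[ℝ] Euc k) :
    ∃ c : OpenPartialHomeomorph (fibreProduct s t) (Euc k),
      IsSubmanifoldChart ((𝓡 a).prod (𝓡 b)) c ∧ w ∈ c.source ∧
      (∀ x ∈ c.source, x.1.2 ∈ ψ.source ∧
        c x = L (ψ x.1.2, (h.equiv (h.domChart x.1.1)).2)) := by
  set φ := h.domChart with hφd
  set χ := h.codChart with hχd
  set e := h.equiv with hed
  have hφ : φ ∈ IsManifold.maximalAtlas (𝓡 a) ∞ U := h.domChart_mem_maximalAtlas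
  have hχ : χ ∈ IsManifold.maximalAtlas (𝓡 m) ∞ M := h.codChart_mem_maximalAtlas
  have hsχ : ∀ u ∈ φ.source, s u ∈ χ.source := h.source_subset_preimage_source
  have hnorm : ∀ u ∈ φ.source, χ (s u) = (e (φ u)).1 := by
    intro u hu
    have := h.writtenInCharts (show φ u ∈ (φ.extend (𝓡 a)).target by
      simpa using φ.map_source hu)
    simpa [← hφd, ← hχd, ← hed, φ.left_inv hu] using this
  let O : Set (U × V) := φ.source ×ˢ ψ.source
  let g : U × V → Euc k := fun p => L (ψ p.2, (e (φ p.1)).2)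
  let bb : Euc k → V := fun z => ψ.symm (L.symm z).1
  let aa : Euc k → Euc a := fun z => e.symm (χ (t (bb z)), (L.symm z).2)
  let T1 : Set (Euc k) := {z | (L.symm z).1 ∈ ψ.target}
  let T2 : Set (Euc k) := T1 ∩ (fun z => t (bb z)) ⁻¹' χ.source
  let T : Set (Euc k) := T2 ∩ aa ⁻¹' φ.target
  have hT1 : IsOpen T1 := ψ.open_target.preimage (by fun_prop)
  have hbb : ContMDiffOn (𝓡 k) (𝓡 b) ∞ bb T1 := by
    refine (contMDiffOn_symm_of_mem_maximalAtlas hψ).comp (t := ψ.target) ?_ fun z hz => hz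
    exact ContMDiff.contMDiffOn (contMDiff_iff_contDiff.2 (by fun_prop))
  have htb : ContMDiffOn (𝓡 k) (𝓡 m) ∞ (fun z => t (bb z)) T1 := ht.comp_contMDiffOn hbb
  have hT2 : IsOpen T2 := htb.continuousOn.isOpen_inter_preimage hT1 χ.open_source
  have haa : ContMDiffOn (𝓡 k) (𝓡 a) ∞ aa T2 := by
    have h1 : ContMDiffOn (𝓡 k) (𝓡 m) ∞ (fun z => χ (t (bb z))) T2 :=
      (contMDiffOn_of_mem_maximalAtlas hχ).comp (htb.mono inter_subset_left) fun z hz => hz.2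
    rw [contMDiffOn_iff_contDiffOn] at h1 ⊢
    have h2 : ContDiffOn ℝ ∞ (fun z => (L.symm z).2) T2 := by fun_prop
    exact e.symm.contDiff.comp_contDiffOn (h1.prodMk h2)
  have hT : IsOpen T := haa.continuousOn.isOpen_inter_preimage hT2 φ.open_target
  have hσ : ContMDiffOn (𝓡 k) ((𝓡 a).prod (𝓡 b)) ∞ (fun z => (φ.symm (aa z), bb z)) T := by
    refine ContMDiffOn.prodMk ?_ (hbb.mono fun z hz => hz.1.1)
    exact (contMDiffOn_symm_of_mem_maximalAtlas hφ).comp (haa.mono inter_subset_left)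
      fun z hz => hz.2
  have hg : ContMDiffOn ((𝓡 a).prod (𝓡 b)) (𝓡 k) ∞ g O := by
    have h1 : ContMDiffOn ((𝓡 a).prod (𝓡 b)) (𝓡 b) ∞ (fun p : U × V => ψ p.2) O :=
      (contMDiffOn_of_mem_maximalAtlas hψ).comp contMDiff_snd.contMDiffOn fun p hp => hp.2
    have h2 : ContMDiffOn ((𝓡 a).prod (𝓡 b)) (𝓡 a) ∞ (fun p : U × V => φ p.1) O :=
      (contMDiffOn_of_mem_maximalAtlas hφ).comp contMDiff_fst.contMDiffOn fun p hp => hp.1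
    have h3 : ContMDiff ((𝓡 b).prod (𝓡 a)) (𝓡 k) ∞
        (fun q : Euc b × Euc a => L (q.1, (e q.2).2)) := by
      rw [← modelWithCornersSelf_prod, chartedSpaceSelf_prod, contMDiff_iff_contDiff]
      fun_prop
    exact h3.comp_contMDiffOn (h1.prodMk h2)
  obtain ⟨c, hc, hcs, hcv⟩ := exists_submanifoldChart ((𝓡 a).prod (𝓡 b)) (W := fibreProduct s t)
    (φ.open_source.prod ψ.open_source) hT hg hσ
    (fun x hx hxO => by
      have hb : bb (g x) = x.2 := by simp [bb, g, ψ.left_inv hxO.2]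
      have ha : aa (g x) = φ x.1 := by
        simp only [aa, hb]
        rw [← show s x.1 = t x.2 from hx, hnorm _ hxO.1]
        simp [g]
      refine ⟨⟨?_, ?_⟩, ?_⟩
      · simpa [T1, g] using ψ.map_source hxO.2
      · change t (bb (g x)) ∈ χ.source
        rw [hb, ← show s x.1 = t x.2 from hx]; exact hsχ _ hxO.1
      · change aa (g x) ∈ φ.target
        rw [ha]; exact φ.map_source hxO.1)
    (fun z hz => by
      change s (φ.symm (aa z)) = t (bb z)
      have h1 : φ.symm (aa z) ∈ φ.source := φ.map_target hz.2
      apply χ.injOn (hsχ _ h1) hz.1.2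
      rw [hnorm _ h1, φ.right_inv hz.2]
      simp [aa])
    (fun z hz => ⟨φ.map_target hz.2, ψ.map_target hz.1.1⟩)
    (fun x hx hxO => by
      have hb : bb (g x) = x.2 := by simp [bb, g, ψ.left_inv hxO.2]
      have ha : aa (g x) = φ x.1 := by
        simp only [aa, hb]
        rw [← show s x.1 = t x.2 from hx, hnorm _ hxO.1]
        simp [g]
      ext1
      · simp [ha, φ.left_inv hxO.1]
      · exact hb)
    (fun z hz => by
      have h1 : ψ (bb z) = (L.symm z).1 := ψ.right_inv hz.1.1
      simp only [g, h1, φ.right_inv hz.2]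
      simp [aa]) w
  refine ⟨c, hc, ?_, ?_⟩
  · rw [hcs]; exact ⟨h.mem_domChart_source, hw⟩
  · intro x hx
    rw [hcs] at hx
    exact ⟨hx.2, hcv x⟩

theorem exists_submersionChart {m' : ℕ} {M' : Type*} [TopologicalSpace M']
    [ChartedSpace (Euc m') M'] {F' : Type} [NormedAddCommGroup F'] [NormedSpace ℝ F']
    {k : ℕ} (hk : k = a + b - m) {s : U → M} {t : V → M} {r : V → M'} (w : fibreProduct s t)
    (hs : IsSubmersionAtOfComplement F (𝓡 a) (𝓡 m) ∞ s w.1.1)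
    (ht : ContMDiff (𝓡 b) (𝓡 m) ∞ t)
    (hr : IsSubmersionAtOfComplement F' (𝓡 b) (𝓡 m') ∞ r w.1.2) :
    ∃ (c : OpenPartialHomeomorph (fibreProduct s t) (Euc k))
      (d : OpenPartialHomeomorph M' (Euc m')) (e : Euc k ≃L[ℝ] Euc m' × (F' × F)),
      IsSubmanifoldChart ((𝓡 a).prod (𝓡 b)) c ∧ w ∈ c.source ∧
      d ∈ IsManifold.maximalAtlas (𝓡 m') ∞ M' ∧ r w.1.2 ∈ d.source ∧
      (∀ x ∈ c.source, r x.1.2 ∈ d.source ∧ d (r x.1.2) = (e (c x)).1) := by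
  have hF : FiniteDimensional ℝ (Euc m × F) := hs.equiv.toLinearEquiv.finiteDimensional
  have hF' : FiniteDimensional ℝ F :=
    Module.Finite.of_surjective (LinearMap.snd ℝ (Euc m) F) LinearMap.snd_surjective
  have hd : a = m + Module.finrank ℝ F := by
    have := hs.equiv.toLinearEquiv.finrank_eq
    simpa [Module.finrank_prod] using this
  let L : (Euc b × F) ≃L[ℝ] Euc k := ContinuousLinearEquiv.ofFinrankEq (by
    rw [Module.finrank_prod]; simp; omega)
  obtain ⟨c, hc, hwc, hcv⟩ :=
    exists_fibreChart w hs ht hr.domChart_mem_maximalAtlas hr.mem_domChart_source L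
  refine ⟨c, hr.codChart, (L.symm.trans (hr.equiv.prodCongr (.refl ℝ F))).trans
    (ContinuousLinearEquiv.prodAssoc ℝ _ _ _), hc, hwc, hr.codChart_mem_maximalAtlas,
    hr.mem_codChart_source, ?_⟩
  intro x hx
  obtain ⟨h1, h2⟩ := hcv x hx
  refine ⟨hr.source_subset_preimage_source h1, ?_⟩
  have h3 := hr.writtenInCharts (show hr.domChart x.1.2 ∈ (hr.domChart.extend (𝓡 b)).target by
    simpa using hr.domChart.map_source h1)
  simp only [Function.comp_apply, OpenPartialHomeomorph.extend_coe, modelWithCornersSelf_coe,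
    OpenPartialHomeomorph.extend_coe_symm, modelWithCornersSelf_coe_symm, id_eq,
    hr.domChart.left_inv h1] at h3
  rw [h2]
  simpa using h3

theorem isSubmersionAtOfComplement_of_chart {k m' : ℕ} {W : Type*} [TopologicalSpace W]
    [ChartedSpace (Euc k) W] [IsManifold (𝓡 k) ∞ W] {M' : Type*} [TopologicalSpace M']
    [ChartedSpace (Euc m') M'] {r : W → M'} {x : W} (e : Euc k ≃L[ℝ] Euc m' × F)
    (c : OpenPartialHomeomorph W (Euc k)) (d : OpenPartialHomeomorph M' (Euc m'))
    (hx : x ∈ c.source) (hxd : r x ∈ d.source) (hc : c ∈ atlas (Euc k) W)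
    (hd : d ∈ IsManifold.maximalAtlas (𝓡 m') ∞ M')
    (h : ∀ y ∈ c.source, r y ∈ d.source ∧ d (r y) = (e (c y)).1) :
    IsSubmersionAtOfComplement F (𝓡 k) (𝓡 m') ∞ r x := by
  refine IsSubmersionAtOfComplement.mk_of_charts e c d hx hxd
    (IsManifold.subset_maximalAtlas hc) hd (fun y hy => (h y hy).1) ?_
  intro z hz
  have hz' : z ∈ c.target := by simpa using hz
  have := (h _ (c.map_target hz')).2
  rw [c.right_inv hz'] at this
  simpa using this

end FibreProduct

/-! ### Bi-submersions -/

section BiSubmersions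

variable {m : ℕ} {M : Type u} [TopologicalSpace M] [ChartedSpace (Euc m) M]

/-- A smooth manifold `(U, t, s)` (Hausdorff and second countable) with two submersions
`t, s : U → M`. -/
structure SubmersionPair (m : ℕ) (M : Type u) [TopologicalSpace M] [ChartedSpace (Euc m) M] :
    Type (max u (v + 1)) where
  carrier : Type v
  dim : ℕ
  [topologicalSpace : TopologicalSpace carrier]
  [t2Space : T2Space carrier]
  [secondCountableTopology : SecondCountableTopology carrier]
  [chartedSpace : ChartedSpace (Euc dim) carrier]
  [isManifold : IsManifold (𝓡 dim) ∞ carrier]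
  t : carrier → M
  s : carrier → M
  isSubmersion_t : IsSubmersion (𝓡 dim) (𝓡 m) ∞ t
  isSubmersion_s : IsSubmersion (𝓡 dim) (𝓡 m) ∞ s

attribute [instance] SubmersionPair.topologicalSpace SubmersionPair.t2Space
  SubmersionPair.secondCountableTopology SubmersionPair.chartedSpace SubmersionPair.isManifold

/-- `(U, t, s)` is a bi-submersion of `(M, 𝓕)`: `s⁻¹(𝓕) = t⁻¹(𝓕)` and
`s⁻¹(𝓕) = C_c^∞(U; ker ds) + C_c^∞(U; ker dt)`. -/
structure IsBiSubmersion [IsManifold (𝓡 m) ∞ M] (𝓕 : Foliation m M) (U : SubmersionPair.{u, v} m M) : Prop where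
  pullback_eq : 𝓕.pullback U.dim U.s = 𝓕.pullback U.dim U.t
  pullback_eq_add : 𝓕.pullback U.dim U.s =
    {Z | ∃ X ∈ kernelFields m U.dim U.s, ∃ Y ∈ kernelFields m U.dim U.t, ∀ u, Z u = X u + Y u}

/-- `f` restricts on the open set `U'` to a local morphism from `U` to `V`. The values of `f`
outside `U'` are irrelevant. -/
structure IsLocalMorphism (U : SubmersionPair.{u, v} m M) (V : SubmersionPair.{u, w} m M)
    (U' : Set U.carrier) (f : U.carrier → V.carrier) : Prop where
  isOpen : IsOpen U'
  contMDiffOn : ContMDiffOn (𝓡 U.dim) (𝓡 V.dim) ∞ f U'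
  s_comp : ∀ u ∈ U', V.s (f u) = U.s u
  t_comp : ∀ u ∈ U', V.t (f u) = U.t u

/-- The inverse `U⁻¹ = (U, s, t)` of `(U, t, s)`. -/
def SubmersionPair.inverse (U : SubmersionPair.{u, v} m M) : SubmersionPair.{u, v} m M where
  carrier := U.carrier
  dim := U.dim
  t := U.s
  s := U.t
  isSubmersion_t := U.isSubmersion_s
  isSubmersion_s := U.isSubmersion_t

/-- The underlying space `{(u, v) ; s_U(u) = t_V(v)}` of the composition. -/
abbrev SubmersionPair.compSet (U : SubmersionPair.{u, v} m M) (V : SubmersionPair.{u, w} m M) :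
    Set (U.carrier × V.carrier) := fibreProduct U.s V.t

theorem SubmersionPair.exists_compChart (U : SubmersionPair.{u, v} m M)
    (V : SubmersionPair.{u, w} m M) (x : U.compSet V) :
    ∃ c : OpenPartialHomeomorph (U.compSet V) (Euc (U.dim + V.dim - m)),
      IsSubmanifoldChart ((𝓡 U.dim).prod (𝓡 V.dim)) c ∧ x ∈ c.source := by
  obtain ⟨c, d, e, hc, hx, -⟩ := exists_submersionChart rfl x
    (U.isSubmersion_s.isSubmersionOfComplement_complement x.1.1) V.isSubmersion_t.contMDiff
    (V.isSubmersion_s.isSubmersionOfComplement_complement x.1.2)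
  exact ⟨c, hc, hx⟩

/-- The composition `U ∘ V = (U ×_{s_U, t_V} V, t_U ∘ pr₁, s_V ∘ pr₂)`, with the smooth structure
of a submanifold of `U × V`. -/
def SubmersionPair.comp (U : SubmersionPair.{u, v} m M) (V : SubmersionPair.{u, w} m M) :
    SubmersionPair.{u, max v w} m M where
  carrier := U.compSet V
  dim := U.dim + V.dim - m
  chartedSpace := submanifoldChartedSpace ((𝓡 U.dim).prod (𝓡 V.dim)) (U.compSet V)
    (U.exists_compChart V)
  isManifold := submanifold_isManifold _ _ (U.exists_compChart V)
  t x := U.t x.1.1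
  s x := V.s x.1.2
  isSubmersion_t := by
    let _ := submanifoldChartedSpace ((𝓡 U.dim).prod (𝓡 V.dim)) (U.compSet V)
      (U.exists_compChart V)
    have _ : IsManifold (𝓡 (U.dim + V.dim - m)) ∞ (U.compSet V) :=
      submanifold_isManifold _ _ (U.exists_compChart V)
    refine ⟨U.isSubmersion_t.complement × V.isSubmersion_t.complement, inferInstance, inferInstance,
      fun x => ?_⟩
    obtain ⟨c, d, e, hc, hx, hd, hxd, hcd⟩ := exists_submersionChart
      (k := U.dim + V.dim - m) (by rw [add_comm])
      (⟨x.1.swap, x.2.symm⟩ : fibreProduct V.t U.s)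
      (V.isSubmersion_t.isSubmersionOfComplement_complement x.1.2) U.isSubmersion_s.contMDiff
      (U.isSubmersion_t.isSubmersionOfComplement_complement x.1.1)
    obtain ⟨c', hc', hsrc, hval⟩ := hc.swap
    refine isSubmersionAtOfComplement_of_chart (x := x) e c' d ((hsrc x).2 hx) hxd hc' hd ?_
    intro y hy
    have := hcd _ ((hsrc y).1 hy)
    rw [← hval] at this
    exact this
  isSubmersion_s := by
    let _ := submanifoldChartedSpace ((𝓡 U.dim).prod (𝓡 V.dim)) (U.compSet V)
      (U.exists_compChart V)
    have _ : IsManifold (𝓡 (U.dim + V.dim - m)) ∞ (U.compSet V) :=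
      submanifold_isManifold _ _ (U.exists_compChart V)
    refine ⟨V.isSubmersion_s.complement × U.isSubmersion_s.complement, inferInstance, inferInstance,
      fun x => ?_⟩
    obtain ⟨c, d, e, hc, hx, hd, hxd, hcd⟩ := exists_submersionChart rfl x
      (U.isSubmersion_s.isSubmersionOfComplement_complement x.1.1) V.isSubmersion_t.contMDiff
      (V.isSubmersion_s.isSubmersionOfComplement_complement x.1.2)
    exact isSubmersionAtOfComplement_of_chart (x := x) e c d hx hxd hc hd hcd

end BiSubmersions

/-! ### Atlases and groupoids -/

section Atlases

variable {m : ℕ} {M : Type u} [TopologicalSpace M] [ChartedSpace (Euc m) M] {ι : Type w}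

/-- `U` is adapted to the family `𝓤`: every point of `U` has an open neighbourhood on which there is
a morphism to a member of the family. -/
def IsAdapted (𝓤 : ι → SubmersionPair.{u, v} m M) (U : SubmersionPair.{u, v} m M) : Prop :=
  ∀ u : U.carrier, ∃ (U' : Set U.carrier) (i : ι) (f : U.carrier → (𝓤 i).carrier),
    u ∈ U' ∧ IsLocalMorphism U (𝓤 i) U' f

/-- The family `𝓤` is an atlas of bi-submersions of `(M, 𝓕)`. -/
structure IsAtlas [IsManifold (𝓡 m) ∞ M] (𝓕 : Foliation m M)
    (𝓤 : ι → SubmersionPair.{u, v} m M) : Prop where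
  isBiSubmersion : ∀ i, IsBiSubmersion 𝓕 (𝓤 i)
  iUnion_range_s : ⋃ i, range (𝓤 i).s = univ
  isAdapted_inverse : ∀ i, IsAdapted 𝓤 (𝓤 i).inverse
  isAdapted_comp : ∀ i j, IsAdapted 𝓤 ((𝓤 i).comp (𝓤 j))

/-- The relation `∼` on the disjoint union of the family: `u ∼ v` if there is a local morphism
mapping `u` to `v`. -/
def atlasRel (𝓤 : ι → SubmersionPair.{u, v} m M) (x y : Σ i, (𝓤 i).carrier) : Prop :=
  ∃ (U' : Set (𝓤 x.1).carrier) (f : (𝓤 x.1).carrier → (𝓤 y.1).carrier),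
    IsLocalMorphism (𝓤 x.1) (𝓤 y.1) U' f ∧ x.2 ∈ U' ∧ f x.2 = y.2

/-- The quotient `G_𝓤` of the disjoint union of the family by (the equivalence relation generated
by) `∼`. -/
def AtlasQuotient (𝓤 : ι → SubmersionPair.{u, v} m M) : Type (max v w) := Quot (atlasRel 𝓤)

/-- The quotient map `q_i : U_i → G_𝓤`. -/
def atlasQuotientMap (𝓤 : ι → SubmersionPair.{u, v} m M) (i : ι) (u : (𝓤 i).carrier) :
    AtlasQuotient 𝓤 := Quot.mk _ ⟨i, u⟩

/-- A groupoid structure on `G` with set of objects `M`, source map `s` and target map `t`. The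
product `g h` is defined when `s g = t h`. -/
structure GroupoidStructure {G : Type v} {M : Type u} (s t : G → M) where
  mul : ∀ g h : G, s g = t h → G
  one : M → G
  inv : G → G
  s_mul : ∀ g h e, s (mul g h e) = s h
  t_mul : ∀ g h e, t (mul g h e) = t g
  s_one : ∀ x, s (one x) = x
  t_one : ∀ x, t (one x) = x
  s_inv : ∀ g, s (inv g) = t g
  t_inv : ∀ g, t (inv g) = s g
  mul_assoc : ∀ g h k (e : s g = t h) (e' : s h = t k),
    mul (mul g h e) k ((s_mul g h e).trans e') = mul g (mul h k e') (e.trans (t_mul h k e').symm)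
  one_mul : ∀ g, mul (one (t g)) g (s_one _) = g
  mul_one : ∀ g, mul g (one (s g)) (t_one _).symm = g
  inv_mul : ∀ g, mul (inv g) g (s_inv g) = one (s g)
  mul_inv : ∀ g, mul g (inv g) (t_inv g).symm = one (t g)

end Atlases

end

end HolonomyGroupoid

/-! Everything rests on an extension principle, `exists_localMorphism_of_sections`: let σ be a local
section of s_U through u and τ one of s_V through v, over the same open set, with t_U ∘ σ = t_V ∘ τ;
then some local morphism from U to V takes u to v. To see this, choose coordinates near u in which
s_U is a product projection, and join each point to the point of σ in its s_U-fibre by a segment.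
Since dt_U maps ker ds_U into t_U^*(𝓕), the t_U-image of the segment moves with velocity Σ aᵢ ξᵢ,
where ξᵢ ∈ 𝓕. Because V is a bi-submersion, each ξᵢ lifts locally through t_V to a field Hᵢ in ker
ds_V (`IsBiSubmersion.exists_lift`). Solve γ' = Σ aᵢ Hᵢ(γ) in V, starting on τ: s_V ∘ γ is constant,
while t_V ∘ γ and the t_U-image of the segment solve the same equation with the same initial value,
so they agree. The morphism sends the end of the segment to γ(1). It is smooth by smooth dependence
on parameters, which `exists_parametric_solution` derives from an implicit function theorem in
C([0,1], E).

Say that u carries φ when φ = t_U ∘ σ near s_U(u) for some local section σ of s_U through u. Every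
point carries some φ, local morphisms preserve the carried maps, and by the principle two points
with equal source which carry a common φ are related by local morphisms in both directions. This
yields the symmetry of ∼, the independence of q_U from choices, and the fact that an element of G is
determined by its source and any one map that it carries. A point (u, v) of a composition carries φ
∘ φ', and (f(u), u) carries the identity if f is a local morphism from the inverse. The groupoid
axioms thus reduce to identities between maps M → M.

That U ∘ V is a bi-submersion is a separate matter: `IsBiSubmersion.pullbackAt_comp` moves pull-back
conditions from t to s across one factor at a time, and the splitting into kernels comes from
lifting fields of 𝓕 to motions of the U-factor alone. -/

namespace HolonomyGroupoid

noncomputable section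

/-! ### Smooth dependence of solutions of differential equations on parameters -/

section SmoothDependence

section Nemytskii

variable {K : Type*} [TopologicalSpace K] [CompactSpace K]
  {E F : Type u} [NormedAddCommGroup E] [NormedSpace ℝ E] [NormedAddCommGroup F] [NormedSpace ℝ F]

/-- The pointwise application `C(K, E →L F) → C(K, E) → C(K, F)` as a bounded bilinear map. -/
def continuousMapApply (K : Type*) [TopologicalSpace K] [CompactSpace K]
    (E F : Type u) [NormedAddCommGroup E] [NormedSpace ℝ E] [NormedAddCommGroup F]
    [NormedSpace ℝ F] : C(K, E →L[ℝ] F) →L[ℝ] C(K, E) →L[ℝ] C(K, F) :=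
  LinearMap.mkContinuous₂
    (LinearMap.mk₂ ℝ (fun (A : C(K, E →L[ℝ] F)) (h : C(K, E)) =>
        (⟨fun x => A x (h x), A.continuous.clm_apply h.continuous⟩ : C(K, F)))
      (fun _ _ _ => by ext; simp) (fun _ _ _ => by ext; simp) (fun _ _ _ => by ext; simp)
      (fun _ _ _ => by ext; simp)) 1 (fun A h => by
        rw [one_mul, ContinuousMap.norm_le _ (by positivity)]
        intro x
        exact ((A x).le_opNorm (h x)).trans
          (mul_le_mul (A.norm_coe_le_norm x) (h.norm_coe_le_norm x) (norm_nonneg _)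
            (norm_nonneg A)))

@[simp]
theorem continuousMapApply_apply (A : C(K, E →L[ℝ] F)) (h : C(K, E)) (x : K) :
    continuousMapApply K E F A h x = A x (h x) := rfl

/-- The derivative f' is uniformly continuous near the compact range of γ, so the mean value
inequality bounds the first-order remainder uniformly in x, as the sup norm requires. -/
theorem hasFDerivAt_continuousMap_comp (f : C(E, F)) (f' : C(E, E →L[ℝ] F))
    (hf : ∀ x, HasFDerivAt f (f' x) x) (γ : C(K, E)) :
    HasFDerivAt (fun γ : C(K, E) => f.comp γ) (continuousMapApply K E F (f'.comp γ)) γ := by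
  rw [hasFDerivAt_iff_isLittleO_nhds_zero, Asymptotics.isLittleO_iff]
  intro ε hε
  have hcpt : IsCompact (range γ) := isCompact_range γ.continuous
  have h1 := hcpt.uniformContinuousAt_of_continuousAt f'
    (fun x _ => f'.continuous.continuousAt) (Metric.dist_mem_uniformity hε)
  obtain ⟨δ, hδ, h2⟩ := Metric.mem_uniformity_dist.1 h1
  filter_upwards [Metric.ball_mem_nhds (0 : C(K, E)) hδ] with h hh
  have hh' : ‖h‖ < δ := by simpa using hh
  rw [ContinuousMap.norm_le _ (by positivity)]
  intro x
  have hx : ‖h x‖ < δ := (h.norm_coe_le_norm x).trans_lt hh'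
  have h3 : ∀ y ∈ Metric.ball (γ x) δ, ‖f' y - f' (γ x)‖ ≤ ε := by
    intro y hy
    have := h2 (show dist (γ x) y < δ by rw [dist_comm]; exact hy) (mem_range_self x)
    have h4 : dist (f' (γ x)) (f' y) < ε := this
    rw [← dist_eq_norm, dist_comm]
    exact h4.le
  have h5 := (convex_ball (γ x) δ).norm_image_sub_le_of_norm_hasFDerivWithin_le'
    (f := f) (f' := fun y => f' y) (φ := f' (γ x)) (C := ε)
    (fun y _ => (hf y).hasFDerivWithinAt) h3 (Metric.mem_ball_self hδ)
    (show γ x + h x ∈ Metric.ball (γ x) δ by simpa using hx)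
  simp only [add_sub_cancel_left] at h5
  refine le_trans ?_ (h5.trans (mul_le_mul_of_nonneg_left (h.norm_coe_le_norm x) hε.le))
  exact le_of_eq rfl

/-- Composition with a smooth map is smooth on the space of continuous maps. -/
theorem contDiff_continuousMap_comp (f : C(E, F)) (hf : ContDiff ℝ ∞ f) :
    ContDiff ℝ ∞ (fun γ : C(K, E) => f.comp γ) := by
  rw [contDiff_infty]
  intro n
  -- The derivative is built from the same operator for `fderiv ℝ f`, whose values lie in E →L[ℝ] F.
  -- Hence F varies in the induction, and E and F share a universe.
  induction n generalizing F with
  | zero => exact contDiff_zero.2 (ContinuousMap.continuous_postcomp f)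
  | succ n ih =>
    push_cast
    rw [contDiff_succ_iff_hasFDerivAt]
    obtain ⟨hd, hf'⟩ := contDiff_infty_iff_fderiv.1 hf
    let f' : C(E, E →L[ℝ] F) := ⟨fderiv ℝ f, hf'.continuous⟩
    have h := ContinuousLinearMap.contDiff (𝕜 := ℝ) (E := C(K, E →L[ℝ] F))
      (F := C(K, E) →L[ℝ] C(K, F)) (n := n) (continuousMapApply K E F)
    exact ⟨fun γ => continuousMapApply K E F (f'.comp γ), h.comp (ih f' hf'),
      hasFDerivAt_continuousMap_comp f f' fun x => (hd x).hasFDerivAt⟩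

end Nemytskii

/-- Two functions agreeing near a point, one of them globally smooth. -/
theorem exists_contDiff_eventuallyEq {E F : Type*} [NormedAddCommGroup E] [NormedSpace ℝ E]
    [FiniteDimensional ℝ E] [NormedAddCommGroup F] [NormedSpace ℝ F] {f : E → F} {O : Set E}
    {x : E} (hO : O ∈ 𝓝 x) (hf : ContDiffOn ℝ ∞ f O) :
    ∃ g : E → F, ContDiff ℝ ∞ g ∧ g =ᶠ[𝓝 x] f := by
  obtain ⟨ε, hε, hεO⟩ := Metric.nhds_basis_closedBall.mem_iff.1 (interior_mem_nhds.2 hO)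
  -- χ is 1 on the ball of radius ε / 2 and supported in the closed ball of radius ε, where f is
  -- smooth.
  let χ : ContDiffBump x := ⟨ε / 2, ε, by positivity, by linarith⟩
  refine ⟨fun y => χ y • f y, contDiff_iff_contDiffAt.2 fun y => ?_, ?_⟩
  · by_cases hy : y ∈ tsupport χ
    · rw [χ.tsupport_eq] at hy
      exact χ.contDiff.contDiffAt.smul (hf.contDiffAt (mem_interior_iff_mem_nhds.1 (hεO hy)))
    · refine contDiffAt_const (c := (0 : F)) |>.congr_of_eventuallyEq ?_
      filter_upwards [notMem_tsupport_iff_eventuallyEq.1 hy] with z hz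
      simp [hz]
  · filter_upwards [χ.eventuallyEq_one] with y hy
    simp [hy]

variable {E : Type u} [NormedAddCommGroup E] [NormedSpace ℝ E]

/-- The primitive vanishing at `0` of a continuous map on `[0, 1]`. -/
def primitive [CompleteSpace E] : C(Icc (0 : ℝ) 1, E) →L[ℝ] C(Icc (0 : ℝ) 1, E) :=
  LinearMap.mkContinuous
    -- `projIcc` extends γ to ℝ by constants outside [0, 1].
    { toFun := fun γ => ⟨fun r => ∫ s in (0 : ℝ)..r, γ (projIcc 0 1 zero_le_one s), by
        have h : Continuous fun s : ℝ => γ (projIcc 0 1 zero_le_one s) :=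
          γ.continuous.comp continuous_projIcc
        exact (intervalIntegral.continuous_primitive
          (fun a b => h.intervalIntegrable a b) 0).comp continuous_subtype_val⟩
      map_add' := fun γ γ' => by
        ext r
        have h : ∀ γ : C(Icc (0 : ℝ) 1, E),
            Continuous fun s : ℝ => γ (projIcc 0 1 zero_le_one s) :=
          fun γ => γ.continuous.comp continuous_projIcc
        simpa using intervalIntegral.integral_add ((h γ).intervalIntegrable 0 r)
          ((h γ').intervalIntegrable 0 r)
      map_smul' := fun c γ => by
        ext r
        simp } 1 (fun γ => by
      rw [one_mul, ContinuousMap.norm_le _ (norm_nonneg _)]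
      intro r
      have := intervalIntegral.norm_integral_le_of_norm_le_const (a := (0 : ℝ)) (b := r)
        (C := ‖γ‖) (f := fun s => γ (projIcc 0 1 zero_le_one s))
        (fun s _ => γ.norm_coe_le_norm _)
      refine this.trans ?_
      have hr : |(r : ℝ) - 0| ≤ 1 := by
        rw [sub_zero, abs_of_nonneg r.2.1]; exact r.2.2
      exact mul_le_of_le_one_right (norm_nonneg _) hr)

end SmoothDependence

/-! ### Implicit functions and differential equations with parameters. -/

section ParametricSolution

/-- An inverse function theorem for maps over a parameter space: the solution set of
`Φ (p, c) = 0` is locally the graph of a smooth function if `∂Φ/∂c` is the identity. -/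
theorem exists_contDiffOn_implicit {P C : Type*} [NormedAddCommGroup P] [NormedSpace ℝ P]
    [CompleteSpace P] [NormedAddCommGroup C] [NormedSpace ℝ C] [CompleteSpace C]
    {Φ : P × C → C} (hΦ : ContDiff ℝ ∞ Φ) {p₀ : P} {c₀ : C} (h₀ : Φ (p₀, c₀) = 0)
    (hd : ∀ c, Φ (p₀, c) = c - c₀) :
    ∃ (N : Set P) (Γ : P → C), IsOpen N ∧ p₀ ∈ N ∧ ContDiffOn ℝ ∞ Γ N ∧ Γ p₀ = c₀ ∧
      ∀ p ∈ N, Φ (p, Γ p) = 0 := by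
  -- The differential of Ψ at (p₀, c₀) is triangular with identities on the diagonal, so Ψ is
  -- locally invertible and Γ p is the second component of Ψ⁻¹ (p, 0).
  let Ψ : P × C → P × C := fun q => (q.1, Φ q)
  have hΨ : ContDiff ℝ ∞ Ψ := contDiff_fst.prodMk hΦ
  have hΦd : HasFDerivAt Φ (fderiv ℝ Φ (p₀, c₀)) (p₀, c₀) :=
    (hΦ.differentiable (by simp) _).hasFDerivAt
  set D := fderiv ℝ Φ (p₀, c₀)
  have hD : ∀ c, D (0, c) = c := by
    intro c
    have h1 : HasFDerivAt (fun c => Φ (p₀, c)) (D.comp (ContinuousLinearMap.inr ℝ P C)) c₀ :=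
      hΦd.comp c₀ (hasFDerivAt_prodMk_right p₀ c₀)
    have h2 : HasFDerivAt (fun c => Φ (p₀, c)) (ContinuousLinearMap.id ℝ C) c₀ := by
      simp only [hd]
      exact (hasFDerivAt_id c₀).sub_const c₀
    have h3 := h1.unique h2
    simpa using congrArg (fun A : C →L[ℝ] C => A c) h3
  let L : (P × C) ≃L[ℝ] (P × C) :=
    (ContinuousLinearEquiv.refl ℝ P).skewProd (ContinuousLinearEquiv.refl ℝ C)
      (D.comp (ContinuousLinearMap.inl ℝ P C))
  have hL : HasFDerivAt Ψ (L : (P × C) →L[ℝ] (P × C)) (p₀, c₀) := by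
    have h1 : HasFDerivAt Ψ ((ContinuousLinearMap.fst ℝ P C).prod D) (p₀, c₀) :=
      hasFDerivAt_fst.prodMk hΦd
    convert h1 using 1
    ext q
    · simp [L]
    · simp [L]
    · simp [L]
    · simp [L, hD]
  have hn : (∞ : WithTop ℕ∞) ≠ 0 := by simp
  let e := hΨ.contDiffAt.toOpenPartialHomeomorph Ψ hL hn
  have he : ∀ q, e q = Ψ q := fun q => rfl
  have hmem : (p₀, c₀) ∈ e.source := hΨ.contDiffAt.mem_toOpenPartialHomeomorph_source hL hn
  have he₀ : e (p₀, c₀) = (p₀, 0) := by rw [he]; simp [Ψ, h₀]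
  -- On S the differential is invertible, which makes the local inverse smooth at every point of a
  -- neighbourhood and not only at the base point.
  let S : Set (P × C) := fderiv ℝ Ψ ⁻¹' range ((↑) : ((P × C) ≃L[ℝ] (P × C)) → _)
  have hS : IsOpen S :=
    ContinuousLinearEquiv.isOpen.preimage (hΨ.continuous_fderiv hn)
  have hT : IsOpen (e.target ∩ e.symm ⁻¹' S) := e.symm.isOpen_inter_preimage hS
  have hp₀ : (p₀, (0 : C)) ∈ e.target ∩ e.symm ⁻¹' S := by
    refine ⟨he₀ ▸ e.map_source hmem, ?_⟩
    rw [mem_preimage, ← he₀, e.left_inv hmem]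
    exact ⟨L, hL.fderiv.symm⟩
  have hc : Continuous fun p : P => (p, (0 : C)) := by fun_prop
  refine ⟨_, fun p => (e.symm (p, 0)).2, hT.preimage hc, hp₀, ?_, ?_, ?_⟩
  · intro p hp
    obtain ⟨hpt, A, hA⟩ := hp
    have h1 : HasFDerivAt e (A : (P × C) →L[ℝ] (P × C)) (e.symm (p, 0)) := by
      rw [hA]
      exact (hΨ.differentiable hn _).hasFDerivAt
    have h2 := e.contDiffAt_symm hpt h1 hΨ.contDiffAt
    have h3 : ContDiffAt ℝ ∞ (fun p : P => (p, (0 : C))) p := by fun_prop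
    exact (contDiffAt_snd.comp p (h2.comp p h3)).contDiffWithinAt
  · change (e.symm (p₀, 0)).2 = c₀
    rw [← he₀, e.left_inv hmem]
  · intro p hp
    have h1 := e.right_inv hp.1
    rw [he] at h1
    have h2 : (e.symm (p, 0)).1 = p := congrArg Prod.fst h1
    have h3 : Φ (e.symm (p, 0)) = 0 := congrArg Prod.snd h1
    have h4 : (p, (e.symm (p, 0)).2) = e.symm (p, 0) := Prod.ext h2.symm rfl
    change Φ (p, (e.symm (p, 0)).2) = 0
    rw [h4, h3]

variable {P E : Type u} [NormedAddCommGroup P] [NormedSpace ℝ P] [CompleteSpace P]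
  [NormedAddCommGroup E] [NormedSpace ℝ E] [CompleteSpace E]

theorem contDiff_continuousMap_clm {K : Type*} [TopologicalSpace K] [CompactSpace K]
    {E F : Type*} [NormedAddCommGroup E] [NormedSpace ℝ E] [NormedAddCommGroup F]
    [NormedSpace ℝ F] (A : E →L[ℝ] F) :
    ContDiff ℝ ∞ (fun γ : C(K, E) => (A : C(E, F)).comp γ) :=
  (LinearMap.mkContinuous
    { toFun := fun γ : C(K, E) => (A : C(E, F)).comp γ
      map_add' := fun _ _ => by ext; simp
      map_smul' := fun _ _ => by ext; simp } ‖A‖ (fun γ => by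
        rw [ContinuousMap.norm_le _ (by positivity)]
        intro x
        exact (A.le_opNorm _).trans
          (mul_le_mul_of_nonneg_left (γ.norm_coe_le_norm x) (norm_nonneg A)))).contDiff

theorem contDiff_continuousMap_const {K : Type*} [TopologicalSpace K] [CompactSpace K]
    {E : Type*} [NormedAddCommGroup E] [NormedSpace ℝ E] :
    ContDiff ℝ ∞ (fun x : E => ContinuousMap.const K x) :=
  (LinearMap.mkContinuous
    { toFun := fun x : E => ContinuousMap.const K x
      map_add' := fun _ _ => by ext; simp
      map_smul' := fun _ _ => by ext; simp } 1 (fun x => by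
        rw [one_mul, ContinuousMap.norm_le _ (norm_nonneg x)]
        intro _
        exact le_rfl)).contDiff

/-- Smooth dependence on parameters of the solution on `[0, 1]` of a differential equation
`γ' = G (r, p, γ)`, near a parameter where the right-hand side vanishes. -/
theorem exists_parametric_solution {G : ℝ × P × E → E} (hG : ContDiff ℝ ∞ G) {τ : P → E}
    (hτ : ContDiff ℝ ∞ τ) {p₀ : P} (h₀ : ∀ r w, G (r, p₀, w) = 0) :
    ∃ (N : Set P) (γ : P → ℝ → E), IsOpen N ∧ p₀ ∈ N ∧ ContDiffOn ℝ ∞ (fun p => γ p 1) N ∧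
      γ p₀ 1 = τ p₀ ∧
      (∀ p ∈ N, γ p 0 = τ p ∧ ∀ r ∈ Icc (0 : ℝ) 1, HasDerivAt (γ p) (G (r, p, γ p r)) r) ∧
      ∀ O ∈ 𝓝 (τ p₀), ∀ᶠ p in 𝓝 p₀, ∀ r ∈ Icc (0 : ℝ) 1, γ p r ∈ O := by
  let C := C(Icc (0 : ℝ) 1, E)
  let tc : C(Icc (0 : ℝ) 1, ℝ × P × E) := ⟨fun r => (r, 0, 0), by fun_prop⟩
  let iP : P →L[ℝ] ℝ × P × E :=
    (ContinuousLinearMap.inr ℝ ℝ (P × E)).comp (ContinuousLinearMap.inl ℝ P E)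
  let iE : E →L[ℝ] ℝ × P × E :=
    (ContinuousLinearMap.inr ℝ ℝ (P × E)).comp (ContinuousLinearMap.inr ℝ P E)
  -- J (p, c) is the curve r ↦ (r, p, c r), written as a constant plus linear maps so that its
  -- smoothness is immediate.
  let J : P × C → C(Icc (0 : ℝ) 1, ℝ × P × E) := fun q =>
    tc + ((iP : C(P, ℝ × P × E)).comp (ContinuousMap.const _ q.1) +
      (iE : C(E, ℝ × P × E)).comp q.2)
  have hJ : ∀ q r, J q r = ((r : ℝ), q.1, q.2 r) := by
    intro q r
    simp [J, tc, iP, iE]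
  have hJs : ContDiff ℝ ∞ J :=
    contDiff_const.add (((contDiff_continuousMap_clm iP).comp
      (contDiff_continuousMap_const.comp contDiff_fst)).add
      ((contDiff_continuousMap_clm iE).comp contDiff_snd))
  let G' : C(ℝ × P × E, E) := ⟨G, hG.continuous⟩
  let R : P × C → C := fun q => primitive (G'.comp (J q))
  have hR : ContDiff ℝ ∞ R := by
    have h := ContinuousLinearMap.contDiff (𝕜 := ℝ) (E := C) (F := C) (n := ∞)
      (primitive (E := E))
    exact h.comp ((contDiff_continuousMap_comp G' hG).comp hJs)
  -- The zeros of Φ (p, ·) are the solutions of the integral equation. At p₀ the integral vanishes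
  -- for every curve, so Φ (p₀, c) = c - c₀ and solutions reach time 1 without any smallness
  -- assumption on G.
  let Φ : P × C → C := fun q => q.2 - ContinuousMap.const _ (τ q.1) - R q
  have hΦ : ContDiff ℝ ∞ Φ :=
    (contDiff_snd.sub (contDiff_continuousMap_const.comp (hτ.comp contDiff_fst))).sub hR
  have hR₀ : ∀ c, R (p₀, c) = 0 := by
    intro c
    have : G'.comp (J (p₀, c)) = 0 := by
      ext r
      simp [G', hJ, h₀]
    simp [R, this]
  obtain ⟨N, Γ, hN, hp₀, hΓ, hΓ₀, hsol⟩ := exists_contDiffOn_implicit hΦ (p₀ := p₀)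
    (c₀ := ContinuousMap.const _ (τ p₀)) (by simp [Φ, hR₀]) (by intro c; simp [Φ, hR₀])
  have hcont : ∀ p, Continuous fun s : ℝ =>
      G ((projIcc 0 1 zero_le_one s : Icc (0 : ℝ) 1), p, Γ p (projIcc 0 1 zero_le_one s)) := by
    intro p
    refine hG.continuous.comp ?_
    have := (Γ p).continuous.comp (continuous_projIcc (h := zero_le_one (α := ℝ)))
    exact (continuous_subtype_val.comp continuous_projIcc).prodMk (continuous_const.prodMk this)
  -- The integral is defined for all real r, so the derivative is two-sided even at r = 0 and r = 1.
  let γ : P → ℝ → E := fun p r => τ p + ∫ s in (0 : ℝ)..r,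
    G ((projIcc 0 1 zero_le_one s : Icc (0 : ℝ) 1), p, Γ p (projIcc 0 1 zero_le_one s))
  have hγ : ∀ p ∈ N, ∀ r : Icc (0 : ℝ) 1, γ p r = Γ p r := by
    intro p hp r
    have h1 : Γ p r - τ p - R (p, Γ p) r = 0 := by
      exact congrArg (fun c : C => c r) (hsol p hp)
    have h2 : R (p, Γ p) r = γ p r - τ p := by
      simp only [R, γ, add_sub_cancel_left]
      refine intervalIntegral.integral_congr fun s _ => ?_
      simp [G', hJ]
    rw [h2] at h1
    have h3 : Γ p r - γ p r = 0 := by rw [← h1]; abel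
    exact (sub_eq_zero.1 h3).symm
  refine ⟨N, γ, hN, hp₀, ?_, ?_, ?_, ?_⟩
  · have h1 : ContDiffOn ℝ ∞ (fun p => Γ p ⟨1, by simp⟩) N :=
      (ContinuousLinearMap.contDiff (𝕜 := ℝ) (E := C) (F := E) (n := ∞)
        (ContinuousMap.evalCLM ℝ ⟨1, by simp⟩)).comp_contDiffOn hΓ
    exact h1.congr fun p hp => hγ p hp ⟨1, by simp⟩
  · rw [hγ p₀ hp₀ ⟨1, by simp⟩, hΓ₀]; rfl
  · intro p hp
    refine ⟨by simp [γ], fun r hr => ?_⟩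
    have h1 := (intervalIntegral.integral_hasDerivAt_right ((hcont p).intervalIntegrable 0 r)
      ((hcont p).stronglyMeasurableAtFilter _ _) (hcont p).continuousAt).const_add (τ p)
    rw [projIcc_of_mem zero_le_one hr, ← hγ p hp ⟨r, hr⟩] at h1
    exact h1
  · intro O hO
    obtain ⟨ε, hε, hεO⟩ := Metric.mem_nhds_iff.1 hO
    have h1 : ContinuousAt Γ p₀ := (hΓ.contDiffAt (hN.mem_nhds hp₀)).continuousAt
    filter_upwards [Metric.continuousAt_iff'.1 h1 ε hε, hN.mem_nhds hp₀] with p hp hpN r hr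
    apply hεO
    rw [hγ p hpN ⟨r, hr⟩]
    have h2 := (ContinuousMap.dist_lt_iff hε).1 hp ⟨r, hr⟩
    rw [hΓ₀] at h2
    exact h2

end ParametricSolution

/-! ### Extension of a map from a section by solving an equation along the fibres. -/

section Intertwining

variable {X Y W Z : Type u} [NormedAddCommGroup X] [NormedSpace ℝ X] [FiniteDimensional ℝ X]
  [NormedAddCommGroup Y] [NormedSpace ℝ Y] [FiniteDimensional ℝ Y]
  [NormedAddCommGroup W] [NormedSpace ℝ W] [FiniteDimensional ℝ W]
  [NormedAddCommGroup Z] [NormedSpace ℝ Z]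

/-- Let `TU : X × Y → Z` have vertical derivatives which are combinations of vector fields `Ξ i`
along `TU`, and let the `Ξ i` lift through `TV : W → Z` to vector fields `H i` tangent to the fibres
of `SV : W → X`. Then a section `τ` of `SV` with `TV (τ x) = TU (x, σ x)` extends from the graph of
`σ` to a smooth map intertwining `TU` with `TV` and the projection to `X` with `SV`. -/
theorem exists_intertwining_map {ι : Type*} [Fintype ι] {TU : X × Y → Z} {A : ι → X × Y → ℝ}
    {ℓ : ι → Y →L[ℝ] ℝ} {Ξ : ι → Z → Z} {SV : W → X} {TV : W → Z} {H : ι → W → W} {σ : X → Y}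
    {τ : X → W} {z₀ : X × Y} {w₀ : W} {O₁ : Set (X × Y)} {O₂ : Set W} {O₃ : Set X}
    (hO₁ : IsOpen O₁) (hz₀ : z₀ ∈ O₁) (hO₂ : IsOpen O₂) (hw₀ : w₀ ∈ O₂) (hO₃ : IsOpen O₃)
    (hx₀ : z₀.1 ∈ O₃) (hTU : ContDiffOn ℝ ∞ TU O₁) (hA : ∀ i, ContDiffOn ℝ ∞ (A i) O₁)
    (hΞ : ∀ i, ContDiffAt ℝ ∞ (Ξ i) (TU z₀)) (hSV : ContDiffOn ℝ ∞ SV O₂)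
    (hTV : ContDiffOn ℝ ∞ TV O₂) (hH : ∀ i, ContDiffOn ℝ ∞ (H i) O₂) (hσ : ContDiffOn ℝ ∞ σ O₃)
    (hτ : ContDiffOn ℝ ∞ τ O₃) (hσ₀ : σ z₀.1 = z₀.2) (hτ₀ : τ z₀.1 = w₀)
    (hUd : ∀ z ∈ O₁, ∀ η : Y, fderiv ℝ TU z (0, η) = ∑ i, (ℓ i η * A i z) • Ξ i (TU z))
    (hSd : ∀ w ∈ O₂, ∀ i, fderiv ℝ SV w (H i w) = 0)
    (hTd : ∀ w ∈ O₂, ∀ i, fderiv ℝ TV w (H i w) = Ξ i (TV w))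
    (hSτ : ∀ x ∈ O₃, SV (τ x) = x) (hTτ : ∀ x ∈ O₃, TV (τ x) = TU (x, σ x)) :
    ∃ (N : Set (X × Y)) (f : X × Y → W), IsOpen N ∧ z₀ ∈ N ∧ ContDiffOn ℝ ∞ f N ∧ f z₀ = w₀ ∧
      ∀ z ∈ N, SV (f z) = z.1 ∧ TV (f z) = TU z := by
  have hXc := FiniteDimensional.complete ℝ X
  have hYc := FiniteDimensional.complete ℝ Y
  have hWc := FiniteDimensional.complete ℝ W
  have hn : (∞ : WithTop ℕ∞) ≠ 0 := by simp
  -- The data entering the differential equation are replaced by global smooth functions with the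
  -- same germs at the base points. `TU`, `TV` and `Ξ` are only used to check the result, and stay
  -- local.
  choose A' hA's hA' using fun i => exists_contDiff_eventuallyEq (hO₁.mem_nhds hz₀) (hA i)
  choose H' hH's hH' using fun i => exists_contDiff_eventuallyEq (hO₂.mem_nhds hw₀) (hH i)
  obtain ⟨σ', hσ's, hσ'⟩ := exists_contDiff_eventuallyEq (hO₃.mem_nhds hx₀) hσ
  obtain ⟨τ', hτ's, hτ'⟩ := exists_contDiff_eventuallyEq (hO₃.mem_nhds hx₀) hτ
  -- The segment in the fibre over p.1 from the graph of σ' to p. It is constant for p = z₀, since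
  -- z₀ lies on the graph; this makes the right-hand side of the equation vanish at z₀.
  let c : X × Y → ℝ → X × Y := fun p r => (p.1, σ' p.1 + r • (p.2 - σ' p.1))
  have hc₀ : ∀ r, c z₀ r = z₀ := by
    intro r
    have : σ' z₀.1 = z₀.2 := by rw [hσ'.self_of_nhds, hσ₀]
    ext1 <;> simp [c, this]
  have hcs : ContDiff ℝ ∞ fun q : (X × Y) × ℝ => c q.1 q.2 := by fun_prop
  -- By `hUd`, these are the coefficients along the `Ξ i` of the velocity of `TU` on the segment,
  -- near z₀.
  let a : X × Y → ι → ℝ → ℝ := fun p i r => ℓ i (p.2 - σ' p.1) * A' i (c p r)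
  have ha₀ : ∀ i r, a z₀ i r = 0 := by
    intro i r
    have : σ' z₀.1 = z₀.2 := by rw [hσ'.self_of_nhds, hσ₀]
    simp [a, this]
  have has : ∀ i, ContDiff ℝ ∞ fun q : (X × Y) × ℝ => a q.1 i q.2 := by
    intro i
    exact (ContDiff.clm_apply contDiff_const (by fun_prop)).mul ((hA's i).comp hcs)
  let G : ℝ × (X × Y) × W → W := fun q => ∑ i, a q.2.1 i q.1 • H' i q.2.2
  have hG : ContDiff ℝ ∞ G := by
    refine ContDiff.sum fun i _ => ContDiff.smul ?_ ((hH's i).comp (by fun_prop))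
    exact (has i).comp (f := fun q : ℝ × (X × Y) × W => (q.2.1, q.1)) (by fun_prop)
  obtain ⟨N, γ, hN, hzN, hγs, hγ₀, hγ, hγO⟩ := exists_parametric_solution hG
    (τ := fun p => τ' p.1) (hτ's.comp contDiff_fst) (p₀ := z₀) (by intro r w; simp [G, ha₀])
  have hτ'₀ : τ' z₀.1 = w₀ := by rw [hτ'.self_of_nhds, hτ₀]
  rw [hτ'₀] at hγ₀
  have hTVw : TV w₀ = TU z₀ := by
    rw [← hτ₀, hTτ _ hx₀, hσ₀]
  -- Local Lipschitz bounds for the `Ξ i`, which give uniqueness for the equation satisfied by both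
  -- image curves.
  choose K S hS hK using fun i =>
    ((hΞ i).of_le (show (1 : WithTop ℕ∞) ≤ ∞ by exact_mod_cast le_top)).exists_lipschitzOnWith
  have hQ₂ : ∀ᶠ w in 𝓝 w₀, w ∈ O₂ ∧ ∀ i, H' i w = H i w ∧ TV w ∈ S i := by
    refine (hO₂.eventually_mem hw₀).and (Filter.eventually_all.2 fun i => (hH' i).and ?_)
    exact (hTV.contDiffAt (hO₂.mem_nhds hw₀)).continuousAt (by rw [hTVw]; exact hS i)
  have hQ₁ : ∀ᶠ z in 𝓝 z₀, z ∈ O₁ ∧ ∀ i, A' i z = A i z ∧ TU z ∈ S i := by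
    refine (hO₁.eventually_mem hz₀).and (Filter.eventually_all.2 fun i => (hA' i).and ?_)
    exact (hTU.contDiffAt (hO₁.mem_nhds hz₀)).continuousAt (hS i)
  have hcQ : ∀ᶠ p in 𝓝 z₀, ∀ r ∈ Icc (0 : ℝ) 1,
      c p r ∈ O₁ ∧ ∀ i, A' i (c p r) = A i (c p r) ∧ TU (c p r) ∈ S i := by
    -- Tube lemma: the segment belonging to z₀ stays at z₀, so those of nearby p stay in the good
    -- neighbourhood for all r in [0, 1].
    refine isCompact_Icc.eventually_forall_of_forall_eventually fun r _ => ?_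
    have h : Filter.Tendsto (fun q : (X × Y) × ℝ => c q.1 q.2) (𝓝 (z₀, r)) (𝓝 z₀) := by
      have := hcs.continuous.tendsto (z₀, r)
      simpa only [hc₀] using this
    exact h.eventually hQ₁
  have hx : ∀ᶠ p in 𝓝 z₀, p.1 ∈ O₃ ∧ σ' p.1 = σ p.1 ∧ τ' p.1 = τ p.1 :=
    continuous_fst.continuousAt.eventually ((hO₃.eventually_mem hx₀).and (hσ'.and hτ'))
  obtain ⟨N', hN'sub, hN', hzN'⟩ := mem_nhds_iff.1
    ((hN.eventually_mem hzN).and ((hγO _ (by rw [hτ'₀]; exact hQ₂)).and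
      (hcQ.and hx)))
  refine ⟨N', fun p => γ p 1, hN', hzN', hγs.mono fun p hp => (hN'sub hp).1, hγ₀, ?_⟩
  intro p hp
  obtain ⟨hpN, hpγ, hpc, hpO₃, hpσ, hpτ⟩ := hN'sub hp
  obtain ⟨hγp0, hγd⟩ := hγ p hpN
  have hG' : ∀ r ∈ Icc (0 : ℝ) 1, G (r, p, γ p r) = ∑ i, a p i r • H i (γ p r) := by
    intro r hr
    exact Finset.sum_congr rfl fun i _ => by rw [((hpγ r hr).2 i).1]
  have hSγ : ∀ r ∈ Icc (0 : ℝ) 1, HasDerivAt (fun r => SV (γ p r)) 0 r := by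
    intro r hr
    have h1 : HasDerivAt (fun r => SV (γ p r)) _ r := ((hSV.contDiffAt (hO₂.mem_nhds (hpγ r hr).1)).differentiableAt
      hn).hasFDerivAt.comp_hasDerivAt r (hγd r hr)
    rw [hG' r hr, map_sum] at h1
    simpa [hSd _ (hpγ r hr).1] using h1
  have hTγ : ∀ r ∈ Icc (0 : ℝ) 1,
      HasDerivAt (fun r => TV (γ p r)) (∑ i, a p i r • Ξ i (TV (γ p r))) r := by
    intro r hr
    have h1 : HasDerivAt (fun r => TV (γ p r)) _ r := ((hTV.contDiffAt (hO₂.mem_nhds (hpγ r hr).1)).differentiableAt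
      hn).hasFDerivAt.comp_hasDerivAt r (hγd r hr)
    rw [hG' r hr, map_sum] at h1
    simpa [hTd _ (hpγ r hr).1] using h1
  have hTc : ∀ r ∈ Icc (0 : ℝ) 1,
      HasDerivAt (fun r => TU (c p r)) (∑ i, a p i r • Ξ i (TU (c p r))) r := by
    intro r hr
    have h2 : HasDerivAt (c p) (0, p.2 - σ' p.1) r := by
      refine (hasDerivAt_const r p.1).prodMk ?_
      simpa using ((hasDerivAt_id r).smul_const (p.2 - σ' p.1)).const_add (σ' p.1)
    have h1 : HasDerivAt (fun r => TU (c p r)) _ r := ((hTU.contDiffAt (hO₁.mem_nhds (hpc r hr).1)).differentiableAt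
      hn).hasFDerivAt.comp_hasDerivAt r h2
    rw [hUd _ (hpc r hr).1] at h1
    have h3 : ∑ i, a p i r • Ξ i (TU (c p r)) =
        ∑ i, (ℓ i (p.2 - σ' p.1) * A i (c p r)) • Ξ i (TU (c p r)) :=
      Finset.sum_congr rfl fun i _ => by rw [← ((hpc r hr).2 i).1]
    rw [h3]
    exact h1
  have hc1 : c p 1 = p := by ext1 <;> simp [c]
  have h01 : (1 : ℝ) ∈ Icc (0 : ℝ) 1 := by simp
  have h00 : (0 : ℝ) ∈ Icc (0 : ℝ) 1 := by simp
  constructor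
  · have h1 := constant_of_has_deriv_right_zero
      (fun r hr => (hSγ r hr).continuousAt.continuousWithinAt)
      (fun r hr => (hSγ r (Ico_subset_Icc_self hr)).hasDerivWithinAt) 1 h01
    rw [h1, hγp0, hpτ, hSτ _ hpO₃]
  -- Grönwall: the difference of the two image curves vanishes at r = 0 and has derivative bounded
  -- by k r times its norm.
  · let k : ℝ → ℝ := fun r => ∑ i, |a p i r| * K i
    have hk : Continuous k := by
      refine continuous_finsetSum _ fun i _ => Continuous.mul (Continuous.abs ?_) continuous_const
      exact (has i).continuous.comp (f := fun r : ℝ => (p, r)) (by fun_prop)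
    obtain ⟨B, hB⟩ := (isCompact_Icc (a := (0 : ℝ)) (b := 1)).bddAbove_image hk.continuousOn
    have hD : ∀ r ∈ Icc (0 : ℝ) 1, HasDerivAt (fun r => TV (γ p r) - TU (c p r))
        (∑ i, a p i r • (Ξ i (TV (γ p r)) - Ξ i (TU (c p r)))) r := by
      intro r hr
      simp only [smul_sub, Finset.sum_sub_distrib]
      exact (hTγ r hr).sub (hTc r hr)
    have h1 := eq_zero_of_abs_deriv_le_mul_abs_self_of_eq_zero_right (K := B)
      (fun r hr => (hD r hr).continuousAt.continuousWithinAt)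
      (fun r hr => (hD r (Ico_subset_Icc_self hr)).hasDerivWithinAt)
      (by
        rw [hγp0, hpτ, hTτ _ hpO₃, sub_eq_zero]
        simp [c, hpσ])
      (fun r hr => by
        have hr := Ico_subset_Icc_self hr
        refine (norm_sum_le _ _).trans (le_trans ?_ (mul_le_mul_of_nonneg_right
          (hB (mem_image_of_mem k hr)) (norm_nonneg _)))
        rw [Finset.sum_mul]
        refine Finset.sum_le_sum fun i _ => ?_
        rw [norm_smul, Real.norm_eq_abs, mul_assoc]
        refine mul_le_mul_of_nonneg_left ?_ (abs_nonneg _)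
        exact (hK i).norm_sub_le ((hpγ r hr).2 i).2 ((hpc r hr).2 i).2) 1 h01
    rw [hc1] at h1
    exact sub_eq_zero.1 h1

end Intertwining

set_option linter.unusedSectionVars false

/-! ### Vector fields in charts -/

section Fields

variable {n : ℕ} {N : Type v} [TopologicalSpace N] [ChartedSpace (Euc n) N]
  [IsManifold (𝓡 n) ∞ N]

theorem mdifferentiable_of_mem_maximalAtlas {φ : OpenPartialHomeomorph N (Euc n)}
    (hφ : φ ∈ IsManifold.maximalAtlas (𝓡 n) ∞ N) : φ.MDifferentiable (𝓡 n) (𝓡 n) :=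
  ⟨(contMDiffOn_of_mem_maximalAtlas hφ).mdifferentiableOn (by simp),
    (contMDiffOn_symm_of_mem_maximalAtlas hφ).mdifferentiableOn (by simp)⟩

theorem mfderiv_chart_injective {φ : OpenPartialHomeomorph N (Euc n)}
    (hφ : φ ∈ IsManifold.maximalAtlas (𝓡 n) ∞ N) {y : N} (hy : y ∈ φ.source) :
    Function.Injective (mfderiv (𝓡 n) (𝓡 n) φ y) :=
  (mdifferentiable_of_mem_maximalAtlas hφ).mfderiv_injective hy

theorem isInvertible_mfderiv_chart {φ : OpenPartialHomeomorph N (Euc n)}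
    (hφ : φ ∈ IsManifold.maximalAtlas (𝓡 n) ∞ N) {y : N} (hy : y ∈ φ.source) :
    (mfderiv (𝓡 n) (𝓡 n) φ y).IsInvertible :=
  ⟨(mdifferentiable_of_mem_maximalAtlas hφ).mfderiv hy, rfl⟩

/-- The vector field which is constant equal to `w` in the chart `φ`. -/
def chartField (φ : OpenPartialHomeomorph N (Euc n)) (w : Euc n) : VecField n N :=
  VectorField.mpullback (𝓡 n) (𝓡 n) φ (fun _ => w)

theorem chartField_apply (φ : OpenPartialHomeomorph N (Euc n)) (w : Euc n) (y : N) :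
    chartField φ w y = (mfderiv (𝓡 n) (𝓡 n) φ y).inverse w := rfl

theorem smoothFieldOn_chartField {φ : OpenPartialHomeomorph N (Euc n)}
    (hφ : φ ∈ IsManifold.maximalAtlas (𝓡 n) ∞ N) (w : Euc n) :
    SmoothFieldOn (chartField φ w) φ.source := by
  intro y hy
  have h1 : ContMDiffAt (𝓡 n) (𝓡 n).tangent ∞
      (fun z : Euc n => (⟨z, w⟩ : TangentBundle (𝓡 n) (Euc n))) (φ y) := by
    rw [← contMDiffWithinAt_univ]
    exact contMDiffWithinAt_vectorSpace_iff_contDiffWithinAt.2 contDiffWithinAt_const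
  exact (h1.mpullback_vectorField_preimage
    ((contMDiffOn_of_mem_maximalAtlas hφ).contMDiffAt (φ.open_source.mem_nhds hy))
    (isInvertible_mfderiv_chart hφ hy) (by simp)).contMDiffWithinAt

theorem mfderiv_chartField {φ : OpenPartialHomeomorph N (Euc n)}
    (hφ : φ ∈ IsManifold.maximalAtlas (𝓡 n) ∞ N) (w : Euc n) {y : N} (hy : y ∈ φ.source) :
    mfderiv (𝓡 n) (𝓡 n) φ y (chartField φ w y) = w := by
  obtain ⟨A, hA⟩ := isInvertible_mfderiv_chart hφ hy
  rw [chartField_apply, ← hA, ContinuousLinearMap.inverse_equiv]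
  exact A.apply_symm_apply w

/-- The derivative of a vector-valued smooth function along a smooth field is smooth. -/
theorem contMDiffOn_mfderiv_apply {E : Type*} [NormedAddCommGroup E] [NormedSpace ℝ E]
    {g : N → E} {O : Set N} (hO : IsOpen O) (hg : ContMDiffOn (𝓡 n) 𝓘(ℝ, E) ∞ g O)
    {X : VecField n N} (hX : SmoothFieldOn X O) :
    ContMDiffOn (𝓡 n) 𝓘(ℝ, E) ∞ (fun y => (mfderiv (𝓡 n) 𝓘(ℝ, E) g y (X y) : E)) O := by
  have h1 := (hg.contMDiffOn_tangentMapWithin (m := ∞) (by simp) hO.uniqueMDiffOn).comp hX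
    (fun y hy => hy)
  have h2 := (contMDiff_snd_tangentBundle_modelSpace E 𝓘(ℝ, E) (n := ∞)).comp_contMDiffOn h1
  refine h2.congr fun y hy => ?_
  change _ = (mfderivWithin (𝓡 n) 𝓘(ℝ, E) g O y (X y) : E)
  rw [mfderivWithin_of_isOpen hO hy]

/-- The coefficient vector varies with y here; expanding it in the standard basis reduces the claim
to fields which are constant in the chart. -/
theorem smoothFieldOn_chartField_comp {φ : OpenPartialHomeomorph N (Euc n)}
    (hφ : φ ∈ IsManifold.maximalAtlas (𝓡 n) ∞ N) {c : N → Euc n} {O : Set N} (hO : O ⊆ φ.source)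
    (hc : ContMDiffOn (𝓡 n) (𝓡 n) ∞ c O) :
    SmoothFieldOn (fun y => chartField φ (c y) y) O := by
  have h1 : ∀ i, ContMDiffOn (𝓡 n) 𝓘(ℝ, ℝ) ∞ (fun y => c y i) O := by
    intro i
    exact (contMDiff_iff_contDiff.2 (EuclideanSpace.proj (𝕜 := ℝ) i).contDiff).comp_contMDiffOn hc
  have h2 : SmoothFieldOn (fun y => ∑ i, c y i • chartField φ (EuclideanSpace.single i 1) y) O :=
    ContMDiffOn.sum_section fun i _ =>
      (h1 i).smul_section ((smoothFieldOn_chartField hφ (EuclideanSpace.single i 1)).mono hO)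
  refine h2.congr fun y _ => ?_
  have h3 : chartField φ (c y) y = ∑ i, c y i • chartField φ (EuclideanSpace.single i 1) y := by
    have h4 : c y = ∑ i, c y i • EuclideanSpace.single i (1 : ℝ) := by
      ext j
      simp [Pi.single_apply]
    let A : Euc n →L[ℝ] TangentSpace (𝓡 n) y := (mfderiv (𝓡 n) (𝓡 n) φ y).inverse
    have h5 : A (c y) = ∑ i, c y i • A (EuclideanSpace.single i 1) := by
      conv_lhs => rw [h4]
      simp only [map_sum, map_smul]
    exact h5
  exact congrArg (Bundle.TotalSpace.mk y) h3

theorem exists_bump [T2Space N] {O : Set N} {y : N} (hO : O ∈ 𝓝 y) :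
    ∃ χ ∈ compactFunctions n N, tsupport χ ⊆ O ∧ χ =ᶠ[𝓝 y] 1 := by
  obtain ⟨f, -, hf⟩ := (SmoothBumpFunction.nhds_basis_tsupport (I := 𝓡 n) y).mem_iff.1 hO
  exact ⟨f, ⟨f.contMDiff, f.hasCompactSupport⟩, hf, f.eventuallyEq_one⟩

theorem fieldSupport_smul_subset_left (f : N → ℝ) (X : VecField n N) :
    fieldSupport (fun y => f y • X y) ⊆ tsupport f :=
  closure_mono fun y hy hf => hy (by simp [hf])

theorem fieldSupport_smul_subset_right (f : N → ℝ) (X : VecField n N) :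
    fieldSupport (fun y => f y • X y) ⊆ fieldSupport X :=
  closure_mono fun y hy hX => hy (by simp [hX])

theorem smul_mem_compactFields {χ : N → ℝ} (hχ : χ ∈ compactFunctions n N) {O : Set N}
    (hO : IsOpen O) (hχO : tsupport χ ⊆ O) {X : VecField n N} (hX : SmoothFieldOn X O) :
    (fun y => χ y • X y) ∈ compactFields n N :=
  ⟨(hχ.1.contMDiffOn.smul_section_of_tsupport hO hχO hX).contMDiffOn,
    hχ.2.of_isClosed_subset isClosed_closure (fieldSupport_smul_subset_left χ X)⟩

theorem compactFields.smul {f : N → ℝ} (hf : ContMDiff (𝓡 n) 𝓘(ℝ, ℝ) ∞ f) {X : VecField n N}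
    (hX : X ∈ compactFields n N) : (fun y => f y • X y) ∈ compactFields n N :=
  ⟨hf.contMDiffOn.smul_section hX.1,
    hX.2.of_isClosed_subset isClosed_closure (fieldSupport_smul_subset_right f X)⟩

theorem compactFields.zero : (fun _ => 0 : VecField n N) ∈ compactFields n N :=
  ⟨(Bundle.contMDiff_zeroSection ℝ (TangentSpace (𝓡 n) : N → Type)).contMDiffOn, by
    simp [fieldSupport]⟩

theorem compactFields.add {X Y : VecField n N} (hX : X ∈ compactFields n N)
    (hY : Y ∈ compactFields n N) : (fun y => X y + Y y) ∈ compactFields n N := by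
  refine ⟨hX.1.add_section hY.1, (hX.2.union hY.2).of_isClosed_subset isClosed_closure ?_⟩
  rw [fieldSupport, fieldSupport, fieldSupport, ← closure_union]
  refine closure_mono fun y hy => ?_
  by_contra h
  simp only [mem_union, mem_ofPred_eq, not_or, not_not] at h
  exact hy (by simp [h.1, h.2])

theorem compactFields.sum {ι : Type*} (s : Finset ι) {X : ι → VecField n N}
    (hX : ∀ i ∈ s, X i ∈ compactFields n N) : (fun y => ∑ i ∈ s, X i y) ∈ compactFields n N := by
  classical
  induction s using Finset.induction_on with
  | empty => simpa using compactFields.zero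
  | insert i s hi ih =>
    simp only [Finset.sum_insert hi]
    exact compactFields.add (hX i (by simp)) (ih fun j hj => hX j (by simp [hj]))

theorem compactFields.sub {X Y : VecField n N} (hX : X ∈ compactFields n N)
    (hY : Y ∈ compactFields n N) : (fun y => X y - Y y) ∈ compactFields n N := by
  have := compactFields.add hX (compactFields.smul (f := fun _ => -1) contMDiff_const hY)
  simpa [sub_eq_add_neg] using this

/-- This glues local solutions: ρ i is nonzero only where the local statement at the centre i holds,
and compactness keeps the sum finite. -/
theorem exists_finite_partition [T2Space N] [SecondCountableTopology N] {K : Set N}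
    (hK : IsCompact K) {O : N → Set N} (hO : ∀ y ∈ K, O y ∈ 𝓝 y) :
    ∃ (s : Finset N) (ρ : s → N → ℝ), (∀ i ∈ s, i ∈ K) ∧
      (∀ i, ContMDiff (𝓡 n) 𝓘(ℝ, ℝ) ∞ (ρ i)) ∧ (∀ i y, ρ i y ≠ 0 → y ∈ O i) ∧
      ∀ y ∈ K, ∑ i, ρ i y = 1 := by
  have : LocallyCompactSpace N := ChartedSpace.locallyCompactSpace (Euc n) N
  obtain ⟨s, hsK, hs⟩ := hK.elim_nhds_subcover (fun y => interior (O y))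
    (fun y hy => interior_mem_nhds.2 (hO y hy))
  obtain ⟨f, hf⟩ := SmoothPartitionOfUnity.exists_isSubordinate (𝓡 n) hK.isClosed
    (fun i : s => interior (O i)) (fun _ => isOpen_interior) (by
      intro y hy
      obtain ⟨i, hi, hyi⟩ := mem_iUnion₂.1 (hs hy)
      exact mem_iUnion.2 ⟨⟨i, hi⟩, hyi⟩)
  refine ⟨s, fun i => f i, hsK, fun i => (f i).contMDiff,
    fun i y hy => interior_subset (hf i (subset_tsupport _ hy)), fun y hy => ?_⟩
  rw [← finsum_eq_sum_of_fintype]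
  exact f.sum_eq_one hy

end Fields

/-! ### Submersions in charts -/

section SubmersionCharts

variable {m n : ℕ} {M : Type u} [TopologicalSpace M] [ChartedSpace (Euc m) M]
  [IsManifold (𝓡 m) ∞ M] {N : Type v} [TopologicalSpace N] [ChartedSpace (Euc n) N]
  [IsManifold (𝓡 n) ∞ N]

/-- A pair of charts in which the map `p` is the projection of a product onto its first factor. -/
structure IsSubmersionChart {F : Type} [NormedAddCommGroup F] [NormedSpace ℝ F] (p : N → M)
    (φ : OpenPartialHomeomorph N (Euc n)) (κ : OpenPartialHomeomorph M (Euc m))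
    (e : Euc n ≃L[ℝ] Euc m × F) : Prop where
  mem_left : φ ∈ IsManifold.maximalAtlas (𝓡 n) ∞ N
  mem_right : κ ∈ IsManifold.maximalAtlas (𝓡 m) ∞ M
  mapsTo : ∀ y ∈ φ.source, p y ∈ κ.source
  eq_fst : ∀ y ∈ φ.source, κ (p y) = (e (φ y)).1

theorem isSubmersionChart_of_isSubmersionAtOfComplement {F : Type} [NormedAddCommGroup F]
    [NormedSpace ℝ F] {p : N → M} {y : N} (h : IsSubmersionAtOfComplement F (𝓡 n) (𝓡 m) ∞ p y) :
    IsSubmersionChart p h.domChart h.codChart h.equiv := by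
  refine ⟨h.domChart_mem_maximalAtlas, h.codChart_mem_maximalAtlas,
    fun y hy => h.source_subset_preimage_source hy, fun y hy => ?_⟩
  have := h.writtenInCharts (show h.domChart y ∈ (h.domChart.extend (𝓡 n)).target by
    simpa using h.domChart.map_source hy)
  simpa [h.domChart.left_inv hy] using this

theorem exists_isSubmersionChart {p : N → M} (hp : IsSubmersion (𝓡 n) (𝓡 m) ∞ p) (y : N) :
    ∃ (F : Type) (_ : NormedAddCommGroup F) (_ : NormedSpace ℝ F) (_ : FiniteDimensional ℝ F)
      (φ : OpenPartialHomeomorph N (Euc n)) (κ : OpenPartialHomeomorph M (Euc m))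
      (e : Euc n ≃L[ℝ] Euc m × F), IsSubmersionChart p φ κ e ∧ y ∈ φ.source := by
  have h := hp.isSubmersionOfComplement_complement y
  have hF : FiniteDimensional ℝ (Euc m × hp.complement) :=
    h.equiv.toLinearEquiv.finiteDimensional
  have hF' : FiniteDimensional ℝ hp.complement :=
    Module.Finite.of_surjective (LinearMap.snd ℝ (Euc m) hp.complement) LinearMap.snd_surjective
  exact ⟨hp.complement, _, _, hF', h.domChart, h.codChart, h.equiv,
    isSubmersionChart_of_isSubmersionAtOfComplement h, h.mem_domChart_source⟩

theorem mfderiv_clm_comp {E E' : Type*} [NormedAddCommGroup E] [NormedSpace ℝ E]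
    [NormedAddCommGroup E'] [NormedSpace ℝ E'] (L : E →L[ℝ] E') {g : N → E} {y : N}
    (hg : MDifferentiableAt (𝓡 n) 𝓘(ℝ, E) g y) (v : TangentSpace (𝓡 n) y) :
    (mfderiv (𝓡 n) 𝓘(ℝ, E') (fun y => L (g y)) y v : E') =
      L (mfderiv (𝓡 n) 𝓘(ℝ, E) g y v : E) := by
  have h := L.hasMFDerivAt.comp y hg.hasMFDerivAt
  have h2 : mfderiv (𝓡 n) 𝓘(ℝ, E') (fun y => L (g y)) y = _ := h.mfderiv
  rw [h2]
  rfl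

theorem IsSubmersionChart.mfderiv_fst {F : Type} [NormedAddCommGroup F] [NormedSpace ℝ F]
    {p : N → M} {φ : OpenPartialHomeomorph N (Euc n)} {κ : OpenPartialHomeomorph M (Euc m)}
    {e : Euc n ≃L[ℝ] Euc m × F} (h : IsSubmersionChart p φ κ e)
    (hp : MDifferentiable (𝓡 n) (𝓡 m) p) {y : N} (hy : y ∈ φ.source)
    (v : TangentSpace (𝓡 n) y) :
    (mfderiv (𝓡 m) (𝓡 m) κ (p y) (mfderiv (𝓡 n) (𝓡 m) p y v) : Euc m) =
      (e (mfderiv (𝓡 n) (𝓡 n) φ y v : Euc n)).1 := by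
  have h1 : (fun y => κ (p y)) =ᶠ[𝓝 y]
      fun y => ((ContinuousLinearMap.fst ℝ (Euc m) F).comp (e : Euc n →L[ℝ] Euc m × F)) (φ y) := by
    filter_upwards [φ.open_source.mem_nhds hy] with z hz using h.eq_fst z hz
  have h2 : mfderiv (𝓡 n) (𝓡 m) (fun y => κ (p y)) y = _ :=
    mfderiv_comp y ((mdifferentiable_of_mem_maximalAtlas h.mem_right).mdifferentiableAt
      (h.mapsTo y hy)) (hp y)
  have h3 := mfderiv_clm_comp
    ((ContinuousLinearMap.fst ℝ (Euc m) F).comp (e : Euc n →L[ℝ] Euc m × F))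
    ((mdifferentiable_of_mem_maximalAtlas h.mem_left).mdifferentiableAt hy) v
  rw [← h1.mfderiv_eq, h2] at h3
  exact h3

end SubmersionCharts

/-! ### Vertical fields in submersion charts -/

section VerticalFields

variable {m n : ℕ} {M : Type u} [TopologicalSpace M] [ChartedSpace (Euc m) M]
  [IsManifold (𝓡 m) ∞ M] {N : Type v} [TopologicalSpace N] [ChartedSpace (Euc n) N]
  [IsManifold (𝓡 n) ∞ N] {F : Type} [NormedAddCommGroup F] [NormedSpace ℝ F]
  {p : N → M} {φ : OpenPartialHomeomorph N (Euc n)} {κ : OpenPartialHomeomorph M (Euc m)}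
  {e : Euc n ≃L[ℝ] Euc m × F}

theorem IsSubmersionChart.mfderiv_chartField_eq_zero (hc : IsSubmersionChart p φ κ e)
    (hp : MDifferentiable (𝓡 n) (𝓡 m) p) (a : F) {y : N} (hy : y ∈ φ.source) :
    mfderiv (𝓡 n) (𝓡 m) p y (chartField φ (e.symm (0, a)) y) = 0 := by
  apply mfderiv_chart_injective hc.mem_right (hc.mapsTo y hy)
  rw [map_zero]
  refine (hc.mfderiv_fst hp hy _).trans ?_
  rw [mfderiv_chartField hc.mem_left _ hy]
  simp only [ContinuousLinearEquiv.apply_symm_apply]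
  rfl

theorem IsSubmersionChart.smul_chartField_mem (hc : IsSubmersionChart p φ κ e)
    (hp : MDifferentiable (𝓡 n) (𝓡 m) p) {χ : N → ℝ} (hχ : χ ∈ compactFunctions n N)
    (hχO : tsupport χ ⊆ φ.source) (a : F) :
    (fun y => χ y • chartField φ (e.symm (0, a)) y) ∈ kernelFields m n p := by
  refine ⟨smul_mem_compactFields hχ φ.open_source hχO (smoothFieldOn_chartField hc.mem_left _),
    fun y => ?_⟩
  by_cases hy : y ∈ φ.source
  · simp only [map_smul, hc.mfderiv_chartField_eq_zero hp a hy, smul_zero]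
  · beta_reduce
    rw [image_eq_zero_of_notMem_tsupport fun h => hy (hχO h), zero_smul, map_zero]

theorem chartField_eq_sum {ι : Type*} [Fintype ι] (b : Module.Basis ι ℝ F) (a : F) (y : N) :
    chartField φ (e.symm (0, a)) y = ∑ i, b.repr a i • chartField φ (e.symm (0, b i)) y := by
  let A : Euc n →L[ℝ] TangentSpace (𝓡 n) y := (mfderiv (𝓡 n) (𝓡 n) φ y).inverse
  let B : F →L[ℝ] TangentSpace (𝓡 n) y :=
    A.comp ((e.symm : Euc m × F →L[ℝ] Euc n).comp (ContinuousLinearMap.inr ℝ (Euc m) F))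
  have h4 : B a = ∑ i, b.repr a i • B (b i) := by
    conv_lhs => rw [← b.sum_repr a]
    simp only [map_sum, map_smul]
  exact h4

/-- A vector which is vertical for `p` is constant in the chart with vertical coordinates. -/
theorem IsSubmersionChart.eq_chartField (hc : IsSubmersionChart p φ κ e)
    (hp : MDifferentiable (𝓡 n) (𝓡 m) p) {y : N} (hy : y ∈ φ.source) {v : TangentSpace (𝓡 n) y}
    (hv : mfderiv (𝓡 n) (𝓡 m) p y v = 0) :
    v = chartField φ (e.symm (0, (e (mfderiv (𝓡 n) (𝓡 n) φ y v : Euc n)).2)) y := by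
  apply mfderiv_chart_injective hc.mem_left hy
  rw [mfderiv_chartField hc.mem_left _ hy]
  refine (e.symm_apply_apply _).symm.trans (congrArg e.symm ?_)
  refine Prod.ext ?_ rfl
  refine (hc.mfderiv_fst hp hy v).symm.trans ?_
  rw [hv, map_zero]
  rfl

end VerticalFields

/-! ### The pull-back of a foliation -/

section Pullback

variable {m n : ℕ} {M : Type u} [TopologicalSpace M] [ChartedSpace (Euc m) M]
  [IsManifold (𝓡 m) ∞ M] {𝓕 : Foliation m M} {N : Type v} [TopologicalSpace N]
  [ChartedSpace (Euc n) N] [IsManifold (𝓡 n) ∞ N] {p : N → M}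

theorem compactFunctions.mul_left {f g : N → ℝ} (hf : ContMDiff (𝓡 n) 𝓘(ℝ, ℝ) ∞ f)
    (hg : g ∈ compactFunctions n N) : (fun y => f y * g y) ∈ compactFunctions n N :=
  ⟨hf.mul hg.1, hg.2.mul_left⟩

theorem pullbackModule.zero : (fun _ => 0) ∈ 𝓕.pullbackModule n p :=
  ⟨0, Fin.elim0, Fin.elim0, fun j => j.elim0, fun y => by simp⟩

theorem pullbackModule.add {Y Y' : ∀ y : N, TangentSpace (𝓡 m) (p y)}
    (h : Y ∈ 𝓕.pullbackModule n p) (h' : Y' ∈ 𝓕.pullbackModule n p) :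
    (fun y => Y y + Y' y) ∈ 𝓕.pullbackModule n p := by
  obtain ⟨k, f, ξ, hfξ, hY⟩ := h
  obtain ⟨k', f', ξ', hfξ', hY'⟩ := h'
  refine ⟨k + k', Fin.append f f', Fin.append ξ ξ', fun j => ?_, fun y => ?_⟩
  · refine Fin.addCases (fun i => ?_) (fun i => ?_) j
    · simpa using hfξ i
    · simpa using hfξ' i
  · simp [Fin.sum_univ_add, hY y, hY' y]

theorem pullbackModule.sum {ι : Type*} (s : Finset ι)
    {Y : ι → ∀ y : N, TangentSpace (𝓡 m) (p y)} (h : ∀ i ∈ s, Y i ∈ 𝓕.pullbackModule n p) :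
    (fun y => ∑ i ∈ s, Y i y) ∈ 𝓕.pullbackModule n p := by
  classical
  induction s using Finset.induction_on with
  | empty => simpa using pullbackModule.zero
  | insert i s hi ih =>
    simp only [Finset.sum_insert hi]
    exact pullbackModule.add (h i (by simp)) (ih fun j hj => h j (by simp [hj]))

theorem pullbackModule.single {f : N → ℝ} (hf : f ∈ compactFunctions n N) {ξ : VecField m M}
    (hξ : ξ ∈ 𝓕.fields) : (fun y => f y • ξ (p y)) ∈ 𝓕.pullbackModule n p :=
  ⟨1, fun _ => f, fun _ => ξ, fun _ => ⟨hf, hξ⟩, fun y => by simp⟩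

theorem pullbackModule.smul {f : N → ℝ} (hf : ContMDiff (𝓡 n) 𝓘(ℝ, ℝ) ∞ f)
    {Y : ∀ y : N, TangentSpace (𝓡 m) (p y)} (h : Y ∈ 𝓕.pullbackModule n p) :
    (fun y => f y • Y y) ∈ 𝓕.pullbackModule n p := by
  obtain ⟨k, g, ξ, hgξ, hY⟩ := h
  refine ⟨k, fun j y => f y * g j y, ξ,
    fun j => ⟨compactFunctions.mul_left hf (hgξ j).1, (hgξ j).2⟩, fun y => ?_⟩
  simp [hY y, Finset.smul_sum, mul_smul]

/-- Membership in the pull-back module is a local property. -/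
theorem mem_pullbackModule_of_locally [T2Space N] [SecondCountableTopology N]
    {Y : ∀ y : N, TangentSpace (𝓡 m) (p y)} {K : Set N} (hK : IsCompact K)
    (hYK : ∀ y ∉ K, Y y = 0)
    (h : ∀ y ∈ K, ∃ Y' ∈ 𝓕.pullbackModule n p, ∀ᶠ z in 𝓝 y, Y z = Y' z) :
    Y ∈ 𝓕.pullbackModule n p := by
  choose! Y' hY' hYY' using h
  obtain ⟨s, ρ, hsK, hρ, hρO, hρ1⟩ := exists_finite_partition (n := n) hK hYY'
  -- Y may replace Y' i wherever ρ i is nonzero; the ρ i sum to 1 on K, and Y vanishes elsewhere.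
  have h1 : Y = fun y => ∑ i : s, ρ i y • Y' i y := by
    funext y
    have h2 : ∀ i : s, ρ i y • Y' i y = ρ i y • Y y := by
      intro i
      by_cases hi : ρ i y = 0
      · simp [hi]
      · rw [show Y y = Y' i y from hρO i y hi]
    simp only [h2, ← Finset.sum_smul]
    by_cases hy : y ∈ K
    · rw [hρ1 y hy, one_smul]
    · rw [hYK y hy, smul_zero]
  rw [h1]
  exact pullbackModule.sum _ fun i _ => pullbackModule.smul (hρ i) (hY' i (hsK i i.2))

/-- The coefficients are smooth on O only; a bump function makes them global and compactly supported
without changing them near y. -/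
theorem exists_pullbackModule_eventuallyEq [T2Space N] {ι : Type*} [Fintype ι] {f : ι → N → ℝ}
    {ξ : ι → VecField m M} {O : Set N} {y : N} (hO : IsOpen O) (hy : y ∈ O)
    (hf : ∀ i, ContMDiffOn (𝓡 n) 𝓘(ℝ, ℝ) ∞ (f i) O) (hξ : ∀ i, ξ i ∈ 𝓕.fields)
    {Y : ∀ y : N, TangentSpace (𝓡 m) (p y)}
    (hY : ∀ᶠ z in 𝓝 y, Y z = ∑ i, f i z • ξ i (p z)) :
    ∃ Y' ∈ 𝓕.pullbackModule n p, ∀ᶠ z in 𝓝 y, Y z = Y' z := by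
  obtain ⟨χ, hχ, hχO, hχ1⟩ := exists_bump (n := n) (hO.mem_nhds hy)
  refine ⟨fun z => ∑ i, (χ z * f i z) • ξ i (p z),
    pullbackModule.sum _ fun i _ => pullbackModule.single ⟨?_, hχ.2.mul_right⟩ (hξ i), ?_⟩
  · refine contMDiff_of_tsupport fun z hz => ?_
    have hzO : z ∈ O := hχO (tsupport_mul_subset_left hz)
    exact hχ.1.contMDiffAt.mul ((hf i).contMDiffAt (hO.mem_nhds hzO))
  · filter_upwards [hY, hχ1] with z hz hz1
    simp [hz, hz1]

end Pullback

/-! ### Local structure of bi-submersions -/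

section BiSubmersionLocal

variable {m : ℕ} {M : Type u} [TopologicalSpace M] [ChartedSpace (Euc m) M]
  [IsManifold (𝓡 m) ∞ M] {𝓕 : Foliation m M} {U : SubmersionPair.{u, v} m M}

theorem SubmersionPair.mdifferentiable_s (U : SubmersionPair.{u, v} m M) :
    MDifferentiable (𝓡 U.dim) (𝓡 m) U.s :=
  U.isSubmersion_s.contMDiff.mdifferentiable (by simp)

theorem SubmersionPair.mdifferentiable_t (U : SubmersionPair.{u, v} m M) :
    MDifferentiable (𝓡 U.dim) (𝓡 m) U.t :=
  U.isSubmersion_t.contMDiff.mdifferentiable (by simp)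

/-- Allows every result about t and ker ds to be used with s and t exchanged. -/
theorem IsBiSubmersion.inverse (h : IsBiSubmersion 𝓕 U) : IsBiSubmersion 𝓕 U.inverse where
  pullback_eq := h.pullback_eq.symm
  pullback_eq_add := by
    change 𝓕.pullback U.dim U.t = {Z | ∃ X ∈ kernelFields m U.dim U.t,
      ∃ Y ∈ kernelFields m U.dim U.s, ∀ u, Z u = X u + Y u}
    rw [← h.pullback_eq, h.pullback_eq_add]
    ext Z
    constructor
    · rintro ⟨X, hX, Y, hY, hZ⟩
      exact ⟨Y, hY, X, hX, fun u => (hZ u).trans (add_comm (G := Euc U.dim) _ _)⟩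
    · rintro ⟨X, hX, Y, hY, hZ⟩
      exact ⟨Y, hY, X, hX, fun u => (hZ u).trans (add_comm (G := Euc U.dim) _ _)⟩

/-- The differential of `t` maps vector fields in `ker ds` into `t^*(𝓕)`. -/
theorem IsBiSubmersion.mfderiv_t_mem (h : IsBiSubmersion 𝓕 U) {X : VecField U.dim U.carrier}
    (hX : X ∈ kernelFields m U.dim U.s) :
    (fun y => mfderiv (𝓡 U.dim) (𝓡 m) U.t y (X y)) ∈ 𝓕.pullbackModule U.dim U.t := by
  have h1 : X ∈ 𝓕.pullback U.dim U.s := by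
    refine ⟨hX.1, ?_⟩
    simp only [hX.2]
    exact pullbackModule.zero
  rw [h.pullback_eq] at h1
  exact h1.2

/-- The vector fields of the foliation lift locally through `t` to vector fields in `ker ds`. -/
theorem IsBiSubmersion.exists_lift (h : IsBiSubmersion 𝓕 U) {ξ : VecField m M}
    (hξ : ξ ∈ 𝓕.fields) (u : U.carrier) :
    ∃ X ∈ kernelFields m U.dim U.s,
      ∀ᶠ y in 𝓝 u, mfderiv (𝓡 U.dim) (𝓡 m) U.t y (X y) = ξ (U.t y) := by
  obtain ⟨F, _, _, _, φ, κ, e, hc, hu⟩ := exists_isSubmersionChart U.isSubmersion_t u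
  let b : U.carrier → Euc m := fun y => (mfderiv (𝓡 m) (𝓡 m) κ (U.t y) (ξ (U.t y)) : Euc m)
  -- Coordinates of a lift of ξ through t: the base component is ξ read in κ, the fibre component is
  -- 0.
  let c : U.carrier → Euc U.dim := fun y => e.symm (b y, 0)
  have hb : ContMDiffOn (𝓡 U.dim) (𝓡 m) ∞ b φ.source :=
    (contMDiffOn_mfderiv_apply κ.open_source (contMDiffOn_of_mem_maximalAtlas hc.mem_right)
      ((𝓕.subset_compactFields hξ).1.mono (subset_univ _))).comp
      U.isSubmersion_t.contMDiff.contMDiffOn hc.mapsTo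
  have hcs : ContMDiffOn (𝓡 U.dim) (𝓡 U.dim) ∞ c φ.source := by
    have h1 : ContMDiff (𝓡 m) (𝓡 U.dim) ∞ (fun z : Euc m => e.symm (z, 0)) :=
      contMDiff_iff_contDiff.2 (by fun_prop)
    exact h1.comp_contMDiffOn hb
  have hZs := smoothFieldOn_chartField_comp hc.mem_left subset_rfl hcs
  obtain ⟨χ, hχ, hχO, hχ1⟩ := exists_bump (n := U.dim) (φ.open_source.mem_nhds hu)
  have hZ : (fun y => χ y • chartField φ (c y) y) ∈ 𝓕.pullback U.dim U.t := by
    refine ⟨smul_mem_compactFields hχ φ.open_source hχO hZs, ?_⟩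
    convert pullbackModule.single hχ hξ (p := U.t) using 2 with y
    rw [map_smul]
    by_cases hy : y ∈ φ.source
    · congr 1
      apply mfderiv_chart_injective hc.mem_right (hc.mapsTo y hy)
      refine (hc.mfderiv_fst U.mdifferentiable_t hy _).trans ?_
      rw [mfderiv_chartField hc.mem_left _ hy]
      simp [c, b]
    · rw [image_eq_zero_of_notMem_tsupport fun h => hy (hχO h), zero_smul, zero_smul]
  -- The cut-off lift lies in t⁻¹(𝓕) = s⁻¹(𝓕) = ker ds + ker dt. Its ker ds part has the same image
  -- under dt, because the other part is killed.
  have hZ' := hZ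
  rw [← h.pullback_eq, h.pullback_eq_add] at hZ'
  obtain ⟨X, hX, Y, hY, hXY⟩ := hZ'
  refine ⟨X, hX, ?_⟩
  filter_upwards [hχ1, φ.open_source.mem_nhds hu] with y hy hyφ
  have h1 : X y = chartField φ (c y) y - Y y := by
    have := hXY y
    simp only [hy, Pi.one_apply, one_smul] at this
    rw [this, add_sub_cancel_right]
  rw [h1, map_sub, hY.2, sub_zero]
  apply mfderiv_chart_injective hc.mem_right (hc.mapsTo y hyφ)
  refine (hc.mfderiv_fst U.mdifferentiable_t hyφ _).trans ?_
  rw [mfderiv_chartField hc.mem_left _ hyφ]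
  simp [c, b]

end BiSubmersionLocal

/-! ### Extension of sections to local morphisms -/

section LocalMorphisms

/-- Translates manifold derivatives into the derivatives in coordinates that
`exists_intertwining_map` requires. -/
theorem fderiv_comp_chart_symm {n : ℕ} {N : Type v} [TopologicalSpace N] [ChartedSpace (Euc n) N]
    [IsManifold (𝓡 n) ∞ N] {E : Type*} [NormedAddCommGroup E] [NormedSpace ℝ E] {g : N → E}
    {ψ : OpenPartialHomeomorph N (Euc n)} (hψ : ψ ∈ IsManifold.maximalAtlas (𝓡 n) ∞ N)
    {w : Euc n} (hw : w ∈ ψ.target) (hg : MDifferentiableAt (𝓡 n) 𝓘(ℝ, E) g (ψ.symm w))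
    (v : TangentSpace (𝓡 n) (ψ.symm w)) :
    fderiv ℝ (fun w => g (ψ.symm w)) w (mfderiv (𝓡 n) (𝓡 n) ψ (ψ.symm w) v : Euc n) =
      (mfderiv (𝓡 n) 𝓘(ℝ, E) g (ψ.symm w) v : E) := by
  have hd := mdifferentiable_of_mem_maximalAtlas hψ
  have h1 : mfderiv (𝓡 n) 𝓘(ℝ, E) (fun w => g (ψ.symm w)) w = _ :=
    mfderiv_comp w hg (hd.mdifferentiableAt_symm hw)
  rw [mfderiv_eq_fderiv] at h1
  rw [h1]
  have h2 := hd.symm_comp_deriv (ψ.map_target hw)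
  rw [ψ.right_inv hw] at h2
  have h3 := congrArg (fun A : TangentSpace (𝓡 n) (ψ.symm w) →L[ℝ] TangentSpace (𝓡 n) (ψ.symm w) =>
    A v) h2
  exact congrArg (mfderiv (𝓡 n) 𝓘(ℝ, E) g (ψ.symm w)) h3

variable {m : ℕ} {M : Type u} [TopologicalSpace M] [ChartedSpace (Euc m) M]
  [IsManifold (𝓡 m) ∞ M] {𝓕 : Foliation m M}

theorem mfderiv_comp_chart_apply {n : ℕ} {N : Type v} [TopologicalSpace N]
    [ChartedSpace (Euc n) N] [IsManifold (𝓡 n) ∞ N] {p : N → M}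
    (hp : MDifferentiable (𝓡 n) (𝓡 m) p) {κ : OpenPartialHomeomorph M (Euc m)}
    (hκ : κ ∈ IsManifold.maximalAtlas (𝓡 m) ∞ M) {y : N} (hy : p y ∈ κ.source) :
    MDifferentiableAt (𝓡 n) (𝓡 m) (fun y => κ (p y)) y ∧ ∀ v : TangentSpace (𝓡 n) y,
      (mfderiv (𝓡 n) (𝓡 m) (fun y => κ (p y)) y v : Euc m) =
        (mfderiv (𝓡 m) (𝓡 m) κ (p y) (mfderiv (𝓡 n) (𝓡 m) p y v) : Euc m) := by
  have h1 := (mdifferentiable_of_mem_maximalAtlas hκ).mdifferentiableAt hy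
  refine ⟨h1.comp y (hp y), fun v => ?_⟩
  have h2 : mfderiv (𝓡 n) (𝓡 m) (fun y => κ (p y)) y = _ := mfderiv_comp y h1 (hp y)
  rw [h2]
  rfl

/-- A section of `s_U` through `u` and a section of `s_V` through `v` on which the target maps agree
are related by a local morphism from `U` to `V`. -/
theorem exists_localMorphism_of_sections {U : SubmersionPair.{u, v} m M}
    {V : SubmersionPair.{u, w} m M} [T2Space M] (hU : IsBiSubmersion 𝓕 U) (hV : IsBiSubmersion 𝓕 V)
    {x : M} {σ : M → U.carrier} {τ : M → V.carrier} {D : Set M} (hD : IsOpen D) (hx : x ∈ D)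
    (hσ : ContMDiffOn (𝓡 m) (𝓡 U.dim) ∞ σ D) (hτ : ContMDiffOn (𝓡 m) (𝓡 V.dim) ∞ τ D)
    (hsσ : ∀ y ∈ D, U.s (σ y) = y) (hsτ : ∀ y ∈ D, V.s (τ y) = y)
    (htt : ∀ y ∈ D, V.t (τ y) = U.t (σ y)) :
    ∃ (U' : Set U.carrier) (f : U.carrier → V.carrier),
      IsLocalMorphism U V U' f ∧ σ x ∈ U' ∧ f (σ x) = τ x := by
  obtain ⟨F, _, _, _, φ, κ, e, hc, hu⟩ := exists_isSubmersionChart U.isSubmersion_s (σ x)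
  set u := σ x with hu_def
  set v := τ x with hv_def
  have hsu : U.s u = x := hsσ x hx
  let ψ := chartAt (Euc V.dim) v
  have hψ : ψ ∈ IsManifold.maximalAtlas (𝓡 V.dim) ∞ V.carrier :=
    IsManifold.chart_mem_maximalAtlas v
  let μ := chartAt (Euc m) (U.t u)
  have hμ : μ ∈ IsManifold.maximalAtlas (𝓡 m) ∞ M := IsManifold.chart_mem_maximalAtlas (U.t u)
  have hφ := hc.mem_left
  have hκ := hc.mem_right
  -- vertical fields on `U`
  let b := Module.finBasis ℝ F
  let ℓ : Fin (Module.finrank ℝ F) → F →L[ℝ] ℝ := fun i => (b.coord i).toContinuousLinearMap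
  obtain ⟨χ, hχ, hχO, hχ1⟩ := exists_bump (n := U.dim) (φ.open_source.mem_nhds hu)
  let E : Fin (Module.finrank ℝ F) → VecField U.dim U.carrier :=
    fun i y => χ y • chartField φ (e.symm (0, b i)) y
  have hE : ∀ i, E i ∈ kernelFields m U.dim U.s :=
    fun i => hc.smul_chartField_mem U.mdifferentiable_s hχ hχO (b i)
  choose k f ξ hfξ hEt using fun i => hU.mfderiv_t_mem (hE i)
  -- their images lift to `V`
  choose X hX hXt using fun i j => hV.exists_lift (hfξ i j).2 v
  -- neighbourhoods
  have htuv : V.t v = U.t u := htt x hx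
  have hsv : V.s v = x := hsτ x hx
  obtain ⟨Ou, hOu_sub, hOu, huOu⟩ : ∃ Ou : Set U.carrier,
      (∀ y ∈ Ou, y ∈ φ.source ∧ χ y = 1 ∧ U.t y ∈ μ.source) ∧ IsOpen Ou ∧ u ∈ Ou := by
    refine mem_nhds_iff.1 ((φ.open_source.eventually_mem hu).and (hχ1.and ?_))
    exact U.isSubmersion_t.contMDiff.continuous.continuousAt.eventually
      (μ.open_source.eventually_mem (mem_chart_source _ _))
  obtain ⟨Ov, hOv_sub, hOv, hvOv⟩ : ∃ Ov : Set V.carrier,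
      (∀ y ∈ Ov, y ∈ ψ.source ∧ V.s y ∈ κ.source ∧ V.t y ∈ μ.source ∧
        ∀ i j, mfderiv (𝓡 V.dim) (𝓡 m) V.t y (X i j y) = ξ i j (V.t y)) ∧ IsOpen Ov ∧ v ∈ Ov := by
    refine mem_nhds_iff.1 ((ψ.open_source.eventually_mem (mem_chart_source _ _)).and
      (Filter.Eventually.and ?_ (Filter.Eventually.and ?_ ?_)))
    · refine V.isSubmersion_s.contMDiff.continuous.continuousAt.eventually
        (κ.open_source.eventually_mem ?_)
      rw [hsv, ← hsu]
      exact hc.mapsTo u hu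
    · refine V.isSubmersion_t.contMDiff.continuous.continuousAt.eventually
        (μ.open_source.eventually_mem ?_)
      rw [htuv]
      exact mem_chart_source _ _
    · exact Filter.eventually_all.2 fun i => Filter.eventually_all.2 fun j => hXt i j
  obtain ⟨D', hD'_sub, hD', hxD'⟩ : ∃ D' : Set M,
      (∀ y ∈ D', y ∈ κ.source ∧ y ∈ D ∧ σ y ∈ Ou ∧ τ y ∈ Ov) ∧ IsOpen D' ∧ x ∈ D' := by
    refine mem_nhds_iff.1 (Filter.Eventually.and (κ.open_source.eventually_mem ?_)
      ((hD.eventually_mem hx).and (Filter.Eventually.and ?_ ?_)))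
    · rw [← hsu]; exact hc.mapsTo u hu
    · exact (hσ.contMDiffAt (hD.mem_nhds hx)).continuousAt.eventually (hOu.eventually_mem huOu)
    · exact (hτ.contMDiffAt (hD.mem_nhds hx)).continuousAt.eventually (hOv.eventually_mem hvOv)
  -- The neighbourhoods in U, V and M, read in the charts.
  let O₁ : Set (Euc m × F) := e.symm ⁻¹' (φ.target ∩ φ.symm ⁻¹' Ou)
  let O₂ : Set (Euc V.dim) := ψ.target ∩ ψ.symm ⁻¹' Ov
  let O₃ : Set (Euc m) := κ.target ∩ κ.symm ⁻¹' D'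
  have hO₁ : IsOpen O₁ := (φ.symm.isOpen_inter_preimage hOu).preimage e.symm.continuous
  have hO₂ : IsOpen O₂ := ψ.symm.isOpen_inter_preimage hOv
  have hO₃ : IsOpen O₃ := κ.symm.isOpen_inter_preimage hD'
  let z₀ : Euc m × F := e (φ u)
  have hz₀ : z₀ ∈ O₁ := by
    simp only [O₁, z₀, mem_preimage, mem_inter_iff, ContinuousLinearEquiv.symm_apply_apply,
      φ.left_inv hu]
    exact ⟨φ.map_source hu, huOu⟩
  have hvs : v ∈ ψ.source := mem_chart_source _ _
  have hw₀ : ψ v ∈ O₂ := by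
    refine ⟨ψ.map_source hvs, ?_⟩
    rw [mem_preimage, ψ.left_inv hvs]
    exact hvOv
  have hκx : κ x = z₀.1 := by
    rw [← hsu]; exact hc.eq_fst u hu
  have hxκ : x ∈ κ.source := (hD'_sub x hxD').1
  have hx₀ : z₀.1 ∈ O₃ := by
    rw [← hκx]
    refine ⟨κ.map_source hxκ, ?_⟩
    rw [mem_preimage, κ.left_inv hxκ]
    exact hxD'
  have hGs : ContMDiffOn 𝓘(ℝ, Euc m × F) (𝓡 U.dim) ∞ (fun z => φ.symm (e.symm z)) O₁ := by
    have h1 : ContMDiff 𝓘(ℝ, Euc m × F) (𝓡 U.dim) ∞ (fun z : Euc m × F => e.symm z) :=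
      contMDiff_iff_contDiff.2 (by fun_prop)
    exact (contMDiffOn_symm_of_mem_maximalAtlas hφ).comp h1.contMDiffOn fun z hz => hz.1
  have hψs : ContMDiffOn (𝓡 V.dim) (𝓡 V.dim) ∞ ψ.symm O₂ :=
    (contMDiffOn_symm_of_mem_maximalAtlas hψ).mono inter_subset_left
  have hκs : ContMDiffOn (𝓡 m) (𝓡 m) ∞ κ.symm O₃ :=
    (contMDiffOn_symm_of_mem_maximalAtlas hκ).mono inter_subset_left
  obtain ⟨N, g, hN, hz₀N, hg, hg₀, hgN⟩ := exists_intertwining_map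
    -- The pair (i, j) stands for the j-th field in the expansion of dt(E i). Its coefficient is the
    -- i-th coordinate of the fibre vector times f i j.
    (ι := Σ i, Fin (k i))
    (TU := fun z => μ (U.t (φ.symm (e.symm z)))) (A := fun i z => f i.1 i.2 (φ.symm (e.symm z)))
    (ℓ := fun i => ℓ i.1)
    (Ξ := fun i z => (mfderiv (𝓡 m) (𝓡 m) μ (μ.symm z) (ξ i.1 i.2 (μ.symm z)) : Euc m))
    (SV := fun w => κ (V.s (ψ.symm w))) (TV := fun w => μ (V.t (ψ.symm w)))
    (H := fun i w => (mfderiv (𝓡 V.dim) (𝓡 V.dim) ψ (ψ.symm w) (X i.1 i.2 (ψ.symm w)) :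
      Euc V.dim))
    (σ := fun z => (e (φ (σ (κ.symm z)))).2) (τ := fun z => ψ (τ (κ.symm z)))
    (z₀ := z₀) (w₀ := ψ v) hO₁ hz₀ hO₂ hw₀ hO₃ hx₀
    (by
      rw [← contMDiffOn_iff_contDiffOn]
      exact (contMDiffOn_of_mem_maximalAtlas hμ).comp
        (U.isSubmersion_t.contMDiff.comp_contMDiffOn hGs) fun z hz => (hOu_sub _ hz.2).2.2)
    (by
      intro i
      rw [← contMDiffOn_iff_contDiffOn]
      exact (hfξ i.1 i.2).1.1.comp_contMDiffOn hGs)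
    (by
      intro i
      have h1 : ContMDiffOn (𝓡 m) (𝓡 m) ∞
          (fun z => (mfderiv (𝓡 m) (𝓡 m) μ (μ.symm z) (ξ i.1 i.2 (μ.symm z)) : Euc m))
          μ.target :=
        (contMDiffOn_mfderiv_apply μ.open_source (contMDiffOn_of_mem_maximalAtlas hμ)
          ((𝓕.subset_compactFields (hfξ i.1 i.2).2).1.mono (subset_univ _))).comp
          (contMDiffOn_symm_of_mem_maximalAtlas hμ) fun z hz => μ.map_target hz
      refine ContDiffOn.contDiffAt (E := Euc m) (F := Euc m)
        (contMDiffOn_iff_contDiffOn.1 h1) (μ.open_target.mem_nhds ?_)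
      simp only [z₀, ContinuousLinearEquiv.symm_apply_apply, φ.left_inv hu]
      exact μ.map_source (mem_chart_source _ _))
    (by
      rw [← contMDiffOn_iff_contDiffOn]
      exact (contMDiffOn_of_mem_maximalAtlas hκ).comp
        (V.isSubmersion_s.contMDiff.comp_contMDiffOn hψs) fun z hz => (hOv_sub _ hz.2).2.1)
    (by
      rw [← contMDiffOn_iff_contDiffOn]
      exact (contMDiffOn_of_mem_maximalAtlas hμ).comp
        (V.isSubmersion_t.contMDiff.comp_contMDiffOn hψs) fun z hz => (hOv_sub _ hz.2).2.2.1)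
    (by
      intro i
      refine contMDiffOn_iff_contDiffOn (E := Euc V.dim) (E' := Euc V.dim) |>.1 ?_
      exact (contMDiffOn_mfderiv_apply ψ.open_source (contMDiffOn_of_mem_maximalAtlas hψ)
        ((hX i.1 i.2).1.1.mono (subset_univ _))).comp hψs fun z hz => ψ.map_target hz.1)
    (by
      have h1 : ContMDiffOn (𝓡 m) (𝓡 U.dim) ∞ (fun z => φ (σ (κ.symm z))) O₃ :=
        (contMDiffOn_of_mem_maximalAtlas hφ).comp (hσ.comp hκs fun z hz => (hD'_sub _ hz.2).2.1)
          fun z hz => (hOu_sub _ (hD'_sub _ hz.2).2.2.1).1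
      rw [contMDiffOn_iff_contDiffOn] at h1
      exact contDiff_snd.comp_contDiffOn (e.contDiff.comp_contDiffOn h1))
    (by
      rw [← contMDiffOn_iff_contDiffOn]
      exact (contMDiffOn_of_mem_maximalAtlas hψ).comp
        (hτ.comp hκs fun z hz => (hD'_sub _ hz.2).2.1)
        fun z hz => (hOv_sub _ (hD'_sub _ hz.2).2.2.2).1)
    (by simp only [← hκx, κ.left_inv hxκ]; rfl)
    (by simp only [← hκx, κ.left_inv hxκ]; rfl)
    (by
      intro z hz η
      obtain ⟨hyφ, hyχ, hyμ⟩ := hOu_sub _ hz.2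
      set y := φ.symm (e.symm z) with hy
      obtain ⟨hd, hd'⟩ := mfderiv_comp_chart_apply U.mdifferentiable_t hμ hyμ
      have h1 := fderiv_comp_chart_symm hφ hz.1 (g := fun y => μ (U.t y)) hd
        (chartField φ (e.symm (0, η)) y)
      rw [mfderiv_chartField hφ _ hyφ, hd'] at h1
      have h2 : fderiv ℝ (fun z => μ (U.t (φ.symm (e.symm z)))) z =
          (fderiv ℝ (fun w => μ (U.t (φ.symm w))) (e.symm z)).comp
            (e.symm : Euc m × F →L[ℝ] Euc U.dim) :=
        e.symm.comp_right_fderiv (f := fun w => μ (U.t (φ.symm w))) (x := z)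
      rw [h2]
      refine h1.trans ?_
      -- On `Ou` the cut-off χ equals 1, so the `E i` are the coordinate fields themselves.
      have h3 : chartField φ (e.symm (0, η)) y = ∑ i, ℓ i η • E i y := by
        refine (chartField_eq_sum b η y).trans (Finset.sum_congr rfl fun i _ => ?_)
        simp only [E, hyχ, one_smul]
        rfl
      rw [h3]
      have h5 : ∀ i, mfderiv (𝓡 U.dim) (𝓡 m) U.t y (E i y) = ∑ j, f i j y • ξ i j (U.t y) :=
        fun i => hEt i y
      -- The points `μ.symm (μ (U.t y))` and `U.t y` are equal, but their tangent spaces are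
      -- different types; generalizing the point avoids a cast.
      have h6 : ∀ i j z', z' = U.t y →
          (mfderiv (𝓡 m) (𝓡 m) μ z' (ξ i j z') : Euc m) =
            (mfderiv (𝓡 m) (𝓡 m) μ (U.t y) (ξ i j (U.t y)) : Euc m) := by
        rintro i j _ rfl
        rfl
      simp only [map_sum, map_smul, h5, Fintype.sum_sigma, Finset.smul_sum]
      refine Finset.sum_congr rfl fun i _ => Finset.sum_congr rfl fun j _ => ?_
      refine (smul_smul (α := Euc m) (ℓ i η) (f i j y) _).trans ?_
      exact congrArg (fun a : Euc m => (ℓ i η * f i j y) • a) (h6 i j _ (μ.left_inv hyμ)).symm)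
    (by
      intro z hz i
      obtain ⟨hyψ, hyκ, hyμ, hyX⟩ := hOv_sub _ hz.2
      obtain ⟨hd, hd'⟩ := mfderiv_comp_chart_apply V.mdifferentiable_s hκ hyκ
      refine (fderiv_comp_chart_symm hψ hz.1 (g := fun y => κ (V.s y)) hd _).trans ?_
      rw [hd', (hX i.1 i.2).2, map_zero]
      rfl)
    (by
      intro z hz i
      obtain ⟨hyψ, hyκ, hyμ, hyX⟩ := hOv_sub _ hz.2
      obtain ⟨hd, hd'⟩ := mfderiv_comp_chart_apply V.mdifferentiable_t hμ hyμ
      refine (fderiv_comp_chart_symm hψ hz.1 (g := fun y => μ (V.t y)) hd _).trans ?_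
      rw [hd', hyX, μ.left_inv hyμ])
    (by
      intro z hz
      obtain ⟨hy, hyD, hyU, hyV⟩ := hD'_sub _ hz.2
      rw [ψ.left_inv (hOv_sub _ hyV).1, hsτ _ hyD, κ.right_inv hz.1])
    (by
      intro z hz
      obtain ⟨hy, hyD, hyU, hyV⟩ := hD'_sub _ hz.2
      rw [ψ.left_inv (hOv_sub _ hyV).1, htt _ hyD]
      -- The base coordinate of σ at `κ.symm z` is z because σ is a section of s_U.
      have h1 : (z, (e (φ (σ (κ.symm z)))).2) = e (φ (σ (κ.symm z))) := by
        ext1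
        · rw [← hc.eq_fst _ (hOu_sub _ hyU).1, hsσ _ hyD, κ.right_inv hz.1]
        · rfl
      rw [h1, e.symm_apply_apply, φ.left_inv (hOu_sub _ hyU).1])
  -- the local morphism
  have hT : IsOpen (N ∩ g ⁻¹' O₂) := hg.continuousOn.isOpen_inter_preimage hN hO₂
  have heφ : ContMDiffOn (𝓡 U.dim) 𝓘(ℝ, Euc m × F) ∞ (fun y => e (φ y)) φ.source := by
    have h1 : ContMDiff (𝓡 U.dim) 𝓘(ℝ, Euc m × F) ∞ (fun z : Euc U.dim => e z) :=
      contMDiff_iff_contDiff.2 (by fun_prop)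
    exact h1.comp_contMDiffOn (contMDiffOn_of_mem_maximalAtlas hφ)
  have hu' : Ou ⊆ φ.source := fun y hy => (hOu_sub y hy).1
  refine ⟨Ou ∩ (fun y => e (φ y)) ⁻¹' (N ∩ g ⁻¹' O₂), fun y => ψ.symm (g (e (φ y))),
    ⟨(heφ.mono hu').continuousOn.isOpen_inter_preimage hOu hT, ?_, ?_, ?_⟩, ⟨huOu, hz₀N, ?_⟩, ?_⟩
  · refine (contMDiffOn_symm_of_mem_maximalAtlas hψ).comp (t := ψ.target) ?_
      fun y hy => hy.2.2.1
    exact (contMDiffOn_iff_contDiffOn.2 hg).comp (heφ.mono fun y hy => hu' hy.1)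
      fun y hy => hy.2.1
  · intro y hy
    have hyφ := hu' hy.1
    apply κ.injOn (hOv_sub _ hy.2.2.2).2.1 (hc.mapsTo y hyφ)
    rw [hc.eq_fst y hyφ]
    exact (hgN _ hy.2.1).1
  · intro y hy
    obtain ⟨hyφ, -, hyμ⟩ := hOu_sub y hy.1
    apply μ.injOn (hOv_sub _ hy.2.2.2).2.2.1 hyμ
    have := (hgN _ hy.2.1).2
    simpa [φ.left_inv hyφ] using this
  · change g z₀ ∈ O₂
    rw [hg₀]; exact hw₀
  · change ψ.symm (g z₀) = v
    rw [hg₀, ψ.left_inv hvs]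

end LocalMorphisms

/-! ### Fields which are locally in the pull-back of a foliation -/

section PullbackAt

variable {m n : ℕ} {M : Type u} [TopologicalSpace M] [ChartedSpace (Euc m) M]
  [IsManifold (𝓡 m) ∞ M] {N : Type w} [TopologicalSpace N]
  [ChartedSpace (Euc n) N] [IsManifold (𝓡 n) ∞ N]

/-- Near the point `y`, the field `dp(Z)` coincides with an element of `p^*(𝓕)`. -/
def Foliation.PullbackAt (𝓕 : Foliation m M) (p : N → M) (Z : VecField n N) (y : N) : Prop :=
  ∃ Y ∈ 𝓕.pullbackModule n p, ∀ᶠ z in 𝓝 y, mfderiv (𝓡 n) (𝓡 m) p z (Z z) = Y z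

/-- For compactly supported smooth fields the pull-back condition can thus be checked near each
point, where lifts exist. -/
theorem mem_pullback_iff_pullbackAt [T2Space N] [SecondCountableTopology N] {𝓕 : Foliation m M}
    {p : N → M} {Z : VecField n N} :
    Z ∈ 𝓕.pullback n p ↔ Z ∈ compactFields n N ∧ ∀ y, 𝓕.PullbackAt p Z y := by
  refine ⟨fun h => ⟨h.1, fun y => ⟨_, h.2, Filter.Eventually.of_forall fun z => rfl⟩⟩, fun h =>
    ⟨h.1, mem_pullbackModule_of_locally (n := n) h.1.2 (fun y hy => ?_) fun y _ => h.2 y⟩⟩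
  have h1 : Z y = 0 := by
    by_contra h2
    exact hy (subset_closure h2)
  rw [h1, map_zero]

theorem pullback.add {𝓕 : Foliation m M} {p : N → M} {X Y : VecField n N}
    (hX : X ∈ 𝓕.pullback n p) (hY : Y ∈ 𝓕.pullback n p) :
    (fun y => X y + Y y) ∈ 𝓕.pullback n p := by
  refine ⟨compactFields.add hX.1 hY.1, ?_⟩
  simp only [map_add]
  exact pullbackModule.add hX.2 hY.2

theorem kernelFields_subset_pullback {𝓕 : Foliation m M} {p : N → M} :
    kernelFields m n p ⊆ 𝓕.pullback n p := by
  intro X hX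
  refine ⟨hX.1, ?_⟩
  simp only [hX.2]
  exact pullbackModule.zero

variable {𝓕 : Foliation m M} {U : SubmersionPair.{u, v} m M}

/-- Write dg(Z) = R + Σ fⱼ Xⱼ with Xⱼ in ker ds lifting the fields that express d(t ∘ g)(Z). Then R
lies in ker dt, so ds(R) is a combination of fields of 𝓕, and ds kills the Xⱼ. -/
theorem IsBiSubmersion.pullbackAt_comp [T2Space N] (hU : IsBiSubmersion 𝓕 U)
    {g : N → U.carrier} (hg : ContMDiff (𝓡 n) (𝓡 U.dim) ∞ g) {Z : VecField n N}
    (hZ : SmoothFieldOn Z univ) {y : N} (h : 𝓕.PullbackAt (fun z => U.t (g z)) Z y) :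
    𝓕.PullbackAt (fun z => U.s (g z)) Z y := by
  obtain ⟨Y, ⟨k, f, ξ, hfξ, hY⟩, hYZ⟩ := h
  obtain ⟨F, _, _, _, φ, κ, e, hc, hu⟩ := exists_isSubmersionChart U.isSubmersion_t (g y)
  choose X hX hXt using fun j => hU.exists_lift (hfξ j).2 (g y)
  have hgd : MDifferentiable (𝓡 n) (𝓡 U.dim) g := hg.mdifferentiable (by simp)
  let b := Module.finBasis ℝ F
  obtain ⟨χ, hχ, hχO, hχ1⟩ := exists_bump (n := U.dim) (φ.open_source.mem_nhds hu)
  let E : Fin (Module.finrank ℝ F) → VecField U.dim U.carrier :=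
    fun i y => χ y • chartField φ (e.symm (0, b i)) y
  have hE : ∀ i, E i ∈ kernelFields m U.dim U.t :=
    fun i => hc.smul_chartField_mem U.mdifferentiable_t hχ hχO (b i)
  choose l a ζ haζ hEs using fun i => hU.inverse.mfderiv_t_mem (hE i)
  let R : ∀ z : N, TangentSpace (𝓡 U.dim) (g z) := fun z =>
    mfderiv (𝓡 n) (𝓡 U.dim) g z (Z z) - ∑ j, f j z • X j (g z)
  -- The fibre coordinate of R, whose components in the basis b are the coefficients of R along the
  -- vertical fields `E i`.
  let r : N → F := fun z => (e (mfderiv (𝓡 U.dim) (𝓡 U.dim) φ (g z) (R z) : Euc U.dim)).2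
  have hO : IsOpen (g ⁻¹' φ.source) := φ.open_source.preimage hg.continuous
  have hr : ContMDiffOn (𝓡 n) 𝓘(ℝ, F) ∞ r (g ⁻¹' φ.source) := by
    have h1 : ContMDiffOn (𝓡 n) (𝓡 U.dim) ∞ (fun z => φ (g z)) (g ⁻¹' φ.source) :=
      (contMDiffOn_of_mem_maximalAtlas hc.mem_left).comp hg.contMDiffOn fun z hz => hz
    have h2 := contMDiffOn_mfderiv_apply hO h1 (hZ.mono (subset_univ _))
    have h3 : ∀ j, ContMDiffOn (𝓡 n) (𝓡 U.dim) ∞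
        (fun z => (mfderiv (𝓡 U.dim) (𝓡 U.dim) φ (g z) (X j (g z)) : Euc U.dim))
        (g ⁻¹' φ.source) := fun j =>
      (contMDiffOn_mfderiv_apply φ.open_source (contMDiffOn_of_mem_maximalAtlas hc.mem_left)
        ((hX j).1.1.mono (subset_univ _))).comp hg.contMDiffOn fun z hz => hz
    have h4 : ContMDiffOn (𝓡 n) 𝓘(ℝ, Euc U.dim) ∞ (fun z =>
        ∑ j, f j z • (mfderiv (𝓡 U.dim) (𝓡 U.dim) φ (g z) (X j (g z)) : Euc U.dim))
        (g ⁻¹' φ.source) :=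
      contMDiffOn_finsetSum fun j _ => (hfξ j).1.1.contMDiffOn.smul (h3 j)
    have h5 : ContMDiff (𝓡 U.dim) 𝓘(ℝ, F) ∞ (fun z : Euc U.dim => (e z).2) :=
      contMDiff_iff_contDiff.2 (by fun_prop)
    refine (h5.comp_contMDiffOn (h2.sub h4)).congr fun z hz => ?_
    have h6 : mfderiv (𝓡 n) (𝓡 U.dim) (fun z => φ (g z)) z = _ := mfderiv_comp z
      ((mdifferentiable_of_mem_maximalAtlas hc.mem_left).mdifferentiableAt hz) (hgd z)
    refine congrArg (fun a : Euc U.dim => (e a).2) ?_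
    simp only [R, map_sub, map_sum, map_smul]
    rw [h6]
    rfl
  have hRt : ∀ᶠ z in 𝓝 y, mfderiv (𝓡 U.dim) (𝓡 m) U.t (g z) (R z) = 0 := by
    have h1 : ∀ᶠ z in 𝓝 y, ∀ j,
        mfderiv (𝓡 U.dim) (𝓡 m) U.t (g z) (X j (g z)) = ξ j (U.t (g z)) :=
      hg.continuous.continuousAt.eventually (Filter.eventually_all.2 hXt)
    filter_upwards [h1, hYZ] with z hz hz'
    have h2 : mfderiv (𝓡 n) (𝓡 m) (fun z => U.t (g z)) z = _ :=
      mfderiv_comp z (U.mdifferentiable_t (g z)) (hgd z)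
    rw [h2, hY] at hz'
    simp only [R, map_sub, map_sum, map_smul, hz]
    exact sub_eq_zero.2 hz'
  refine exists_pullbackModule_eventuallyEq (ι := Σ i, Fin (l i))
    (f := fun i z => b.repr (r z) i.1 * a i.1 i.2 (g z)) (ξ := fun i => ζ i.1 i.2) hO hu ?_
    (fun i => (haζ i.1 i.2).2) ?_
  · intro i
    have h1 : ContMDiff 𝓘(ℝ, F) 𝓘(ℝ, ℝ) ∞ (fun z : F => b.repr z i.1) :=
      contMDiff_iff_contDiff.2 ((b.coord i.1).toContinuousLinearMap.contDiff)
    exact (h1.comp_contMDiffOn hr).mul ((haζ i.1 i.2).1.1.comp hg).contMDiffOn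
  · filter_upwards [hRt, hO.mem_nhds hu, hg.continuous.continuousAt.eventually hχ1] with z hz hzφ hzχ
    have h2 : mfderiv (𝓡 n) (𝓡 m) (fun z => U.s (g z)) z = _ :=
      mfderiv_comp z (U.mdifferentiable_s (g z)) (hgd z)
    have h3 : R z = ∑ i, b.repr (r z) i • E i (g z) := by
      refine (hc.eq_chartField U.mdifferentiable_t hzφ hz).trans
        ((chartField_eq_sum b _ _).trans (Finset.sum_congr rfl fun i _ => ?_))
      simp only [E, hzχ, Pi.one_apply, one_smul]
      rfl
    have h4 : mfderiv (𝓡 n) (𝓡 U.dim) g z (Z z) = R z + ∑ j, f j z • X j (g z) :=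
      (sub_add_cancel _ _).symm
    have h5 : ∀ i, mfderiv (𝓡 U.dim) (𝓡 m) U.s (g z) (E i (g z)) =
      ∑ j, a i j (g z) • ζ i j (U.s (g z)) := fun i => hEs i (g z)
    have h6 : mfderiv (𝓡 U.dim) (𝓡 m) U.s (g z) (mfderiv (𝓡 n) (𝓡 U.dim) g z (Z z)) =
        ∑ i : Σ i, Fin (l i), (b.repr (r z) i.1 * a i.1 i.2 (g z)) • ζ i.1 i.2 (U.s (g z)) := by
      rw [h4, map_add, h3]
      simp only [map_sum, map_smul, (hX _).2, smul_zero, Finset.sum_const_zero, add_zero, h5,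
        Fintype.sum_sigma, Finset.smul_sum, smul_smul]
    rw [h2]
    exact h6

end PullbackAt

/-! ### The composition of bi-submersions -/

section Composition

variable {m : ℕ} {M : Type u} [TopologicalSpace M] [ChartedSpace (Euc m) M]
  {U : SubmersionPair.{u, v} m M} {V : SubmersionPair.{u, w} m M}

theorem SubmersionPair.contMDiff_comp_val (U : SubmersionPair.{u, v} m M)
    (V : SubmersionPair.{u, w} m M) :
    ContMDiff (𝓡 (U.comp V).dim) ((𝓡 U.dim).prod (𝓡 V.dim)) ∞
      (fun x : (U.comp V).carrier => (x.1 : U.carrier × V.carrier)) := by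
  intro x
  let c := chartAt (Euc (U.comp V).dim) x
  have hx : x ∈ c.source := mem_chart_source _ x
  have hc : IsSubmanifoldChart ((𝓡 U.dim).prod (𝓡 V.dim)) (W := U.compSet V) c :=
    chart_mem_atlas (Euc (U.comp V).dim) x
  have h1 := (hc.1.contMDiffAt (c.open_target.mem_nhds (c.map_source hx))).comp x
    (contMDiffAt_of_mem_maximalAtlas (I := 𝓡 (U.comp V).dim)
      (IsManifold.chart_mem_maximalAtlas x) hx)
  refine h1.congr_of_eventuallyEq ?_
  filter_upwards [c.open_source.mem_nhds hx] with y hy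
  simp only [Function.comp_apply]
  exact congrArg Subtype.val (c.left_inv hy).symm

theorem SubmersionPair.contMDiff_comp_fst (U : SubmersionPair.{u, v} m M)
    (V : SubmersionPair.{u, w} m M) :
    ContMDiff (𝓡 (U.comp V).dim) (𝓡 U.dim) ∞ (fun x : (U.comp V).carrier => x.1.1) :=
  contMDiff_fst.comp (U.contMDiff_comp_val V)

theorem SubmersionPair.contMDiff_comp_snd (U : SubmersionPair.{u, v} m M)
    (V : SubmersionPair.{u, w} m M) :
    ContMDiff (𝓡 (U.comp V).dim) (𝓡 V.dim) ∞ (fun x : (U.comp V).carrier => x.1.2) :=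
  contMDiff_snd.comp (U.contMDiff_comp_val V)

/-- A map to the composition is smooth if both of its components are smooth. -/
theorem SubmersionPair.contMDiffAt_comp_mk {n : ℕ} {N : Type*} [TopologicalSpace N]
    [ChartedSpace (Euc n) N] {h : N → (U.comp V).carrier} {y : N}
    (h₁ : ContMDiffAt (𝓡 n) (𝓡 U.dim) ∞ (fun z => (h z).1.1) y)
    (h₂ : ContMDiffAt (𝓡 n) (𝓡 V.dim) ∞ (fun z => (h z).1.2) y) :
    ContMDiffAt (𝓡 n) (𝓡 (U.comp V).dim) ∞ h y := by
  have hv : ContMDiffAt (𝓡 n) ((𝓡 U.dim).prod (𝓡 V.dim)) ∞ (fun z => (h z).1) y :=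
    h₁.prodMk h₂
  have hcont : ContinuousAt h y := Topology.IsInducing.subtypeVal.continuousAt_iff.2 hv.continuousAt
  let c := chartAt (Euc (U.comp V).dim) (h y)
  have hx : h y ∈ c.source := mem_chart_source _ _
  have hc : IsSubmanifoldChart ((𝓡 U.dim).prod (𝓡 V.dim)) (W := U.compSet V) c :=
    chart_mem_atlas (Euc (U.comp V).dim) (h y)
  -- The chart c is locally the restriction of the ambient map g, so smoothness into U × V suffices.
  obtain ⟨O, g, hO, hyO, hg, hgc⟩ := hc.2 (h y) hx
  have h3 : ContMDiffAt (𝓡 n) (𝓡 (U.comp V).dim) ∞ (fun z => g (h z).1) y :=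
    ContMDiffAt.comp (I' := (𝓡 U.dim).prod (𝓡 V.dim)) y (hg.contMDiffAt (hO.mem_nhds hyO)) hv
  have h4 : (fun z => g (h z).1) =ᶠ[𝓝 y] fun z => c (h z) := by
    filter_upwards [hcont.eventually (c.open_source.eventually_mem hx),
      hv.continuousAt.eventually (hO.eventually_mem hyO)] with z hz hzO
    exact (hgc _ hz hzO).symm
  have h5 : ContMDiffAt (𝓡 n) (𝓡 (U.comp V).dim) ∞ (fun z => c (h z)) y :=
    h3.congr_of_eventuallyEq h4.symm
  have h6 : ContMDiffAt (𝓡 (U.comp V).dim) (𝓡 (U.comp V).dim) ∞ c.symm (c (h y)) :=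
    contMDiffOn_chart_symm.contMDiffAt (c.open_target.mem_nhds (c.map_source hx))
  refine (ContMDiffAt.comp y h6 h5).congr_of_eventuallyEq ?_
  filter_upwards [hcont.eventually (c.open_source.eventually_mem hx)] with z hz
  exact (c.left_inv hz).symm

variable [IsManifold (𝓡 m) ∞ M] {𝓕 : Foliation m M}

/-- A vector field in `ker ds_U` lifts locally to the composition, with vanishing image in `V`. -/
theorem SubmersionPair.exists_lift_comp_fst {A : VecField U.dim U.carrier}
    (hA : A ∈ kernelFields m U.dim U.s) (w : (U.comp V).carrier) :
    ∃ X ∈ compactFields (U.comp V).dim (U.comp V).carrier,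
      (∀ z, mfderiv (𝓡 (U.comp V).dim) (𝓡 V.dim) (fun x : (U.comp V).carrier => x.1.2) z (X z) =
        0) ∧
      ∀ᶠ z in 𝓝 w,
        mfderiv (𝓡 (U.comp V).dim) (𝓡 U.dim) (fun x : (U.comp V).carrier => x.1.1) z (X z) =
          A z.1.1 := by
  let π₁ : (U.comp V).carrier → U.carrier := fun x => x.1.1
  let π₂ : (U.comp V).carrier → V.carrier := fun x => x.1.2
  have hπ₁ : ContMDiff (𝓡 (U.comp V).dim) (𝓡 U.dim) ∞ π₁ := U.contMDiff_comp_fst V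
  have hπ₂ : ContMDiff (𝓡 (U.comp V).dim) (𝓡 V.dim) ∞ π₂ := U.contMDiff_comp_snd V
  have hd₁ : MDifferentiable (𝓡 (U.comp V).dim) (𝓡 U.dim) π₁ := hπ₁.mdifferentiable (by simp)
  have hd₂ : MDifferentiable (𝓡 (U.comp V).dim) (𝓡 V.dim) π₂ := hπ₂.mdifferentiable (by simp)
  obtain ⟨F, _, _, hs⟩ : ∃ (F : Type) (_ : NormedAddCommGroup F) (_ : NormedSpace ℝ F),
      IsSubmersionAtOfComplement F (𝓡 U.dim) (𝓡 m) ∞ U.s w.1.1 :=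
    ⟨_, _, _, U.isSubmersion_s.isSubmersionOfComplement_complement w.1.1⟩
  have hφ : IsSubmersionChart U.s hs.domChart hs.codChart hs.equiv := isSubmersionChart_of_isSubmersionAtOfComplement hs
  let ψ := chartAt (Euc V.dim) w.1.2
  have hψ : ψ ∈ IsManifold.maximalAtlas (𝓡 V.dim) ∞ V.carrier :=
    IsManifold.chart_mem_maximalAtlas _
  set φ := hs.domChart with hφ_def
  set e := hs.equiv with he_def
  have hF : FiniteDimensional ℝ (Euc m × F) := e.toLinearEquiv.finiteDimensional
  have hF' : FiniteDimensional ℝ F :=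
    Module.Finite.of_surjective (LinearMap.snd ℝ (Euc m) F) LinearMap.snd_surjective
  -- Since dim U = m + dim F, the natural-number subtraction in the dimension of the composition is
  -- not truncated.
  let L : (Euc V.dim × F) ≃L[ℝ] Euc (U.comp V).dim := ContinuousLinearEquiv.ofFinrankEq (by
    have h1 : U.dim = m + Module.finrank ℝ F := by
      have := e.toLinearEquiv.finrank_eq
      simpa [Module.finrank_prod] using this
    have h2 : (U.comp V).dim = U.dim + V.dim - m := rfl
    rw [Module.finrank_prod]
    simp only [finrank_euclideanSpace, Fintype.card_fin]
    omega)
  obtain ⟨c, hc, hwc, hcv⟩ := exists_fibreChart w hs V.isSubmersion_t.contMDiff hψ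
    (mem_chart_source _ _) L
  set c : OpenPartialHomeomorph (U.comp V).carrier (Euc (U.comp V).dim) := c with hc_def
  have hcm : c ∈ IsManifold.maximalAtlas (𝓡 (U.comp V).dim) ∞ (U.comp V).carrier :=
    IsManifold.subset_maximalAtlas (show c ∈ atlas _ _ from hc)
  have hcd := mdifferentiable_of_mem_maximalAtlas hcm
  have hcL : ∀ y ∈ c.source, L.symm (c y) = (ψ (π₂ y), (e (φ (π₁ y))).2) :=
    fun y hy => L.symm_apply_eq.2 (hcv y hy).2
  let O : Set (U.comp V).carrier := c.source ∩ π₁ ⁻¹' φ.source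
  have hO : IsOpen O := c.open_source.inter (φ.open_source.preimage hπ₁.continuous)
  have hwO : w ∈ O := ⟨hwc, hs.mem_domChart_source⟩
  let a : (U.comp V).carrier → F :=
    fun z => (e (mfderiv (𝓡 U.dim) (𝓡 U.dim) φ (π₁ z) (A (π₁ z)) : Euc U.dim)).2
  -- The V-coordinate is at rest, and the s_U-fibre coordinate moves as under A.
  let b : (U.comp V).carrier → Euc (U.comp V).dim := fun z => L (0, a z)
  have hb : ContMDiffOn (𝓡 (U.comp V).dim) (𝓡 (U.comp V).dim) ∞ b O := by
    have h1 : ContMDiffOn (𝓡 (U.comp V).dim) (𝓡 U.dim) ∞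
        (fun z => (mfderiv (𝓡 U.dim) (𝓡 U.dim) φ (π₁ z) (A (π₁ z)) : Euc U.dim)) O :=
      (contMDiffOn_mfderiv_apply φ.open_source (contMDiffOn_of_mem_maximalAtlas hφ.mem_left)
        (hA.1.1.mono (subset_univ _))).comp hπ₁.contMDiffOn fun z hz => hz.2
    have h2 : ContMDiff (𝓡 U.dim) (𝓡 (U.comp V).dim) ∞
        (fun z : Euc U.dim => L ((0 : Euc V.dim), (e z).2)) :=
      contMDiff_iff_contDiff.2 (by fun_prop)
    exact h2.comp_contMDiffOn h1
  obtain ⟨χ, hχ, hχO, hχ1⟩ := exists_bump (n := (U.comp V).dim) (hO.mem_nhds hwO)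
  have hX : (fun z => χ z • chartField c (b z) z) ∈
      compactFields (U.comp V).dim (U.comp V).carrier :=
    smul_mem_compactFields hχ hO hχO
      (smoothFieldOn_chartField_comp hcm inter_subset_left hb)
  have hk₂ : ∀ z ∈ O, mfderiv (𝓡 (U.comp V).dim) (𝓡 V.dim) π₂ z (chartField c (b z) z) = 0 := by
    intro z hz
    have hzψ : π₂ z ∈ ψ.source := (hcv z hz.1).1
    apply mfderiv_chart_injective hψ hzψ
    rw [map_zero]
    have h1 : (fun z => ψ (π₂ z)) =ᶠ[𝓝 z] fun z => ((ContinuousLinearMap.fst ℝ (Euc V.dim) F).comp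
        (L.symm : Euc (U.comp V).dim →L[ℝ] Euc V.dim × F)) (c z) := by
      filter_upwards [c.open_source.mem_nhds hz.1] with y hy
      exact (congrArg Prod.fst (hcL y hy)).symm
    have h2 : mfderiv (𝓡 (U.comp V).dim) (𝓡 V.dim) (fun z => ψ (π₂ z)) z = _ := mfderiv_comp z
      ((mdifferentiable_of_mem_maximalAtlas hψ).mdifferentiableAt hzψ) (hd₂ z)
    have h3 := mfderiv_clm_comp ((ContinuousLinearMap.fst ℝ (Euc V.dim) F).comp
      (L.symm : Euc (U.comp V).dim →L[ℝ] Euc V.dim × F)) (hcd.mdifferentiableAt hz.1)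
      (chartField c (b z) z)
    rw [← h1.mfderiv_eq, h2, mfderiv_chartField hcm _ hz.1] at h3
    refine h3.trans ?_
    simp only [b, ContinuousLinearMap.comp_apply, ContinuousLinearEquiv.coe_coe,
      ContinuousLinearEquiv.symm_apply_apply]
    rfl
  refine ⟨_, hX, fun z => ?_, ?_⟩
  · by_cases hz : z ∈ O
    · rw [map_smul]
      refine (congrArg (fun a => χ z • a) (hk₂ z hz)).trans (smul_zero _)
    · rw [image_eq_zero_of_notMem_tsupport fun h => hz (hχO h), zero_smul, map_zero]
  · filter_upwards [hO.mem_nhds hwO, hχ1] with z hz hzχ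
    simp only [hzχ, Pi.one_apply, one_smul]
    have hzφ : π₁ z ∈ φ.source := hz.2
    -- The fibre product relation forces the U-component into ker ds_U, since the V-component is
    -- zero. A vector of ker ds_U is determined by its fibre coordinate, which is that of A.
    have hst : (fun z => U.s (π₁ z)) = fun z => V.t (π₂ z) := funext fun z => z.2
    have h1 : mfderiv (𝓡 U.dim) (𝓡 m) U.s (π₁ z)
        (mfderiv (𝓡 (U.comp V).dim) (𝓡 U.dim) π₁ z (chartField c (b z) z)) = 0 := by
      have h2 : mfderiv (𝓡 (U.comp V).dim) (𝓡 m) (fun z => U.s (π₁ z)) z = _ :=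
        mfderiv_comp z (U.mdifferentiable_s _) (hd₁ z)
      have h3 : mfderiv (𝓡 (U.comp V).dim) (𝓡 m) (fun z => V.t (π₂ z)) z = _ :=
        mfderiv_comp z (V.mdifferentiable_t _) (hd₂ z)
      have h4 : (mfderiv (𝓡 (U.comp V).dim) (𝓡 m) (fun z => V.t (π₂ z)) z
          (chartField c (b z) z) : Euc m) = 0 := by
        rw [h3]
        exact (congrArg (mfderiv (𝓡 V.dim) (𝓡 m) V.t (π₂ z)) (hk₂ z hz)).trans (map_zero _)
      have h5 : (mfderiv (𝓡 (U.comp V).dim) (𝓡 m) (fun z => U.s (π₁ z)) z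
          (chartField c (b z) z) : Euc m) = 0 := by
        rw [hst]; exact h4
      rw [h2] at h5
      exact h5
    have h2 : (e (mfderiv (𝓡 U.dim) (𝓡 U.dim) φ (π₁ z)
        (mfderiv (𝓡 (U.comp V).dim) (𝓡 U.dim) π₁ z (chartField c (b z) z)) : Euc U.dim)).2 =
        a z := by
      have h1 : (fun z => ((ContinuousLinearMap.snd ℝ (Euc m) F).comp
          (e : Euc U.dim →L[ℝ] Euc m × F)) (φ (π₁ z))) =ᶠ[𝓝 z]
          fun z => ((ContinuousLinearMap.snd ℝ (Euc V.dim) F).comp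
            (L.symm : Euc (U.comp V).dim →L[ℝ] Euc V.dim × F)) (c z) := by
        filter_upwards [c.open_source.mem_nhds hz.1] with y hy
        exact (congrArg Prod.snd (hcL y hy)).symm
      have hφd := (mdifferentiable_of_mem_maximalAtlas hφ.mem_left).mdifferentiableAt hzφ
      have h2 : mfderiv (𝓡 (U.comp V).dim) (𝓡 U.dim) (fun z => φ (π₁ z)) z = _ :=
        mfderiv_comp z hφd (hd₁ z)
      have h3 := mfderiv_clm_comp ((ContinuousLinearMap.snd ℝ (Euc V.dim) F).comp
        (L.symm : Euc (U.comp V).dim →L[ℝ] Euc V.dim × F)) (hcd.mdifferentiableAt hz.1)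
        (chartField c (b z) z)
      have h4 := mfderiv_clm_comp ((ContinuousLinearMap.snd ℝ (Euc m) F).comp
          (e : Euc U.dim →L[ℝ] Euc m × F)) (g := fun z => φ (π₁ z))
          (MDifferentiableAt.comp z hφd (hd₁ z)) (chartField c (b z) z)
      rw [mfderiv_chartField hcm _ hz.1] at h3
      rw [h2] at h4
      refine (h4.symm.trans ((congrArg (fun T : TangentSpace (𝓡 (U.comp V).dim) z →L[ℝ] F =>
        T (chartField c (b z) z)) h1.mfderiv_eq).trans h3)).trans ?_
      simp only [b, ContinuousLinearMap.comp_apply, ContinuousLinearEquiv.coe_coe,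
        ContinuousLinearEquiv.symm_apply_apply]
      rfl
    refine (hφ.eq_chartField U.mdifferentiable_s hzφ h1).trans (Eq.trans ?_
      (hφ.eq_chartField U.mdifferentiable_s hzφ (hA.2 _)).symm)
    rw [h2]

/-- Moving only the U-factor, along a lift of ξ in ker ds_U, changes t = t_U ∘ pr₁ as prescribed and
leaves s = s_V ∘ pr₂ fixed. -/
theorem IsBiSubmersion.exists_lift_comp (hU : IsBiSubmersion 𝓕 U) {ξ : VecField m M}
    (hξ : ξ ∈ 𝓕.fields) (w : (U.comp V).carrier) :
    ∃ X ∈ kernelFields m (U.comp V).dim (U.comp V).s, ∀ᶠ z in 𝓝 w,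
      mfderiv (𝓡 (U.comp V).dim) (𝓡 m) (U.comp V).t z (X z) = ξ ((U.comp V).t z) := by
  obtain ⟨A, hA, hAt⟩ := hU.exists_lift hξ w.1.1
  obtain ⟨X, hX, hX₂, hX₁⟩ := SubmersionPair.exists_lift_comp_fst (V := V) hA w
  have hπ₁ := U.contMDiff_comp_fst V
  have hπ₂ := U.contMDiff_comp_snd V
  refine ⟨X, ⟨hX, fun z => ?_⟩, ?_⟩
  · have h1 : mfderiv (𝓡 (U.comp V).dim) (𝓡 m) (U.comp V).s z = _ :=
      mfderiv_comp z (g := V.s) (f := fun z : (U.comp V).carrier => z.1.2)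
        (V.mdifferentiable_s _) (hπ₂.mdifferentiable (by simp) z)
    rw [h1]
    exact (congrArg (mfderiv (𝓡 V.dim) (𝓡 m) V.s z.1.2) (hX₂ z)).trans (map_zero _)
  · filter_upwards [hX₁, hπ₁.continuous.continuousAt.eventually hAt] with z hz hz'
    have h1 : mfderiv (𝓡 (U.comp V).dim) (𝓡 m) (U.comp V).t z = _ :=
      mfderiv_comp z (g := U.t) (f := fun z : (U.comp V).carrier => z.1.1)
        (U.mdifferentiable_t _) (hπ₁.mdifferentiable (by simp) z)
    rw [h1]
    exact (congrArg (mfderiv (𝓡 U.dim) (𝓡 m) U.t z.1.1) hz).trans hz'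

/-- The composition of two bi-submersions is a bi-submersion. -/
theorem IsBiSubmersion.comp (hU : IsBiSubmersion 𝓕 U) (hV : IsBiSubmersion 𝓕 V) :
    IsBiSubmersion 𝓕 (U.comp V) := by
  have hπ₁ := U.contMDiff_comp_fst V
  have hπ₂ := U.contMDiff_comp_snd V
  have hst : (fun z : (U.comp V).carrier => U.s z.1.1) = fun z => V.t z.1.2 :=
    funext fun z => z.2
  have heq : 𝓕.pullback (U.comp V).dim (U.comp V).s = 𝓕.pullback (U.comp V).dim (U.comp V).t := by
    ext Z
    rw [mem_pullback_iff_pullbackAt, mem_pullback_iff_pullbackAt]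
    refine and_congr_right fun hZ => forall_congr' fun y => ⟨fun h => ?_, fun h => ?_⟩
    -- The condition passes from s_V ∘ pr₂ to t_V ∘ pr₂ = s_U ∘ pr₁, and from there to t_U ∘ pr₁.
    · have h1 : 𝓕.PullbackAt (fun z : (U.comp V).carrier => V.t z.1.2) Z y :=
        hV.inverse.pullbackAt_comp hπ₂ hZ.1 h
      rw [← hst] at h1
      exact hU.inverse.pullbackAt_comp hπ₁ hZ.1 h1
    · have h1 : 𝓕.PullbackAt (fun z : (U.comp V).carrier => U.s z.1.1) Z y :=
        hU.pullbackAt_comp hπ₁ hZ.1 h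
      rw [hst] at h1
      exact hV.pullbackAt_comp hπ₂ hZ.1 h1
  refine ⟨heq, subset_antisymm (fun Z hZ => ?_) ?_⟩
  · have hZt := hZ
    rw [heq] at hZt
    obtain ⟨hZc, k, f, ξ, hfξ, hfZ⟩ := hZt
    -- Locally, a field in ker ds with the same image as Z under dt. Glued by the partition of unity
    -- it gives the ker ds part of Z, and the rest lies in ker dt.
    have hloc : ∀ w : (U.comp V).carrier, ∃ X ∈ kernelFields m (U.comp V).dim (U.comp V).s,
        ∀ᶠ z in 𝓝 w, mfderiv (𝓡 (U.comp V).dim) (𝓡 m) (U.comp V).t z (X z) =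
          mfderiv (𝓡 (U.comp V).dim) (𝓡 m) (U.comp V).t z (Z z) := by
      intro w
      choose A hA hAt using fun j => hU.exists_lift_comp (V := V) (hfξ j).2 w
      refine ⟨fun z => ∑ j, f j z • A j z,
        ⟨compactFields.sum _ fun j _ => compactFields.smul (hfξ j).1.1 (hA j).1, fun z => ?_⟩, ?_⟩
      · simp only [map_sum, map_smul, (hA _).2, smul_zero, Finset.sum_const_zero]
      · filter_upwards [Filter.eventually_all.2 hAt] with z hz
        refine Eq.trans ?_ (hfZ z).symm
        simp only [map_sum, map_smul, hz]
    choose X hX hXZ using hloc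
    obtain ⟨s, ρ, -, hρ, hρO, hρ1⟩ := exists_finite_partition (n := (U.comp V).dim) hZc.2
      (fun w _ => hXZ w)
    have hsum : (fun z => ∑ i : s, ρ i z • X i z) ∈
        kernelFields m (U.comp V).dim (U.comp V).s := by
      refine ⟨compactFields.sum _ fun i _ => compactFields.smul (hρ i) (hX i).1, fun z => ?_⟩
      simp only [map_sum, map_smul, (hX _).2, smul_zero, Finset.sum_const_zero]
    refine ⟨_, hsum, fun z => Z z - ∑ i : s, ρ i z • X i z,
      ⟨compactFields.sub hZc hsum.1, fun z => ?_⟩, fun z => ?_⟩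
    · have h1 : ∀ i : s, ρ i z • mfderiv (𝓡 (U.comp V).dim) (𝓡 m) (U.comp V).t z (X i z) =
          ρ i z • mfderiv (𝓡 (U.comp V).dim) (𝓡 m) (U.comp V).t z (Z z) := by
        intro i
        by_cases hi : ρ i z = 0
        · rw [hi, zero_smul, zero_smul]
        · exact congrArg (fun a => ρ i z • a) (hρO i z hi)
      simp only [map_sub, map_sum, map_smul, h1, ← Finset.sum_smul]
      by_cases hz : z ∈ fieldSupport Z
      · rw [hρ1 z hz, one_smul, sub_self]
      · have h2 : Z z = 0 := by
          by_contra h3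
          exact hz (subset_closure h3)
        rw [h2, map_zero, smul_zero, sub_zero]
    · exact (add_sub_cancel (G := Euc (U.comp V).dim) _ _).symm
  · rintro Z ⟨X, hX, Y, hY, hZ⟩
    have h1 : Z = fun z => X z + Y z := funext hZ
    rw [h1]
    refine pullback.add (kernelFields_subset_pullback hX) ?_
    rw [heq]
    exact kernelFields_subset_pullback hY

end Composition

/-! ### Local diffeomorphisms carried by the points of a bi-submersion -/

section Carries

variable {m : ℕ} {M : Type u} [TopologicalSpace M] [ChartedSpace (Euc m) M]

/-- There is a local section of `s` through `u` whose composition with `t` is `φ`. -/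
def Carries (U : SubmersionPair.{u, v} m M) (u : U.carrier) (φ : M → M) : Prop :=
  ∃ (D : Set M) (σ : M → U.carrier), IsOpen D ∧ U.s u ∈ D ∧ ContMDiffOn (𝓡 m) (𝓡 U.dim) ∞ σ D ∧
    σ (U.s u) = u ∧ ∀ y ∈ D, U.s (σ y) = y ∧ U.t (σ y) = φ y

variable {U : SubmersionPair.{u, v} m M} {V : SubmersionPair.{u, w} m M}

/-- Composing the section with f preserves its source and target values. -/
theorem Carries.of_isLocalMorphism {U' : Set U.carrier} {f : U.carrier → V.carrier}
    (hf : IsLocalMorphism U V U' f) {u : U.carrier} (hu : u ∈ U') {φ : M → M}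
    (h : Carries U u φ) : Carries V (f u) φ := by
  obtain ⟨D, σ, hD, huD, hσ, hσu, hst⟩ := h
  refine ⟨D ∩ σ ⁻¹' U', fun y => f (σ y), hσ.continuousOn.isOpen_inter_preimage hD hf.isOpen, ?_,
    hf.contMDiffOn.comp (hσ.mono inter_subset_left) fun y hy => hy.2, ?_, fun y hy => ⟨?_, ?_⟩⟩
  · rw [hf.s_comp u hu]
    exact ⟨huD, by rwa [mem_preimage, hσu]⟩
  · change f (σ (V.s (f u))) = f u
    rw [hf.s_comp u hu, hσu]
  · rw [hf.s_comp _ hy.2, (hst y hy.1).1]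
  · rw [hf.t_comp _ hy.2, (hst y hy.1).2]

/-- The extension principle in terms of carried maps. The sources must be compared separately,
because φ is a map on all of M and does not record a base point. -/
theorem Carries.exists_isLocalMorphism [IsManifold (𝓡 m) ∞ M] [T2Space M] {𝓕 : Foliation m M}
    (hU : IsBiSubmersion 𝓕 U) (hV : IsBiSubmersion 𝓕 V) {u : U.carrier} {v : V.carrier}
    {φ : M → M} (hu : Carries U u φ) (hv : Carries V v φ) (huv : U.s u = V.s v) :
    ∃ (U' : Set U.carrier) (f : U.carrier → V.carrier),
      IsLocalMorphism U V U' f ∧ u ∈ U' ∧ f u = v := by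
  obtain ⟨D, σ, hD, huD, hσ, hσu, hst⟩ := hu
  obtain ⟨D', τ, hD', hvD, hτ, hτv, hst'⟩ := hv
  obtain ⟨U', f, hf, h1, h2⟩ := exists_localMorphism_of_sections hU hV (hD.inter hD')
    (show U.s u ∈ D ∩ D' from ⟨huD, huv ▸ hvD⟩) (hσ.mono inter_subset_left)
    (hτ.mono inter_subset_right) (fun y hy => (hst y hy.1).1) (fun y hy => (hst' y hy.2).1)
    fun y hy => (hst' y hy.2).2.trans (hst y hy.1).2.symm
  rw [hσu] at h1 h2
  rw [huv, hτv] at h2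
  exact ⟨U', f, hf, h1, h2⟩

/-- A section of the source map of a composition, given by its two components. -/
theorem carries_comp_of_sections {x : (U.comp V).carrier} {D : Set M} (hD : IsOpen D)
    (hx : (U.comp V).s x ∈ D) {σ : M → U.carrier} {τ : M → V.carrier} {φ : M → M}
    (hσ : ContMDiffOn (𝓡 m) (𝓡 U.dim) ∞ σ D) (hτ : ContMDiffOn (𝓡 m) (𝓡 V.dim) ∞ τ D)
    (hστ : ∀ y ∈ D, U.s (σ y) = V.t (τ y)) (hσx : σ ((U.comp V).s x) = x.1.1)
    (hτx : τ ((U.comp V).s x) = x.1.2)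
    (hst : ∀ y ∈ D, V.s (τ y) = y ∧ U.t (σ y) = φ y) : Carries (U.comp V) x φ := by
  classical
  -- The value x is a filler where the components do not match; this never happens on D.
  let h : M → (U.comp V).carrier := fun y =>
    if hy : U.s (σ y) = V.t (τ y) then ⟨(σ y, τ y), hy⟩ else x
  have hh : ∀ y ∈ D, (h y).1 = (σ y, τ y) := fun y hy =>
    congrArg Subtype.val (dif_pos (hστ y hy))
  refine ⟨D, h, hD, hx, fun y hy => ContMDiffAt.contMDiffWithinAt ?_, ?_, fun y hy => ⟨?_, ?_⟩⟩
  · refine SubmersionPair.contMDiffAt_comp_mk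
      ((hσ.contMDiffAt (hD.mem_nhds hy)).congr_of_eventuallyEq ?_)
      ((hτ.contMDiffAt (hD.mem_nhds hy)).congr_of_eventuallyEq ?_)
    · filter_upwards [hD.mem_nhds hy] with z hz
      rw [hh z hz]
    · filter_upwards [hD.mem_nhds hy] with z hz
      rw [hh z hz]
  · apply Subtype.ext
    rw [hh _ hx, hσx, hτx]
  · change V.s (h y).1.2 = y
    rw [hh y hy, (hst y hy).1]
  · change U.t (h y).1.1 = φ y
    rw [hh y hy, (hst y hy).2]

variable [IsManifold (𝓡 m) ∞ M]

/-- In a submersion chart, keep the fibre coordinate equal to that of u. -/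
theorem exists_smooth_section {n : ℕ} {N : Type v} [TopologicalSpace N] [ChartedSpace (Euc n) N]
    [IsManifold (𝓡 n) ∞ N] {p : N → M} (hp : IsSubmersion (𝓡 n) (𝓡 m) ∞ p) (u : N) :
    ∃ (D : Set M) (σ : M → N), IsOpen D ∧ p u ∈ D ∧ ContMDiffOn (𝓡 m) (𝓡 n) ∞ σ D ∧
      σ (p u) = u ∧ ∀ y ∈ D, p (σ y) = y := by
  obtain ⟨F, _, _, _, φ, κ, e, hc, hu⟩ := exists_isSubmersionChart hp u
  let a : M → Euc n := fun y => e.symm (κ y, (e (φ u)).2)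
  have ha : ContMDiffOn (𝓡 m) (𝓡 n) ∞ a κ.source := by
    have h1 : ContMDiff (𝓡 m) (𝓡 n) ∞ (fun z : Euc m => e.symm (z, (e (φ u)).2)) :=
      contMDiff_iff_contDiff.2 (by fun_prop)
    exact h1.comp_contMDiffOn (contMDiffOn_of_mem_maximalAtlas hc.mem_right)
  have hau : a (p u) = φ u := by
    simp only [a, hc.eq_fst u hu, Prod.mk.eta, e.symm_apply_apply]
  refine ⟨κ.source ∩ a ⁻¹' φ.target, fun y => φ.symm (a y),
    ha.continuousOn.isOpen_inter_preimage κ.open_source φ.open_target,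
    ⟨hc.mapsTo u hu, by rw [mem_preimage, hau]; exact φ.map_source hu⟩,
    (contMDiffOn_symm_of_mem_maximalAtlas hc.mem_left).comp (ha.mono inter_subset_left)
      fun y hy => hy.2, by simp only [hau, φ.left_inv hu], fun y hy => ?_⟩
  have h1 := φ.map_target hy.2
  apply κ.injOn (hc.mapsTo _ h1) hy.1
  rw [hc.eq_fst _ h1, φ.right_inv hy.2]
  simp only [a, e.apply_symm_apply]

theorem exists_carries (U : SubmersionPair.{u, v} m M) (u : U.carrier) : ∃ φ, Carries U u φ := by
  obtain ⟨D, σ, hD, hu, hσ, hσu, hs⟩ := exists_smooth_section U.isSubmersion_s u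
  exact ⟨fun y => U.t (σ y), D, σ, hD, hu, hσ, hσu, fun y hy => ⟨hs y hy, rfl⟩⟩

/-- The section is y ↦ (σ (t_V (τ y)), τ y). -/
theorem Carries.comp {x : (U.comp V).carrier} {φ φ' : M → M} (h : Carries U x.1.1 φ)
    (h' : Carries V x.1.2 φ') : Carries (U.comp V) x (φ ∘ φ') := by
  obtain ⟨D, σ, hD, huD, hσ, hσu, hst⟩ := h
  obtain ⟨D', τ, hD', hvD, hτ, hτv, hst'⟩ := h'
  have htτ : ContMDiffOn (𝓡 m) (𝓡 m) ∞ (fun y => V.t (τ y)) D' :=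
    V.isSubmersion_t.contMDiff.comp_contMDiffOn hτ
  have hx : V.t (τ (V.s x.1.2)) = U.s x.1.1 := by rw [hτv]; exact x.2.symm
  refine carries_comp_of_sections (D := D' ∩ (fun y => V.t (τ y)) ⁻¹' D)
    (σ := fun y => σ (V.t (τ y))) (τ := τ) (htτ.continuousOn.isOpen_inter_preimage hD' hD)
    ⟨hvD, show V.t (τ (V.s x.1.2)) ∈ D by rwa [hx]⟩
    (hσ.comp (htτ.mono inter_subset_left) fun y hy => hy.2) (hτ.mono inter_subset_left)
    (fun y hy => (hst _ hy.2).1) ?_ hτv fun y hy => ⟨(hst' y hy.1).1, ?_⟩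
  · change σ (V.t (τ (V.s x.1.2))) = x.1.1
    rw [hx, hσu]
  · exact (hst _ hy.2).2.trans (congrArg φ (hst' y hy.1).2)

variable {U' : Set U.carrier} {f : U.carrier → V.carrier}

/-- For a section σ of s_U the pair (f ∘ σ, σ) is a section with target t_V ∘ f ∘ σ = s_U ∘ σ = id.
-/
theorem carries_inverse_comp (hf : IsLocalMorphism U.inverse V U' f) {u : U.carrier} (hu : u ∈ U')
    (h : V.s (f u) = U.t u) : Carries (V.comp U) ⟨(f u, u), h⟩ id := by
  obtain ⟨D, σ, hD, huD, hσ, hσu, hs⟩ := exists_smooth_section U.isSubmersion_s u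
  have hx : U.s u ∈ D ∩ σ ⁻¹' U' := ⟨huD, show σ (U.s u) ∈ U' by rwa [hσu]⟩
  exact carries_comp_of_sections (x := ⟨(f u, u), h⟩) (σ := fun y => f (σ y)) (τ := σ)
    (hσ.continuousOn.isOpen_inter_preimage hD hf.isOpen) hx
    (hf.contMDiffOn.comp (hσ.mono inter_subset_left) fun y hy => hy.2)
    (hσ.mono inter_subset_left) (fun y hy => hf.s_comp _ hy.2) (congrArg f hσu) hσu
    fun y hy => ⟨hs y hy.1, (hf.t_comp _ hy.2).trans (hs y hy.1)⟩

/-- Here σ must be a section of t_U: the pair (σ, f ∘ σ) has source s_V ∘ f ∘ σ = t_U ∘ σ = id and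
target t_U ∘ σ = id. -/
theorem carries_comp_inverse (hf : IsLocalMorphism U.inverse V U' f) {u : U.carrier} (hu : u ∈ U')
    (h : U.s u = V.t (f u)) : Carries (U.comp V) ⟨(u, f u), h⟩ id := by
  obtain ⟨D, σ, hD, huD, hσ, hσu, hs⟩ := exists_smooth_section U.isSubmersion_t u
  have h1 : V.s (f u) = U.t u := hf.s_comp u hu
  have h2 : (U.comp V).s ⟨(u, f u), h⟩ = U.t u := h1
  refine carries_comp_of_sections (D := D ∩ σ ⁻¹' U') (σ := σ) (τ := fun y => f (σ y))
    (hσ.continuousOn.isOpen_inter_preimage hD hf.isOpen)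
    ⟨?_, ?_⟩ (hσ.mono inter_subset_left)
    (hf.contMDiffOn.comp (hσ.mono inter_subset_left) fun y hy => hy.2)
    (fun y hy => (hf.t_comp _ hy.2).symm) ?_ ?_
    fun y hy => ⟨(hf.s_comp _ hy.2).trans (hs y hy.1), hs y hy.1⟩
  · rwa [h2]
  · rwa [h2, mem_preimage, hσu]
  · rw [h2, hσu]
  · rw [h2, hσu]

end Carries

/-! ### The groupoid of an atlas -/

section AtlasGroupoid

variable {m : ℕ} {M : Type u} [TopologicalSpace M] [ChartedSpace (Euc m) M] {ι : Type w}
  {𝓤 : ι → SubmersionPair.{u, v} m M}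

/-- The map `s : G → M`. -/
def AtlasQuotient.source (𝓤 : ι → SubmersionPair.{u, v} m M) : AtlasQuotient 𝓤 → M :=
  Quot.lift (fun x => (𝓤 x.1).s x.2) fun x y ⟨_, _, hf, hx, hxy⟩ => by
    rw [← hxy, hf.s_comp _ hx]

/-- The map `t : G → M`. -/
def AtlasQuotient.target (𝓤 : ι → SubmersionPair.{u, v} m M) : AtlasQuotient 𝓤 → M :=
  Quot.lift (fun x => (𝓤 x.1).t x.2) fun x y ⟨_, _, hf, hx, hxy⟩ => by
    rw [← hxy, hf.t_comp _ hx]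

/-- A representative of `g` carries the local diffeomorphism `φ`. -/
def AtlasQuotient.Carries (g : AtlasQuotient 𝓤) (φ : M → M) : Prop :=
  ∃ (i : ι) (u : (𝓤 i).carrier), atlasQuotientMap 𝓤 i u = g ∧ HolonomyGroupoid.Carries (𝓤 i) u φ

theorem AtlasQuotient.exists_rep (g : AtlasQuotient 𝓤) :
    ∃ (i : ι) (u : (𝓤 i).carrier), atlasQuotientMap 𝓤 i u = g :=
  Quot.ind (β := fun g => ∃ (i : ι) (u : (𝓤 i).carrier), atlasQuotientMap 𝓤 i u = g)
    (fun x => ⟨x.1, x.2, rfl⟩) g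

/-- The quotient map `q_U : U → G` of an adapted bi-submersion. -/
def adaptedMap {U : SubmersionPair.{u, v} m M} (hU : IsAdapted 𝓤 U) (u : U.carrier) :
    AtlasQuotient 𝓤 :=
  atlasQuotientMap 𝓤 (hU u).choose_spec.choose ((hU u).choose_spec.choose_spec.choose u)

theorem adaptedMap_spec {U : SubmersionPair.{u, v} m M} (hU : IsAdapted 𝓤 U) (u : U.carrier) :
    ∃ (U' : Set U.carrier) (i : ι) (f : U.carrier → (𝓤 i).carrier),
      u ∈ U' ∧ IsLocalMorphism U (𝓤 i) U' f ∧ adaptedMap hU u = atlasQuotientMap 𝓤 i (f u) := by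
  obtain ⟨h1, h2⟩ := (hU u).choose_spec.choose_spec.choose_spec
  exact ⟨_, _, _, h1, h2, rfl⟩

theorem adaptedMap_source {U : SubmersionPair.{u, v} m M} (hU : IsAdapted 𝓤 U) (u : U.carrier) :
    AtlasQuotient.source 𝓤 (adaptedMap hU u) = U.s u := by
  obtain ⟨U', i, f, hu, hf, h⟩ := adaptedMap_spec hU u
  rw [h]
  exact hf.s_comp u hu

theorem adaptedMap_target {U : SubmersionPair.{u, v} m M} (hU : IsAdapted 𝓤 U) (u : U.carrier) :
    AtlasQuotient.target 𝓤 (adaptedMap hU u) = U.t u := by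
  obtain ⟨U', i, f, hu, hf, h⟩ := adaptedMap_spec hU u
  rw [h]
  exact hf.t_comp u hu

theorem adaptedMap_carries {U : SubmersionPair.{u, v} m M} (hU : IsAdapted 𝓤 U) {u : U.carrier}
    {φ : M → M} (h : Carries U u φ) : (adaptedMap hU u).Carries φ := by
  obtain ⟨U', i, f, hu, hf, h'⟩ := adaptedMap_spec hU u
  exact ⟨i, f u, h'.symm, h.of_isLocalMorphism hf hu⟩

variable [IsManifold (𝓡 m) ∞ M]

theorem AtlasQuotient.exists_carries (g : AtlasQuotient 𝓤) : ∃ φ, g.Carries φ := by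
  obtain ⟨i, u, rfl⟩ := g.exists_rep
  obtain ⟨φ, hφ⟩ := HolonomyGroupoid.exists_carries (𝓤 i) u
  exact ⟨φ, i, u, rfl, hφ⟩

variable [T2Space M] {𝓕 : Foliation m M}

/-- The uniqueness principle for G, from which all identities in the groupoid are deduced. -/
theorem AtlasQuotient.Carries.eq (h𝓤 : IsAtlas 𝓕 𝓤) {g g' : AtlasQuotient 𝓤} {φ : M → M}
    (h : g.Carries φ) (h' : g'.Carries φ)
    (hs : AtlasQuotient.source 𝓤 g = AtlasQuotient.source 𝓤 g') : g = g' := by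
  obtain ⟨i, u, rfl, hu⟩ := h
  obtain ⟨j, v, rfl, hv⟩ := h'
  exact Quot.sound (hu.exists_isLocalMorphism (h𝓤.isBiSubmersion i) (h𝓤.isBiSubmersion j) hv hs)

/-- The chosen local morphism and f send u to points carrying the same map, so the choice in
`adaptedMap` is immaterial. -/
theorem adaptedMap_eq (h𝓤 : IsAtlas 𝓕 𝓤) {U : SubmersionPair.{u, v} m M} (hU : IsAdapted 𝓤 U)
    {i : ι} {U' : Set U.carrier} {f : U.carrier → (𝓤 i).carrier}
    (hf : IsLocalMorphism U (𝓤 i) U' f) {u : U.carrier} (hu : u ∈ U') :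
    adaptedMap hU u = atlasQuotientMap 𝓤 i (f u) := by
  obtain ⟨φ, hφ⟩ := exists_carries U u
  refine (adaptedMap_carries hU hφ).eq h𝓤 ⟨i, f u, rfl, hφ.of_isLocalMorphism hf hu⟩ ?_
  rw [adaptedMap_source]
  exact (hf.s_comp u hu).symm

theorem equivalence_atlasRel (h𝓤 : IsAtlas 𝓕 𝓤) : Equivalence (atlasRel 𝓤) where
  refl x := ⟨univ, id, ⟨isOpen_univ, contMDiffOn_id, fun _ _ => rfl, fun _ _ => rfl⟩, trivial, rfl⟩
  -- f need not be invertible. The image f(u) carries a map that u carries, so the extension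
  -- principle yields a morphism backwards.
  symm := by
    rintro x y ⟨U', f, hf, hx, hxy⟩
    obtain ⟨φ, hφ⟩ := exists_carries (𝓤 x.1) x.2
    have h1 := hφ.of_isLocalMorphism hf hx
    have h2 := hf.s_comp _ hx
    rw [hxy] at h1 h2
    exact h1.exists_isLocalMorphism (h𝓤.isBiSubmersion y.1) (h𝓤.isBiSubmersion x.1) hφ h2
  trans := by
    rintro x y z ⟨U', f, hf, hx, hxy⟩ ⟨V', g, hg, hy, hyz⟩
    refine ⟨U' ∩ f ⁻¹' V', fun u => g (f u),
      ⟨hf.contMDiffOn.continuousOn.isOpen_inter_preimage hf.isOpen hg.isOpen,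
        hg.contMDiffOn.comp (hf.contMDiffOn.mono inter_subset_left) fun u hu => hu.2,
        fun u hu => (hg.s_comp _ hu.2).trans (hf.s_comp _ hu.1),
        fun u hu => (hg.t_comp _ hu.2).trans (hf.t_comp _ hu.1)⟩, ⟨hx, ?_⟩, ?_⟩
    · rwa [mem_preimage, hxy]
    · exact (congrArg g hxy).trans hyz

/-- All the representatives of `g` carry the same local diffeomorphisms. -/
theorem AtlasQuotient.Carries.of_rep (h𝓤 : IsAtlas 𝓕 𝓤) {i : ι} {u : (𝓤 i).carrier} {φ : M → M}
    (h : (atlasQuotientMap 𝓤 i u).Carries φ) : HolonomyGroupoid.Carries (𝓤 i) u φ := by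
  obtain ⟨j, v, hvu, hv⟩ := h
  obtain ⟨U', f, hf, h1, h2⟩ :
      atlasRel 𝓤 ⟨j, v⟩ ⟨i, u⟩ := ((equivalence_atlasRel h𝓤).quot_mk_eq_iff _ _).1 hvu
  rw [← show f v = u from h2]
  exact hv.of_isLocalMorphism hf h1

/-- The last property, applied to any pair of carried maps, together with the source, determines k;
the representatives used to build it are therefore irrelevant. -/
theorem AtlasQuotient.exists_mul (h𝓤 : IsAtlas 𝓕 𝓤) (g h : AtlasQuotient 𝓤)
    (e : AtlasQuotient.source 𝓤 g = AtlasQuotient.target 𝓤 h) :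
    ∃ k : AtlasQuotient 𝓤, AtlasQuotient.source 𝓤 k = AtlasQuotient.source 𝓤 h ∧
      AtlasQuotient.target 𝓤 k = AtlasQuotient.target 𝓤 g ∧
      ∀ φ φ', g.Carries φ → h.Carries φ' → k.Carries (φ ∘ φ') := by
  obtain ⟨i, u, rfl⟩ := g.exists_rep
  obtain ⟨j, v, rfl⟩ := h.exists_rep
  refine ⟨adaptedMap (h𝓤.isAdapted_comp i j) ⟨(u, v), e⟩, adaptedMap_source _ _,
    adaptedMap_target _ _, fun φ φ' hφ hφ' => adaptedMap_carries _ ?_⟩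
  exact Carries.comp (hφ.of_rep h𝓤) (hφ'.of_rep h𝓤)

/-- The product of `G`. -/
def AtlasQuotient.mul (h𝓤 : IsAtlas 𝓕 𝓤) (g h : AtlasQuotient 𝓤)
    (e : AtlasQuotient.source 𝓤 g = AtlasQuotient.target 𝓤 h) : AtlasQuotient 𝓤 :=
  (exists_mul h𝓤 g h e).choose

theorem AtlasQuotient.mul_spec (h𝓤 : IsAtlas 𝓕 𝓤) (g h : AtlasQuotient 𝓤)
    (e : AtlasQuotient.source 𝓤 g = AtlasQuotient.target 𝓤 h) :
    AtlasQuotient.source 𝓤 (mul h𝓤 g h e) = AtlasQuotient.source 𝓤 h ∧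
      AtlasQuotient.target 𝓤 (mul h𝓤 g h e) = AtlasQuotient.target 𝓤 g ∧
      ∀ φ φ', g.Carries φ → h.Carries φ' → (mul h𝓤 g h e).Carries (φ ∘ φ') :=
  (exists_mul h𝓤 g h e).choose_spec

theorem AtlasQuotient.mul_mk (h𝓤 : IsAtlas 𝓕 𝓤) {i j : ι} {u : (𝓤 i).carrier}
    {v : (𝓤 j).carrier} (e : (𝓤 i).s u = (𝓤 j).t v) :
    mul h𝓤 (atlasQuotientMap 𝓤 i u) (atlasQuotientMap 𝓤 j v) e =
      adaptedMap (h𝓤.isAdapted_comp i j) ⟨(u, v), e⟩ := by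
  obtain ⟨φ, hφ⟩ := HolonomyGroupoid.exists_carries (𝓤 i) u
  obtain ⟨φ', hφ'⟩ := HolonomyGroupoid.exists_carries (𝓤 j) v
  obtain ⟨h1, -, h2⟩ := mul_spec h𝓤 (atlasQuotientMap 𝓤 i u) (atlasQuotientMap 𝓤 j v) e
  refine (h2 φ φ' ⟨i, u, rfl, hφ⟩ ⟨j, v, rfl, hφ'⟩).eq h𝓤
    (adaptedMap_carries _ (HolonomyGroupoid.Carries.comp hφ hφ')) ?_
  exact h1.trans (adaptedMap_source (h𝓤.isAdapted_comp i j) ⟨(u, v), e⟩).symm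

/-- The inverse is the class of f(u) for a local morphism f from the inverse of U_i. Both products
carry the identity, which identifies them with units. -/
theorem AtlasQuotient.exists_inv (h𝓤 : IsAtlas 𝓕 𝓤) (g : AtlasQuotient 𝓤) :
    ∃ (k : AtlasQuotient 𝓤) (hs : AtlasQuotient.source 𝓤 k = AtlasQuotient.target 𝓤 g)
      (ht : AtlasQuotient.target 𝓤 k = AtlasQuotient.source 𝓤 g),
      (mul h𝓤 k g hs).Carries id ∧ (mul h𝓤 g k ht.symm).Carries id := by
  obtain ⟨i, u, rfl⟩ := g.exists_rep
  obtain ⟨U', k, f, hu, hf⟩ := h𝓤.isAdapted_inverse i u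
  have hs : (𝓤 k).s (f u) = (𝓤 i).t u := hf.s_comp u hu
  have ht : (𝓤 k).t (f u) = (𝓤 i).s u := hf.t_comp u hu
  refine ⟨atlasQuotientMap 𝓤 k (f u), hs, ht, ?_, ?_⟩
  · exact mul_mk h𝓤 hs ▸ adaptedMap_carries _ (carries_inverse_comp hf hu hs)
  · exact mul_mk h𝓤 ht.symm ▸ adaptedMap_carries _ (carries_comp_inverse hf hu ht.symm)

/-- The sources cover M, so some g starts at x, and the unit at x is the product of an inverse of g
with g. -/
theorem AtlasQuotient.exists_one (h𝓤 : IsAtlas 𝓕 𝓤) (x : M) :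
    ∃ k : AtlasQuotient 𝓤, AtlasQuotient.source 𝓤 k = x ∧ AtlasQuotient.target 𝓤 k = x ∧
      k.Carries id := by
  obtain ⟨i, u, rfl⟩ := mem_iUnion.1 (h𝓤.iUnion_range_s ▸ mem_univ x)
  obtain ⟨k, hs, ht, h1, -⟩ := exists_inv h𝓤 (atlasQuotientMap 𝓤 i u)
  obtain ⟨h2, h3, -⟩ := mul_spec h𝓤 k (atlasQuotientMap 𝓤 i u) hs
  exact ⟨_, h2, h3.trans ht, h1⟩

/-- The groupoid of an atlas. -/
def atlasGroupoid (h𝓤 : IsAtlas 𝓕 𝓤) :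
    GroupoidStructure (AtlasQuotient.source 𝓤) (AtlasQuotient.target 𝓤) where
  mul := AtlasQuotient.mul h𝓤
  one x := (AtlasQuotient.exists_one h𝓤 x).choose
  inv g := (AtlasQuotient.exists_inv h𝓤 g).choose
  s_mul g h e := (AtlasQuotient.mul_spec h𝓤 g h e).1
  t_mul g h e := (AtlasQuotient.mul_spec h𝓤 g h e).2.1
  s_one x := (AtlasQuotient.exists_one h𝓤 x).choose_spec.1
  t_one x := (AtlasQuotient.exists_one h𝓤 x).choose_spec.2.1
  s_inv g := (AtlasQuotient.exists_inv h𝓤 g).choose_spec.choose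
  t_inv g := (AtlasQuotient.exists_inv h𝓤 g).choose_spec.choose_spec.choose
  mul_assoc g h k e e' := by
    obtain ⟨φ, hφ⟩ := g.exists_carries
    obtain ⟨φ', hφ'⟩ := h.exists_carries
    obtain ⟨φ'', hφ''⟩ := k.exists_carries
    obtain ⟨-, h₁, h₂⟩ := AtlasQuotient.mul_spec h𝓤 g h e
    obtain ⟨h₃, h₄, h₅⟩ := AtlasQuotient.mul_spec h𝓤 h k e'
    obtain ⟨h₆, -, h₇⟩ := AtlasQuotient.mul_spec h𝓤 (AtlasQuotient.mul h𝓤 g h e) k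
      ((AtlasQuotient.mul_spec h𝓤 g h e).1.trans e')
    obtain ⟨h₈, -, h₉⟩ := AtlasQuotient.mul_spec h𝓤 g (AtlasQuotient.mul h𝓤 h k e')
      (e.trans h₄.symm)
    -- Both bracketings carry φ ∘ φ' ∘ φ'', since composition of maps is associative by definition.
    -- The unit laws use id ∘ φ = φ = φ ∘ id in the same way.
    exact (h₇ (φ ∘ φ') φ'' (h₂ φ φ' hφ hφ') hφ'').eq h𝓤
      (h₉ φ (φ' ∘ φ'') hφ (h₅ φ' φ'' hφ' hφ''))
      (h₆.trans (h₈.trans h₃).symm)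
  one_mul g := by
    obtain ⟨φ, hφ⟩ := g.exists_carries
    obtain ⟨h₁, -, h₂⟩ := AtlasQuotient.mul_spec h𝓤 _ g
      (AtlasQuotient.exists_one h𝓤 (AtlasQuotient.target 𝓤 g)).choose_spec.1
    exact (h₂ _ _ (AtlasQuotient.exists_one h𝓤 _).choose_spec.2.2 hφ).eq h𝓤 hφ h₁
  mul_one g := by
    obtain ⟨φ, hφ⟩ := g.exists_carries
    obtain ⟨h₀, h₀', h₀''⟩ :=
      (AtlasQuotient.exists_one h𝓤 (AtlasQuotient.source 𝓤 g)).choose_spec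
    obtain ⟨h₁, -, h₂⟩ := AtlasQuotient.mul_spec h𝓤 g _ h₀'.symm
    exact (h₂ _ _ hφ h₀'').eq h𝓤 hφ (h₁.trans h₀)
  inv_mul g := by
    obtain ⟨h₀, h₀', h₀''⟩ :=
      (AtlasQuotient.exists_one h𝓤 (AtlasQuotient.source 𝓤 g)).choose_spec
    obtain ⟨hs, ht, h₁, h₂⟩ := (AtlasQuotient.exists_inv h𝓤 g).choose_spec
    exact h₁.eq h𝓤 h₀'' ((AtlasQuotient.mul_spec h𝓤 _ g hs).1.trans h₀.symm)
  mul_inv g := by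
    obtain ⟨h₀, h₀', h₀''⟩ :=
      (AtlasQuotient.exists_one h𝓤 (AtlasQuotient.target 𝓤 g)).choose_spec
    obtain ⟨hs, ht, h₁, h₂⟩ := (AtlasQuotient.exists_inv h𝓤 g).choose_spec
    exact h₂.eq h𝓤 h₀'' ((AtlasQuotient.mul_spec h𝓤 g _ ht.symm).1.trans (hs.trans h₀.symm))

end AtlasGroupoid

end

end HolonomyGroupoid

theorem mainTheorem2 {m : ℕ} {M : Type u} [TopologicalSpace M] [T2Space M]
    [SecondCountableTopology M] [ChartedSpace (HolonomyGroupoid.Euc m) M] [IsManifold (𝓡 m) ∞ M]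
    (𝓕 : HolonomyGroupoid.Foliation m M) {ι : Type w}
    (𝓤 : ι → HolonomyGroupoid.SubmersionPair.{u, v} m M)
    (h𝓤 : HolonomyGroupoid.IsAtlas 𝓕 𝓤) :
    Equivalence (HolonomyGroupoid.atlasRel 𝓤) ∧
    ∃ s t : HolonomyGroupoid.AtlasQuotient 𝓤 → M,
      (∀ i u, s (HolonomyGroupoid.atlasQuotientMap 𝓤 i u) = (𝓤 i).s u ∧
        t (HolonomyGroupoid.atlasQuotientMap 𝓤 i u) = (𝓤 i).t u) ∧
      ∃ q : ∀ U : HolonomyGroupoid.SubmersionPair.{u, v} m M,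
          HolonomyGroupoid.IsBiSubmersion 𝓕 U → HolonomyGroupoid.IsAdapted 𝓤 U →
            U.carrier → HolonomyGroupoid.AtlasQuotient 𝓤,
        (∀ U hU hU', ∀ (i : ι) (U' : Set U.carrier) (f : U.carrier → (𝓤 i).carrier),
          HolonomyGroupoid.IsLocalMorphism U (𝓤 i) U' f →
            ∀ u ∈ U', q U hU hU' u = HolonomyGroupoid.atlasQuotientMap 𝓤 i (f u)) ∧
        ∃ 𝒢 : HolonomyGroupoid.GroupoidStructure s t,
          ∀ i j : ι, ∃ hW : HolonomyGroupoid.IsBiSubmersion 𝓕 ((𝓤 i).comp (𝓤 j)),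
            ∀ (u : (𝓤 i).carrier) (v : (𝓤 j).carrier) (huv : (𝓤 i).s u = (𝓤 j).t v),
              ∃ e : s (HolonomyGroupoid.atlasQuotientMap 𝓤 i u) =
                  t (HolonomyGroupoid.atlasQuotientMap 𝓤 j v),
                𝒢.mul (HolonomyGroupoid.atlasQuotientMap 𝓤 i u)
                  (HolonomyGroupoid.atlasQuotientMap 𝓤 j v) e =
                  q ((𝓤 i).comp (𝓤 j)) hW (h𝓤.isAdapted_comp i j) ⟨(u, v), huv⟩ := by
  refine ⟨HolonomyGroupoid.equivalence_atlasRel h𝓤, HolonomyGroupoid.AtlasQuotient.source 𝓤,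
    HolonomyGroupoid.AtlasQuotient.target 𝓤, fun i u => ⟨rfl, rfl⟩,
    fun U _ hU' => HolonomyGroupoid.adaptedMap hU',
    fun U _ hU' i U' f hf u hu => HolonomyGroupoid.adaptedMap_eq h𝓤 hU' hf hu,
    HolonomyGroupoid.atlasGroupoid h𝓤, fun i j =>
      ⟨(h𝓤.isBiSubmersion i).comp (h𝓤.isBiSubmersion j), fun u v huv =>
        ⟨huv, HolonomyGroupoid.AtlasQuotient.mul_mk h𝓤 huv⟩⟩⟩
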